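/- Let $N\ge 1$, $\Omega=\{x=(x',x_N)\in\mathbb R^{N}: x_N>0\}$, and write $P(x,z)=x+\eta(x,z)$ for a jump function $\eta:\overline\Omega\times\mathbb R^N\to\mathbb R^N$ with $\eta(x,\cdot)$ Borel measurable for every $x\in\overline\Omega$. Assume: * $(\mathrm H_\mu)$ $\mu=c\,\mu_*+\mu_\#$ with $c\in\{0,1\}$ and nonnegative Borel measures $\mu_*,\mu_\#$, where $\mu_*$ is symmetric (invariant under all sign changes and all permutations of the coordinates), $\int(|z|^2\wedge1)\,d\mu_*<\infty$, $\int_{|z|<1}|z|\,d\mu_*=\infty$ and $\int(1\wedge|z|)\,d\mu_\#<\infty$. * $(\mathrm H_\eta^0)$ $P(x,z)_N\ge0$ for all $x\in\overline\Omega$, $z\in\mathbb R^N$, and $\eta(x,z)=z$ whenever $x_N+z_N>0$. * $(\mathrm H_\eta^1)$ $|\eta(x,z)|\le c_\eta|z|$ for all $x\in\overline\Omega$, $z$, with a constant $c_\eta>0$. * $(\mathrm H_\eta^2)$ $\eta(x,\sigma_iz)_i=-\eta(x,z)_i$ for $i=1,\dots,N-1$, where $\sigma_i$ changes the sign of the $i$-th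 coordinate. * $(\mathrm H_\eta^3)$ For each $x\in\overline\Omega$: $\eta(y,z)\to\eta(x,z)$ as $\overline\Omega\ni y\to x$, for $\mu$-a.e. $z$. * $(\mathrm H_\eta^4)$ $|\eta(x',s,z)'-\eta(y',s,z)'|\le C|z||x'-y'|$ for all $x',y',z$ and $s>0$, with a constant $C$. * $(\mathrm H_\eta^5)$ $|P(x,z)_N-P(y,z)_N|\le|x_N-y_N|$ for all $x,y\in\overline\Omega$ and $z$. For $f\in C_b(\overline\Omega)$ consider the problem $$u(x)-I[u](x)-f(x)=0\ \text{ in }\Omega,\qquad -\frac{\partial u}{\partial x_N}=0\ \text{ on }\partial\Omega,\tag{E}$$ where $I[u](x)=\mathrm{P.V.}\int [u(P(x,z))-u(x)]\,d\mu(z)$. For $\delta>0$ put $$I^\delta[w](x)=\int_{|z|\ge\delta}[w(P(x,z))-w(x)]\,d\mu(z),\qquad I_\delta[\phi](x)=\lim_{b\to0^+}\int_{b<|z|<\delta}[\phi(P(x,z))-\phi(x)]\,d\mu(z).$$ A bounded usc function $u:\overline\Omega\to\mathbb R$ is a viscosity subsolution of (E) with data $f$ if for all $\delta>0$, all $\phi\in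 C^2(\mathbb R^N)$ and every $x\in\overline\Omega$ at which $u-\phi$ attains its maximum over $B(x,c_\eta\delta)\cap\overline\Omega$: $u(x)-I_\delta[\phi](x)-I^\delta[u](x)-f(x)\le0$ if $x\in\Omega$, or if $x\in\partial\Omega$ and $c=0$; and $-\frac{\partial\phi}{\partial x_N}(x)\le0$ if $x\in\partial\Omega$ and $c=1$. Viscosity supersolutions are bounded lsc functions defined in the same way with minima and reversed inequalities, and a viscosity solution is both a sub- and a supersolution. Then: 1. (Comparison) If $f,g\in C_b(\overline\Omega)$, $f\le g$ in $\overline\Omega$, $u$ is a bounded usc viscosity subsolution of (E) with data $f$ and $v$ is a bounded lsc viscosity supersolution of (E) with data $g$, then $u\le v$ in $\overline\Omega$. 2. (Well-posedness) For every $f\in C_b(\overline\Omega)$ there is a unique viscosity solution $u_f$ of (E) on $\overline\Omega$, and $f\mapsto u_f$ is continuous for the supremum norm on $\overline\Omega$. 3. (Examples) Let $\eta(x,z)=z$ if $x_N+z_N\ge0$ and, otherwise, let $\eta(x,z)$ be one of (b) $z\,x_N/|z_N|$, (c) $(z',-x_N)$, (d) $(z',-2x_N-z_N)$. Each of these three jump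 functions satisfies $(\mathrm H_\eta^0)$–$(\mathrm H_\eta^5)$ (for a suitable $c_\eta$), for every $\mu$ satisfying $(\mathrm H_\mu)$. -/

import Mathlib

open MeasureTheory Set Filter Topology

noncomputable section

namespace NonlocalNeumann

/-- The space `ℝ^N` with `N = n + 1 ≥ 1`. -/
abbrev E (n : ℕ) : Type := EuclideanSpace ℝ (Fin (n + 1))

/-- The normal coordinate `x_N`. -/
def nor {n : ℕ} (x : E n) : ℝ := x (Fin.last n)

/-- The tangential part `x' = (x_1, …, x_{N-1})`. -/
def tang {n : ℕ} (x : E n) : EuclideanSpace ℝ (Fin n) :=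
  WithLp.toLp 2 (fun i : Fin n => x i.castSucc)

/-- The point of `ℝ^N` with tangential part `p` and normal coordinate `s`. -/
def ofParts {n : ℕ} (p : EuclideanSpace ℝ (Fin n)) (s : ℝ) : E n :=
  WithLp.toLp 2 (Fin.snoc (α := fun _ => ℝ) (fun i => p i) s)

/-- The closed half space `{x_N ≥ 0}`; its interior `Ω` is `{x_N > 0}` and its boundary is
`{x_N = 0}`. -/
def closedHalf (n : ℕ) : Set (E n) := {x | 0 ≤ nor x}

/-- The reflection `σ_i` changing the sign of the `i`-th coordinate. -/
def signFlip {n : ℕ} (i : Fin (n + 1)) (z : E n) : E n :=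
  WithLp.toLp 2 (fun j => if j = i then -(z j) else z j)

/-- The permutation of the coordinates by `e`. -/
def permute {n : ℕ} (e : Equiv.Perm (Fin (n + 1))) (z : E n) : E n :=
  WithLp.toLp 2 (fun j => z (e j))

/-- A measure is symmetric if it is invariant under all sign changes and all permutations of the
coordinates. -/
structure IsSymmetric {n : ℕ} (ν : Measure (E n)) : Prop where
  sign : ∀ i, MeasurePreserving (signFlip i) ν ν
  perm : ∀ e, MeasurePreserving (permute e) ν ν

/-- Assumption (H_μ): `μ = c μ_* + μ_#` with `c ∈ {0, 1}`, where `μ_*` is a symmetric Lévy measure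
with infinite first moment near the origin and `μ_#` integrates `1 ∧ |z|`. The integrability
conditions make the measures locally finite, hence Radon, away from the origin. -/
structure HypMu {n : ℕ} (c : ℕ) (μ μstar μsharp : Measure (E n)) : Prop where
  c_eq : c = 0 ∨ c = 1
  decomposition : μ = c • μstar + μsharp
  symmetric : IsSymmetric μstar
  levy : ∫⁻ z, ENNReal.ofReal (min (‖z‖ ^ 2) 1) ∂μstar < ⊤
  singular : ∫⁻ z in {z : E n | ‖z‖ < 1}, ENNReal.ofReal ‖z‖ ∂μstar = ⊤
  first_moment : ∫⁻ z, ENNReal.ofReal (min 1 ‖z‖) ∂μsharp < ⊤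

/-- Assumption (H_f): `f` is bounded and continuous on the closed half space. -/
structure HypF {n : ℕ} (f : E n → ℝ) : Prop where
  continuousOn : ContinuousOn f (closedHalf n)
  bounded : ∃ K : ℝ, ∀ x ∈ closedHalf n, |f x| ≤ K

/-- Assumptions (H_η^0), …, (H_η^5) on the jump function `η`, where `x + η x z` is the landing
point of a jump `z` from `x`. The values of `η` at points outside the closed half space play
no role. -/
structure HypEta {n : ℕ} (μ : Measure (E n)) (η : E n → E n → E n) (cη : ℝ) : Prop where
  measurable : ∀ x ∈ closedHalf n, Measurable (η x)
  stays_inside : ∀ x ∈ closedHalf n, ∀ z, x + η x z ∈ closedHalf n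
  eq_self : ∀ x ∈ closedHalf n, ∀ z, 0 < nor x + nor z → η x z = z
  growth_pos : 0 < cη
  growth : ∀ x ∈ closedHalf n, ∀ z, ‖η x z‖ ≤ cη * ‖z‖
  antisymm : ∀ x ∈ closedHalf n, ∀ z, ∀ i : Fin n,
    (η x (signFlip i.castSucc z)) i.castSucc = -((η x z) i.castSucc)
  weak_continuity : ∀ x ∈ closedHalf n, ∀ᵐ z ∂μ,
    Tendsto (fun y => η y z) (𝓝[closedHalf n] x) (𝓝 (η x z))
  tangential_lipschitz : ∃ C : ℝ, ∀ (p q : EuclideanSpace ℝ (Fin n)) (s : ℝ) (z : E n), 0 < s →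
    ‖tang (η (ofParts p s) z) - tang (η (ofParts q s) z)‖ ≤ C * ‖z‖ * ‖p - q‖
  normal_contraction : ∀ x ∈ closedHalf n, ∀ y ∈ closedHalf n, ∀ z,
    |nor (x + η x z) - nor (y + η y z)| ≤ |nor x - nor y|

/-- `I^δ[w](x)`, the contribution of the jumps with `|z| ≥ δ`. -/
def largeJumps {n : ℕ} (μ : Measure (E n)) (η : E n → E n → E n) (δ : ℝ) (w : E n → ℝ)
    (x : E n) : ℝ :=
  ∫ z in {z : E n | δ ≤ ‖z‖}, (w (x + η x z) - w x) ∂μ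

/-- `L` is the value of `I_δ[φ](x)`, the contribution of the jumps with `|z| < δ`, understood as a
principal value at `z = 0`. -/
def HasSmallJumps {n : ℕ} (μ : Measure (E n)) (η : E n → E n → E n) (δ : ℝ) (φ : E n → ℝ)
    (x : E n) (L : ℝ) : Prop :=
  Tendsto (fun b : ℝ => ∫ z in {z : E n | b < ‖z‖ ∧ ‖z‖ < δ}, (φ (x + η x z) - φ x) ∂μ)
    (𝓝[>] 0) (𝓝 L)

/-- The nonlinearity `F(x, r, l) = r - l - f(x)`. -/
def F {n : ℕ} (f : E n → ℝ) (x : E n) (r l : ℝ) : ℝ := r - l - f x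

/-- The partial derivative `∂φ/∂x_N`. -/
def normalDeriv {n : ℕ} (φ : E n → ℝ) (x : E n) : ℝ :=
  fderiv ℝ φ x (EuclideanSpace.single (Fin.last n) 1)

/-- Bounded usc viscosity subsolutions of `u - I[u] - f = 0` in `Ω`, `-∂u/∂x_N = 0` on `∂Ω`. The
equation is imposed in `Ω`, and also on `∂Ω` if `c = 0`; the boundary condition is imposed on `∂Ω`
if `c = 1`. -/
structure IsSubsolution {n : ℕ} (c : ℕ) (μ : Measure (E n)) (η : E n → E n → E n) (cη : ℝ)
    (f u : E n → ℝ) : Prop where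
  bounded : ∃ K : ℝ, ∀ x ∈ closedHalf n, |u x| ≤ K
  usc : UpperSemicontinuousOn u (closedHalf n)
  equation : ∀ (δ : ℝ) (φ : E n → ℝ) (x : E n), 0 < δ → ContDiff ℝ 2 φ → x ∈ closedHalf n →
    IsMaxOn (fun y => u y - φ y) (Metric.ball x (cη * δ) ∩ closedHalf n) x →
    (0 < nor x ∨ c = 0) →
    ∃ L, HasSmallJumps μ η δ φ x L ∧ F f x (u x) (L + largeJumps μ η δ u x) ≤ 0
  boundary : ∀ (δ : ℝ) (φ : E n → ℝ) (x : E n), 0 < δ → ContDiff ℝ 2 φ → nor x = 0 → c = 1 →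
    IsMaxOn (fun y => u y - φ y) (Metric.ball x (cη * δ) ∩ closedHalf n) x →
    -normalDeriv φ x ≤ 0

/-- Bounded lsc viscosity supersolutions of the same problem. -/
structure IsSupersolution {n : ℕ} (c : ℕ) (μ : Measure (E n)) (η : E n → E n → E n) (cη : ℝ)
    (f v : E n → ℝ) : Prop where
  bounded : ∃ K : ℝ, ∀ x ∈ closedHalf n, |v x| ≤ K
  lsc : LowerSemicontinuousOn v (closedHalf n)
  equation : ∀ (δ : ℝ) (φ : E n → ℝ) (x : E n), 0 < δ → ContDiff ℝ 2 φ → x ∈ closedHalf n →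
    IsMinOn (fun y => v y - φ y) (Metric.ball x (cη * δ) ∩ closedHalf n) x →
    (0 < nor x ∨ c = 0) →
    ∃ L, HasSmallJumps μ η δ φ x L ∧ 0 ≤ F f x (v x) (L + largeJumps μ η δ v x)
  boundary : ∀ (δ : ℝ) (φ : E n → ℝ) (x : E n), 0 < δ → ContDiff ℝ 2 φ → nor x = 0 → c = 1 →
    IsMinOn (fun y => v y - φ y) (Metric.ball x (cη * δ) ∩ closedHalf n) x →
    0 ≤ -normalDeriv φ x

/-- A viscosity solution is both a sub- and a supersolution. -/
def IsSolution {n : ℕ} (c : ℕ) (μ : Measure (E n)) (η : E n → E n → E n) (cη : ℝ)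
    (f u : E n → ℝ) : Prop :=
  IsSubsolution c μ η cη f u ∧ IsSupersolution c μ η cη f u

open Classical in
/-- Fleas on the window: an outside jump is stopped where its path hits the boundary. -/
def fleas {n : ℕ} (x z : E n) : E n :=
  if 0 ≤ nor x + nor z then z else (nor x / |nor z|) • z

open Classical in
/-- Normal projection: an outside jump lands at the projection onto the boundary. -/
def normalProjection {n : ℕ} (x z : E n) : E n :=
  if 0 ≤ nor x + nor z then z else ofParts (tang z) (-nor x)

open Classical in
/-- Mirror reflection: an outside jump lands at the mirror image of its end point. -/
def mirror {n : ℕ} (x z : E n) : E n :=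
  if 0 ≤ nor x + nor z then z else ofParts (tang z) (-2 * nor x - nor z)

end NonlocalNeumann

end

/-! Write `ν` for c μ_* and `σ` for μ_#.

Comparison. Replacing `v` by `-v`, it is enough that `u₁ + u₂ ≤ 0` for two subsolutions whose data
satisfy `f₁ + f₂ ≤ 0` (`add_nonpos`). Doubling of variables needs no matrix lemma here: at a global
maximum point the test function enters only through the jumps with |z| < δ, whose contribution
vanishes as δ → 0, so inequalities with integrals of `u₁`, `u₂` alone remain
(`IsSubsolution.eventually_le`). The quantity maximized is u₁(x) + u₂(y) − Kχ(x) − Kχ(y) − α|x−y|² −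
γ(x_N−y_N)². The bounded function χ (`cutoff`) gives compactness, and since it is centred at e_N it
makes the normal derivative of the test function strictly negative on the boundary, which rules out
the Neumann condition at maximum points.

Adding the two inequalities leaves the increment of the penalization. Its normal part is nonpositive
because landing heights contract. The first-order tangential part of the small jumps has zero
`ν`-integral by symmetry, so only `tangErr`, quadratic in the small jumps for `ν`, survives. The
tangential Lipschitz bound compares points of equal height only, and between different heights `η`
is merely continuous for a.e. jump. Hence γ → ∞ with α fixed comes first, by continuity of
`tangErr`, and then α → ∞, with α|x−y|² → 0.

The cost of χ is the drift η_N − z_N ≥ 0 created by reflection. Its `ν`-integral can blow up at the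
boundary, but it vanishes unless |z| ≥ x_N, so it becomes of second order when multiplied by x_N;
and ∂χ/∂x_N ≤ 2βx_N.

Existence. Without the jumps shorter than b the measure is finite and a contraction solves the
problem (`exists_truncated_solution`). The half-relaxed limits as b → 0 are a sub- and a
supersolution (`isSubsolution_upperLimit`), and comparison makes them equal. The truncated problems
carry no boundary condition. For c = 1 it emerges in the limit, because the normal drift diverges at
the boundary (`eventually_lt_normal_drift`) and would drive bounded solutions to infinity if ∂φ/∂x_N
had the wrong sign.

Continuity in the data holds because constants are invisible to the operator. In the examples the
landing height is max(s+t, 0) or |s+t|, both 1-Lipschitz in the starting height s. -/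

namespace NonlocalNeumann

variable {n : ℕ}

/-! ### Coordinates -/

/-- The unit vector `e_N`. -/
noncomputable def unitN (n : ℕ) : E n := EuclideanSpace.single (Fin.last n) 1

@[simp] lemma nor_add (x y : E n) : nor (x + y) = nor x + nor y := rfl

@[simp] lemma nor_sub (x y : E n) : nor (x - y) = nor x - nor y := rfl

@[simp] lemma nor_smul (a : ℝ) (x : E n) : nor (a • x) = a * nor x := rfl

@[simp] lemma nor_unitN : nor (unitN n) = 1 := by simp [nor, unitN]

@[simp] lemma nor_ofParts (p : EuclideanSpace ℝ (Fin n)) (s : ℝ) : nor (ofParts p s) = s := by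
  simp [nor, ofParts]

@[simp] lemma tang_ofParts (p : EuclideanSpace ℝ (Fin n)) (s : ℝ) : tang (ofParts p s) = p := by
  ext i; simp [tang, ofParts]

@[simp] lemma ofParts_tang_nor (x : E n) : ofParts (tang x) (nor x) = x := by
  ext i
  refine Fin.lastCases ?_ (fun j => ?_) i <;> simp [tang, ofParts, nor]

@[simp] lemma tang_apply (x : E n) (i : Fin n) : tang x i = x i.castSucc := rfl

lemma tang_add (x y : E n) : tang (x + y) = tang x + tang y := rfl

lemma tang_sub (x y : E n) : tang (x - y) = tang x - tang y := rfl

lemma continuous_nor : Continuous (nor : E n → ℝ) := by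
  unfold nor; fun_prop

lemma continuous_tang : Continuous (tang : E n → EuclideanSpace ℝ (Fin n)) := by
  unfold tang
  exact (PiLp.continuous_toLp 2 _).comp (by fun_prop)

lemma continuous_ofParts (p : EuclideanSpace ℝ (Fin n)) : Continuous (ofParts p : ℝ → E n) := by
  unfold ofParts
  refine (PiLp.continuous_toLp 2 _).comp (continuous_pi fun i => ?_)
  refine Fin.lastCases ?_ (fun j => ?_) i <;> simp <;> fun_prop

lemma norm_sq_eq_tang_add_nor (x : E n) : ‖x‖ ^ 2 = ‖tang x‖ ^ 2 + nor x ^ 2 := by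
  simp [EuclideanSpace.norm_sq_eq, Fin.sum_univ_castSucc, nor]

lemma abs_nor_le (x : E n) : |nor x| ≤ ‖x‖ := by
  refine abs_le_of_sq_le_sq ?_ (norm_nonneg _)
  nlinarith [norm_sq_eq_tang_add_nor x, sq_nonneg ‖tang x‖]

lemma norm_tang_le (x : E n) : ‖tang x‖ ≤ ‖x‖ := by
  apply le_of_sq_le_sq _ (norm_nonneg _)
  nlinarith [norm_sq_eq_tang_add_nor x, sq_nonneg (nor x)]

lemma inner_eq_sum_tang_add_nor (p x : E n) :
    inner ℝ p x = (∑ i : Fin n, p i.castSucc * x i.castSucc) + nor p * nor x := by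
  rw [PiLp.inner_apply, Fin.sum_univ_castSucc]
  simp [nor, mul_comm]

lemma isClosed_closedHalf : IsClosed (closedHalf n) :=
  isClosed_le continuous_const continuous_nor

@[simp] lemma mem_closedHalf {x : E n} : x ∈ closedHalf n ↔ 0 ≤ nor x := Iff.rfl

/-! ### Symmetric measures -/

@[simp] lemma signFlip_signFlip (i : Fin (n + 1)) (z : E n) : signFlip i (signFlip i z) = z := by
  ext j; by_cases h : j = i <;> simp [signFlip, h]

@[simp] lemma norm_signFlip (i : Fin (n + 1)) (z : E n) : ‖signFlip i z‖ = ‖z‖ := by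
  rw [EuclideanSpace.norm_eq, EuclideanSpace.norm_eq]
  congr 1
  refine Finset.sum_congr rfl fun j _ => ?_
  by_cases h : j = i <;> simp [signFlip, h]

@[simp] lemma norm_permute (e : Equiv.Perm (Fin (n + 1))) (z : E n) : ‖permute e z‖ = ‖z‖ := by
  rw [EuclideanSpace.norm_eq, EuclideanSpace.norm_eq]
  congr 1
  exact Equiv.sum_comp e (fun j => ‖z j‖ ^ 2)

@[simp] lemma signFlip_apply_self (i : Fin (n + 1)) (z : E n) : signFlip i z i = -z i := by
  simp [signFlip]

@[simp] lemma nor_signFlip_last (z : E n) : nor (signFlip (Fin.last n) z) = -nor z := by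
  simp [signFlip, nor]

lemma continuous_signFlip (i : Fin (n + 1)) : Continuous (signFlip i : E n → E n) := by
  unfold signFlip
  refine (PiLp.continuous_toLp 2 _).comp (continuous_pi fun j => ?_)
  by_cases h : j = i <;> simp [h] <;> fun_prop

/-- Sign changes as measurable equivalences. -/
noncomputable def signFlipEquiv (i : Fin (n + 1)) : E n ≃ᵐ E n where
  toFun := signFlip i
  invFun := signFlip i
  left_inv := signFlip_signFlip i
  right_inv := signFlip_signFlip i
  measurable_toFun := (continuous_signFlip i).measurable
  measurable_invFun := (continuous_signFlip i).measurable

/-- The set of jumps with size in `J`. -/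
def shell (n : ℕ) (J : Set ℝ) : Set (E n) := {z | ‖z‖ ∈ J}

lemma measurableSet_shell {J : Set ℝ} (hJ : MeasurableSet J) : MeasurableSet (shell n J) :=
  measurable_norm hJ

/-- Shells are invariant under the sign change, so the change of variables shows that the integral
equals its own negative. No integrability is needed. -/
lemma IsSymmetric.setIntegral_eq_zero {ν : Measure (E n)} (hν : IsSymmetric ν) (i : Fin (n + 1))
    (J : Set ℝ) {g : E n → ℝ} (hg : ∀ z, g (signFlip i z) = -g z) :
    ∫ z in shell n J, g z ∂ν = 0 := by
  have h := (hν.sign i).setIntegral_preimage_emb (signFlipEquiv i).measurableEmbedding g (shell n J)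
  have h2 : signFlip i ⁻¹' shell n J = shell n J := by ext z; simp [shell]
  rw [h2] at h
  simp only [hg, integral_neg] at h
  linarith

/-- The hypotheses on the measures and the jump function, with `ν = c μ_*` and `σ = μ_#`. -/
structure JumpSetting (c : ℕ) (ν σ : Measure (E n)) (η : E n → E n → E n) (cη : ℝ) : Prop where
  c_eq : c = 0 ∨ c = 1
  null : c = 0 → ν = 0
  symmetric : IsSymmetric ν
  levy : Integrable (fun z : E n => min (‖z‖ ^ 2) 1) ν
  first_moment : Integrable (fun z : E n => min 1 ‖z‖) σ
  singular : c = 1 → ∫⁻ z in {z : E n | ‖z‖ < 1}, ENNReal.ofReal ‖z‖ ∂ν = ⊤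
  eta : HypEta (ν + σ) η cη

lemma integrable_of_lintegral_ofReal {α : Type*} [MeasurableSpace α] {ν : Measure α} {g : α → ℝ}
    (hm : Measurable g) (h0 : ∀ z, 0 ≤ g z) (h : ∫⁻ z, ENNReal.ofReal (g z) ∂ν < ⊤) :
    Integrable g ν :=
  ⟨hm.aestronglyMeasurable, (hasFiniteIntegral_iff_ofReal (Eventually.of_forall h0)).2 h⟩

/-- The factor c is absorbed into `ν`, which is zero when c = 0; afterwards both cases are treated
together. -/
lemma HypMu.exists_jumpSetting {c : ℕ} {μ μstar μsharp : Measure (E n)}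
    (h : HypMu c μ μstar μsharp) :
    ∃ ν : Measure (E n), μ = ν + μsharp ∧ ∀ η cη, HypEta μ η cη → JumpSetting c ν μsharp η cη := by
  have hf := integrable_of_lintegral_ofReal (by fun_prop) (fun z => by positivity) h.first_moment
  have hl := integrable_of_lintegral_ofReal (by fun_prop) (fun z => by positivity) h.levy
  rcases h.c_eq with rfl | rfl
  · have hd : μ = 0 + μsharp := by simpa using h.decomposition
    refine ⟨0, hd, fun η cη hη => ?_⟩
    refine ⟨Or.inl rfl, fun _ => rfl, ⟨fun i => ?_, fun e => ?_⟩, integrable_zero_measure, hf,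
      by simp, hd ▸ hη⟩
    · exact ⟨(h.symmetric.sign i).measurable, by simp⟩
    · exact ⟨(h.symmetric.perm e).measurable, by simp⟩
  · have hd : μ = μstar + μsharp := by simpa using h.decomposition
    exact ⟨μstar, hd, fun η cη hη => ⟨Or.inr rfl, by simp, h.symmetric, hl, hf,
      fun _ => h.singular, hd ▸ hη⟩⟩

/-! ### Integrability of jumps away from the origin. -/

namespace JumpSetting

variable {c : ℕ} {ν σ : Measure (E n)} {η : E n → E n → E n} {cη : ℝ}

lemma measure_levy_lt_top (h : JumpSetting c ν σ η cη) {b : ℝ} (hb : 0 < b) :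
    ν {z | b ≤ ‖z‖} < ⊤ := by
  have hb' : 0 < min (b ^ 2) 1 := by positivity
  refine lt_of_le_of_lt (measure_mono fun z hz => ?_) (h.levy.measure_ge_lt_top hb')
  simp only [mem_ofPred_eq] at hz ⊢
  gcongr

lemma measure_first_lt_top (h : JumpSetting c ν σ η cη) {b : ℝ} (hb : 0 < b) :
    σ {z | b ≤ ‖z‖} < ⊤ := by
  have hb' : 0 < min 1 b := by positivity
  refine lt_of_le_of_lt (measure_mono fun z hz => ?_) (h.first_moment.measure_ge_lt_top hb')
  simp only [mem_ofPred_eq] at hz ⊢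
  gcongr

lemma measure_shell_lt_top (h : JumpSetting c ν σ η cη) {b : ℝ} (hb : 0 < b) {J : Set ℝ}
    (hJ : J ⊆ Ici b) : ν (shell n J) < ⊤ ∧ σ (shell n J) < ⊤ :=
  ⟨lt_of_le_of_lt (measure_mono fun _ hz => hJ hz) (h.measure_levy_lt_top hb),
    lt_of_le_of_lt (measure_mono fun _ hz => hJ hz) (h.measure_first_lt_top hb)⟩

/-- Measurable functions bounded on a set of jumps bounded away from zero are integrable there. -/
lemma integrableOn_shell (h : JumpSetting c ν σ η cη) {b : ℝ} (hb : 0 < b) {J : Set ℝ}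
    (hJm : MeasurableSet J) (hJ : J ⊆ Ici b) {g : E n → ℝ} (hg : Measurable g) {K : ℝ}
    (hK : ∀ z ∈ shell n J, |g z| ≤ K) :
    IntegrableOn g (shell n J) ν ∧ IntegrableOn g (shell n J) σ := by
  obtain ⟨h1, h2⟩ := h.measure_shell_lt_top hb hJ
  exact ⟨IntegrableOn.of_bound h1 hg.aestronglyMeasurable K
      ((ae_restrict_iff' (measurableSet_shell hJm)).2 (Eventually.of_forall hK)),
    IntegrableOn.of_bound h2 hg.aestronglyMeasurable K
      ((ae_restrict_iff' (measurableSet_shell hJm)).2 (Eventually.of_forall hK))⟩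

lemma setIntegral_add_measure {S : Set (E n)} {g : E n → ℝ} (h1 : IntegrableOn g S ν)
    (h2 : IntegrableOn g S σ) : ∫ z in S, g z ∂(ν + σ) = ∫ z in S, g z ∂ν + ∫ z in S, g z ∂σ := by
  rw [Measure.restrict_add, integral_add_measure h1 h2]

lemma setIntegral_le_integral_of_le {τ : Measure (E n)} {S : Set (E n)} {g G : E n → ℝ}
    (hS : MeasurableSet S) (hg : IntegrableOn g S τ) (hG : Integrable G τ)
    (hle : ∀ z ∈ S, g z ≤ G z) (h0 : ∀ z, 0 ≤ G z) : ∫ z in S, g z ∂τ ≤ ∫ z, G z ∂τ :=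
  (setIntegral_mono_on hg hG.integrableOn hS hle).trans
    (MeasureTheory.setIntegral_le_integral hG (Eventually.of_forall h0))

/-! ### The jump function -/

lemma nor_eta_ge_neg (h : JumpSetting c ν σ η cη) {x : E n} (hx : x ∈ closedHalf n) (z : E n) :
    -nor x ≤ nor (η x z) := by
  have := h.eta.stays_inside x hx z
  simp at this; linarith

/-- Reflection only pushes inwards: a jump that is modified has z_N ≤ −x_N, and landing in the
closed half space forces η_N ≥ −x_N. -/
lemma nor_eta_ge (h : JumpSetting c ν σ η cη) {x : E n} (hx : x ∈ closedHalf n) (z : E n) :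
    nor z ≤ nor (η x z) := by
  by_cases hz : 0 < nor x + nor z
  · rw [h.eta.eq_self x hx z hz]
  · linarith [h.nor_eta_ge_neg hx z]

lemma eta_eq_self_of_norm_lt (h : JumpSetting c ν σ η cη) {x : E n} (hx : x ∈ closedHalf n)
    {z : E n} (hz : ‖z‖ < nor x) : η x z = z :=
  h.eta.eq_self x hx z (by linarith [neg_abs_le (nor z), abs_nor_le z])

/-- The drift η_N − z_N is of first order in |z|, but it is nonzero only if x_N ≤ |z|; the factor
x_N therefore supplies the second power that `ν` can integrate. -/
lemma abs_nor_eta_sub_le (h : JumpSetting c ν σ η cη) {x : E n} (hx : x ∈ closedHalf n) (z : E n) :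
    nor x * (nor (η x z) - nor z) ≤ (1 + cη) * ‖z‖ ^ 2 := by
  have hc := h.eta.growth_pos
  by_cases hz : 0 < nor x + nor z
  · rw [h.eta.eq_self x hx z hz]; simp; positivity
  · have h1 : nor x ≤ ‖z‖ := by linarith [neg_abs_le (nor z), abs_nor_le z]
    have h2 : nor (η x z) - nor z ≤ (1 + cη) * ‖z‖ := by
      have := (le_abs_self _).trans ((abs_nor_le (η x z)).trans (h.eta.growth x hx z))
      linarith [neg_abs_le (nor z), abs_nor_le z]
    have h3 := h.nor_eta_ge hx z
    calc nor x * (nor (η x z) - nor z) ≤ ‖z‖ * ((1 + cη) * ‖z‖) := by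
          apply mul_le_mul h1 h2 (by linarith) (norm_nonneg _)
      _ = _ := by ring

lemma measurable_eta_apply (h : JumpSetting c ν σ η cη) {x : E n} (hx : x ∈ closedHalf n)
    (i : Fin (n + 1)) : Measurable (fun z => η x z i) := by
  have := h.eta.measurable x hx
  fun_prop

lemma abs_eta_apply_le (h : JumpSetting c ν σ η cη) {x : E n} (hx : x ∈ closedHalf n)
    (i : Fin (n + 1)) (z : E n) : |η x z i| ≤ cη * ‖z‖ :=
  (PiLp.norm_apply_le (η x z) i).trans (h.eta.growth x hx z)

lemma setIntegral_tang_eq_zero (h : JumpSetting c ν σ η cη) {x : E n} (hx : x ∈ closedHalf n)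
    (i : Fin n) (J : Set ℝ) : ∫ z in shell n J, η x z i.castSucc ∂ν = 0 :=
  h.symmetric.setIntegral_eq_zero i.castSucc J fun z => h.eta.antisymm x hx z i

lemma setIntegral_nor_eq_zero (h : JumpSetting c ν σ η cη) (J : Set ℝ) :
    ∫ z in shell n J, nor z ∂ν = 0 :=
  h.symmetric.setIntegral_eq_zero (Fin.last n) J fun z => nor_signFlip_last z

/-- On shells of the unit ball the first-order term only sees the normal component. -/
lemma setIntegral_inner_eta (h : JumpSetting c ν σ η cη) {x : E n} (hx : x ∈ closedHalf n)
    {b : ℝ} (hb : 0 < b) {R : ℝ} {J : Set ℝ} (hJm : MeasurableSet J) (hJ : J ⊆ Ico b R) (p : E n) :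
    ∫ z in shell n J, inner ℝ p (η x z) ∂ν
      = nor p * ∫ z in shell n J, (nor (η x z) - nor z) ∂ν := by
  have hJ' : J ⊆ Ici b := fun r hr => (hJ hr).1
  have hR : ∀ z ∈ shell n J, ‖z‖ ≤ R := fun z hz => (hJ hz).2.le
  have hi : ∀ i, IntegrableOn (fun z => η x z i) (shell n J) ν := fun i =>
    (h.integrableOn_shell hb hJm hJ' (h.measurable_eta_apply hx i) (K := cη * R) fun z hz =>
      (h.abs_eta_apply_le hx i z).trans
        (mul_le_mul_of_nonneg_left (hR z hz) h.eta.growth_pos.le)).1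
  have hz : IntegrableOn (fun z => nor z) (shell n J) ν :=
    (h.integrableOn_shell hb hJm hJ' continuous_nor.measurable (K := R) fun z hz =>
      (abs_nor_le z).trans (hR z hz)).1
  have hn : IntegrableOn (fun z => nor (η x z)) (shell n J) ν := hi (Fin.last n)
  simp_rw [inner_eq_sum_tang_add_nor]
  rw [integral_add (integrable_finsetSum _ fun i _ => (hi i.castSucc).const_mul _)
    (hn.const_mul _), integral_finsetSum _ fun i _ => (hi i.castSucc).const_mul _]
  simp_rw [integral_const_mul]
  rw [integral_sub hn hz, h.setIntegral_nor_eq_zero]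
  simp [h.setIntegral_tang_eq_zero hx]

/-- A one-sided bound uniform in the inner radius b and in the distance to the boundary. It is
available because the normal component of `p` is at most proportional to x_N, and it is applied to
the gradient of the cut-off function. -/
lemma setIntegral_inner_eta_le (h : JumpSetting c ν σ η cη) {x : E n} (hx : x ∈ closedHalf n)
    {b : ℝ} (hb : 0 < b) {J : Set ℝ} (hJm : MeasurableSet J) (hJ : J ⊆ Ico b 1) {p : E n}
    {B : ℝ} (hB : 0 ≤ B) (hp : nor p ≤ B * nor x) :
    ∫ z in shell n J, inner ℝ p (η x z) ∂ν
      ≤ B * (1 + cη) * ∫ z, min (‖z‖ ^ 2) 1 ∂ν := by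
  have hc := h.eta.growth_pos
  rw [h.setIntegral_inner_eta hx hb hJm hJ, ← integral_const_mul, ← integral_const_mul]
  have hJ' : J ⊆ Ici b := fun r hr => (hJ hr).1
  refine setIntegral_le_integral_of_le (measurableSet_shell hJm) ?_ (h.levy.const_mul _) ?_
    fun z => by positivity
  · refine Integrable.const_mul (h.integrableOn_shell hb hJm hJ'
      ((h.measurable_eta_apply hx (Fin.last n)).sub continuous_nor.measurable)
      (K := cη + 1) fun z hz => ?_).1 _
    have h1 : ‖z‖ ≤ 1 := (hJ hz).2.le
    refine (abs_sub _ _).trans (add_le_add ((h.abs_eta_apply_le hx _ z).trans ?_)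
      ((abs_nor_le z).trans h1))
    nlinarith
  · intro z hz
    have h1 : ‖z‖ ≤ 1 := (hJ hz).2.le
    rw [min_eq_left (by nlinarith [norm_nonneg z])]
    have h3 := h.nor_eta_ge hx z
    calc nor p * (nor (η x z) - nor z) ≤ (B * nor x) * (nor (η x z) - nor z) := by
          apply mul_le_mul_of_nonneg_right hp (by linarith)
      _ = B * (nor x * (nor (η x z) - nor z)) := by ring
      _ ≤ B * ((1 + cη) * ‖z‖ ^ 2) := by
          apply mul_le_mul_of_nonneg_left (h.abs_nor_eta_sub_le hx z) hB
      _ = _ := by ring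

end JumpSetting

/-! ### Taylor expansions -/

lemma nor_eq_inner (p : E n) : nor p = inner ℝ p (unitN n) := by
  simp [unitN, nor, EuclideanSpace.inner_single_right]

lemma nor_gradient (φ : E n → ℝ) (x : E n) : nor (gradient φ x) = normalDeriv φ x := by
  rw [nor_eq_inner, inner_gradient_left]; rfl

/-- The constants come from local Lipschitz bounds of `φ` and of its derivative, so they are uniform
in the base point. This uniformity serves the stability proof, where base points move. -/
lemma exists_taylor_bound {φ : E n → ℝ} (hφ : ContDiff ℝ 2 φ) (x₀ : E n) :
    ∃ r > 0, ∃ A ≥ 0, ∃ B ≥ 0, ∀ x ∈ Metric.ball x₀ r, ∀ h : E n, ‖h‖ < r →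
      |φ (x + h) - φ x - inner ℝ (gradient φ x) h| ≤ A * ‖h‖ ^ 2 ∧ |φ (x + h) - φ x| ≤ B * ‖h‖ := by
  have h1 : ContDiff ℝ 1 (fderiv ℝ φ) := hφ.fderiv_right (by norm_num)
  obtain ⟨A, s, hs, hA⟩ := h1.contDiffAt.exists_lipschitzOnWith (x := x₀)
  obtain ⟨B, t, ht, hB⟩ := (hφ.of_le (by norm_num)).contDiffAt.exists_lipschitzOnWith (x := x₀)
  obtain ⟨r, hr, hrs⟩ := Metric.mem_nhds_iff.1 (inter_mem hs ht)
  refine ⟨r / 2, by positivity, A, A.2, B, B.2, fun x hx h hh => ?_⟩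
  rw [Metric.mem_ball, dist_eq_norm] at hx
  have hx' : x ∈ Metric.ball x₀ r := by rw [Metric.mem_ball, dist_eq_norm]; linarith
  have hy' : x + h ∈ Metric.ball x₀ r := by
    rw [Metric.mem_ball, dist_eq_norm, add_sub_right_comm]
    linarith [norm_add_le (x - x₀) h]
  constructor
  · have hconv : Convex ℝ (Metric.ball x₀ r ∩ Metric.closedBall x ‖h‖) :=
      (convex_ball _ _).inter (convex_closedBall _ _)
    have := hconv.norm_image_sub_le_of_norm_fderiv_le' (f := φ) (φ := fderiv ℝ φ x)
      (C := A * ‖h‖) (x := x) (y := x + h)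
      (fun y _ => hφ.differentiable (by norm_num) y)
      (fun y hy => by
        rw [← dist_eq_norm]
        refine (hA.dist_le_mul _ (hrs hy.1).1 _ (hrs hx').1).trans ?_
        exact mul_le_mul_of_nonneg_left hy.2 A.2)
      ⟨hx', by simp⟩ ⟨hy', by simp⟩
    rw [add_sub_cancel_left] at this
    rw [inner_gradient_left, pow_two, ← mul_assoc]
    exact this
  · have := hB.dist_le_mul _ (hrs hy').2 _ (hrs hx').2
    simpa [Real.dist_eq, dist_eq_norm] using this

/-! ### Integrals over shrinking shells -/

lemma tendsto_setIntegral_shell_Ioo {τ : Measure (E n)} {g : E n → ℝ} {δ : ℝ}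
    (hg : IntegrableOn g (shell n (Iio δ)) τ) :
    Tendsto (fun b => ∫ z in shell n (Ioo b δ), g z ∂τ) (𝓝[>] 0)
      (𝓝 (∫ z in shell n (Ioo 0 δ), g z ∂τ)) := by
  have hm : ∀ J : Set ℝ, MeasurableSet J → MeasurableSet (shell n J) :=
    fun J => measurableSet_shell
  have hgi := hg.integrable_indicator (hm _ measurableSet_Iio)
  have key : ∀ b, (shell n (Ioo b δ)).indicator g
      = (shell n (Ioi b)).indicator ((shell n (Iio δ)).indicator g) := by
    intro b
    rw [indicator_indicator]; congr 1
  simp_rw [← fun b => integral_indicator (μ := τ) (f := g) (hm (Ioo b δ) measurableSet_Ioo), key]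
  refine tendsto_integral_filter_of_dominated_convergence
    (fun z => |(shell n (Iio δ)).indicator g z|) ?_ ?_ hgi.abs ?_
  · exact Eventually.of_forall fun b =>
      (hgi.indicator (hm _ measurableSet_Ioi)).aestronglyMeasurable
  · exact Eventually.of_forall fun b => Eventually.of_forall fun z =>
      norm_indicator_le_norm_self _ _
  · refine Eventually.of_forall fun z => tendsto_const_nhds.congr' ?_
    by_cases hz : 0 < ‖z‖
    · filter_upwards [Ioo_mem_nhdsGT hz] with b hb
      rw [indicator_of_mem (show z ∈ shell n (Ioi b) from hb.2),
        indicator_of_mem (show z ∈ shell n (Ioi 0) from hz)]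
    · filter_upwards [self_mem_nhdsWithin] with b hb
      rw [indicator_of_notMem (show z ∉ shell n (Ioi b) from fun h => hz (lt_trans hb h)),
        indicator_of_notMem (show z ∉ shell n (Ioi 0) from hz)]

lemma tendsto_setIntegral_shell_zero {τ : Measure (E n)} {g : E n → ℝ} {R : ℝ} (hR : 0 < R)
    (hg : IntegrableOn g (shell n (Iio R)) τ) :
    Tendsto (fun δ => ∫ z in shell n (Ioo 0 δ), g z ∂τ) (𝓝[>] 0) (𝓝 0) := by
  have hm : ∀ J : Set ℝ, MeasurableSet J → MeasurableSet (shell n J) :=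
    fun J => measurableSet_shell
  have hgi := hg.integrable_indicator (hm _ measurableSet_Iio)
  simp_rw [← fun b => integral_indicator (μ := τ) (f := g) (hm (Ioo 0 b) measurableSet_Ioo)]
  have key : ∀ᶠ δ in 𝓝[>] (0 : ℝ), (shell n (Ioo 0 δ)).indicator ((shell n (Iio R)).indicator g)
      = (shell n (Ioo 0 δ)).indicator g := by
    filter_upwards [Ioo_mem_nhdsGT hR] with δ hδ
    rw [indicator_indicator]; congr 1
    exact inter_eq_left.2 fun z hz => lt_trans hz.2 hδ.2
  suffices H : Tendsto (fun δ => ∫ z, (shell n (Ioo 0 δ)).indicator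
      ((shell n (Iio R)).indicator g) z ∂τ) (𝓝[>] 0) (𝓝 (∫ _, 0 ∂τ)) by
    rw [integral_zero] at H
    exact H.congr' (key.mono fun δ h => by simp only [h])
  refine (tendsto_integral_filter_of_dominated_convergence
    (fun z => |(shell n (Iio R)).indicator g z|) ?_ ?_ hgi.abs ?_)
  · exact Eventually.of_forall fun b =>
      (hgi.indicator (hm _ measurableSet_Ioo)).aestronglyMeasurable
  · exact Eventually.of_forall fun b => Eventually.of_forall fun z =>
      norm_indicator_le_norm_self _ _
  · refine Eventually.of_forall fun z => tendsto_const_nhds.congr' ?_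
    by_cases hz : 0 < ‖z‖
    · filter_upwards [Ioo_mem_nhdsGT hz] with b hb
      rw [indicator_of_notMem fun h : z ∈ shell n (Ioo 0 b) => lt_asymm h.2 hb.2]
    · filter_upwards [self_mem_nhdsWithin] with b hb
      rw [indicator_of_notMem fun h : z ∈ shell n (Ioo 0 b) => hz h.1]

/-- The second moment of `ν` on the ball of radius `R`. -/
noncomputable def secondMoment (ν : Measure (E n)) (R : ℝ) : ℝ :=
  ∫ z in shell n (Ioo 0 R), min (‖z‖ ^ 2) 1 ∂ν

/-- The first moment of `σ` on the ball of radius `R`. -/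
noncomputable def firstMoment (σ : Measure (E n)) (R : ℝ) : ℝ :=
  ∫ z in shell n (Ioo 0 R), min 1 ‖z‖ ∂σ

/-! ### Small jumps: one-sided estimates and principal values. -/

namespace JumpSetting

variable {c : ℕ} {ν σ : Measure (E n)} {η : E n → E n → E n} {cη : ℝ}

lemma tendsto_secondMoment (h : JumpSetting c ν σ η cη) :
    Tendsto (secondMoment ν) (𝓝[>] 0) (𝓝 0) :=
  tendsto_setIntegral_shell_zero one_pos h.levy.integrableOn

lemma tendsto_firstMoment (h : JumpSetting c ν σ η cη) :
    Tendsto (firstMoment σ) (𝓝[>] 0) (𝓝 0) :=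
  tendsto_setIntegral_shell_zero one_pos h.first_moment.integrableOn

lemma measurable_comp_jump (h : JumpSetting c ν σ η cη) {x : E n} (hx : x ∈ closedHalf n)
    {w : E n → ℝ} (hw : Measurable ((closedHalf n).domRestrict w)) :
    Measurable (fun z => w (x + η x z)) := by
  have h1 : Measurable fun z => (⟨x + η x z, h.eta.stays_inside x hx z⟩ : closedHalf n) :=
    (measurable_const.add (h.eta.measurable x hx)).subtype_mk
  exact hw.comp h1

/-- One-sided estimate of the contribution of a shell of small jumps. -/
lemma setIntegral_increment_le (h : JumpSetting c ν σ η cη) {x : E n} (hx : x ∈ closedHalf n)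
    {b R : ℝ} (hb : 0 < b) (hR : R ≤ 1) {J : Set ℝ} (hJm : MeasurableSet J) (hJ : J ⊆ Ico b R)
    {w : E n → ℝ} (hw : Measurable ((closedHalf n).domRestrict w)) {K : ℝ}
    (hK : ∀ z ∈ shell n J, |w (x + η x z) - w x| ≤ K) {p : E n} {A B : ℝ} (hA0 : 0 ≤ A)
    (hB0 : 0 ≤ B)
    (hA : ∀ z ∈ shell n J, w (x + η x z) - w x ≤ inner ℝ p (η x z) + A * ‖η x z‖ ^ 2)
    (hB : ∀ z ∈ shell n J, w (x + η x z) - w x ≤ B * ‖η x z‖) :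
    ∫ z in shell n J, (w (x + η x z) - w x) ∂(ν + σ)
      ≤ ∫ z in shell n J, inner ℝ p (η x z) ∂ν + A * cη ^ 2 * secondMoment ν R
        + B * cη * firstMoment σ R := by
  have hc := h.eta.growth_pos
  have hJ' : J ⊆ Ici b := fun r hr => (hJ hr).1
  have hm := measurableSet_shell (n := n) hJm
  have hgr : ∀ z ∈ shell n J, ‖η x z‖ ≤ cη := fun z hz =>
    (h.eta.growth x hx z).trans (by nlinarith [(hJ hz).2])
  have hsub : shell n J ⊆ shell n (Ioo 0 R) := fun z hz => ⟨hb.trans_le (hJ hz).1, (hJ hz).2⟩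
  have hme := h.eta.measurable x hx
  obtain ⟨i1, i2⟩ := h.integrableOn_shell hb hJm hJ'
    ((h.measurable_comp_jump hx hw).sub_const (w x)) hK
  have i3 := (h.integrableOn_shell hb hJm hJ' (g := fun z => inner ℝ p (η x z)) (by fun_prop)
    (K := ‖p‖ * cη) fun z hz => (abs_real_inner_le_norm _ _).trans
      (mul_le_mul_of_nonneg_left (hgr z hz) (norm_nonneg _))).1
  have hl := h.levy.integrableOn (s := shell n (Ioo 0 R))
  have hf := h.first_moment.integrableOn (s := shell n (Ioo 0 R))
  rw [setIntegral_add_measure i1 i2]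
  refine add_le_add ?_ ?_
  · have e1 : ∫ z in shell n J, (w (x + η x z) - w x) ∂ν
        ≤ ∫ z in shell n J, (inner ℝ p (η x z) + A * cη ^ 2 * min (‖z‖ ^ 2) 1) ∂ν := by
      refine setIntegral_mono_on i1 (i3.add ((hl.mono_set hsub).const_mul _)) hm fun z hz => ?_
      refine (hA z hz).trans (add_le_add le_rfl ?_)
      have hz1 : ‖z‖ ≤ 1 := (hJ hz).2.le.trans hR
      rw [min_eq_left (by nlinarith [norm_nonneg z]), mul_assoc, ← mul_pow]
      gcongr
      exact h.eta.growth x hx z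
    rw [integral_add i3 ((hl.mono_set hsub).const_mul _), integral_const_mul] at e1
    refine e1.trans (add_le_add le_rfl (mul_le_mul_of_nonneg_left ?_ (by positivity)))
    exact setIntegral_mono_set hl (Eventually.of_forall fun z => by simp)
      hsub.eventuallyLE
  · have e2 : ∫ z in shell n J, (w (x + η x z) - w x) ∂σ
        ≤ ∫ z in shell n J, B * cη * min 1 ‖z‖ ∂σ := by
      refine setIntegral_mono_on i2 ((hf.mono_set hsub).const_mul _) hm fun z hz => ?_
      refine (hB z hz).trans ?_
      have hz1 : ‖z‖ ≤ 1 := (hJ hz).2.le.trans hR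
      rw [min_eq_right hz1, mul_assoc]
      exact mul_le_mul_of_nonneg_left (h.eta.growth x hx z) hB0
    rw [integral_const_mul] at e2
    refine e2.trans (mul_le_mul_of_nonneg_left ?_ (by positivity))
    exact setIntegral_mono_set hf (Eventually.of_forall fun z => by simp)
      hsub.eventuallyLE

/-- Jumps shorter than x_N do not feel the boundary, so no normal drift is left; the other
alternative, `ν = 0`, is the case c = 0. -/
lemma setIntegral_inner_eta_eq_zero (h : JumpSetting c ν σ η cη) {x : E n}
    (hx : x ∈ closedHalf n) {b R : ℝ} (hb : 0 < b) {J : Set ℝ} (hJm : MeasurableSet J)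
    (hJ : J ⊆ Ico b R) (hR : R ≤ nor x ∨ ν = 0) (p : E n) :
    ∫ z in shell n J, inner ℝ p (η x z) ∂ν = 0 := by
  rcases hR with hR | rfl
  · rw [h.setIntegral_inner_eta hx hb hJm hJ]
    rw [setIntegral_congr_fun (g := fun _ => (0 : ℝ)) (measurableSet_shell hJm)]
    · simp
    · intro z hz
      simp [h.eta_eq_self_of_norm_lt hx ((hJ hz).2.trans_le hR)]
  · simp

lemma bounded_increment (h : JumpSetting c ν σ η cη) {φ : E n → ℝ} (hφ : Continuous φ) {x : E n}
    (hx : x ∈ closedHalf n) (δ : ℝ) : ∃ K ≥ 0, ∀ z, ‖z‖ ≤ δ → |φ (x + η x z) - φ x| ≤ K := by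
  obtain ⟨K, hK⟩ := (isCompact_closedBall (0 : E n) (cη * δ)).exists_bound_of_continuousOn
    (f := fun y => φ (x + y) - φ x) (by fun_prop)
  refine ⟨max K 0, le_max_right _ _, fun z hz => (hK (η x z) ?_).trans (le_max_left _ _)⟩
  rw [mem_closedBall_zero_iff]
  exact (h.eta.growth x hx z).trans (mul_le_mul_of_nonneg_left hz h.eta.growth_pos.le)

/-- Existence of the principal value for test functions. -/
lemma exists_smallJumps (h : JumpSetting c ν σ η cη) {φ : E n → ℝ} (hφ : ContDiff ℝ 2 φ)
    {x : E n} (hx : x ∈ closedHalf n) (hc : 0 < nor x ∨ c = 0) :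
    ∃ L : ℝ → ℝ, (∀ δ > 0, HasSmallJumps (ν + σ) η δ φ x (L δ)) ∧ Tendsto L (𝓝[>] 0) (𝓝 0) := by
  have hcη := h.eta.growth_pos
  obtain ⟨r, hr, A, hA0, B, hB0, hT⟩ := exists_taylor_bound hφ x
  have hT' := hT x (Metric.mem_ball_self hr)
  -- Jumps shorter than ρ stay in the Taylor ball, lie where the truncated moments equal |z|² and
  -- |z|, and are not reflected unless `ν = 0`.
  obtain ⟨ρ, hρ, hρ1, hρr, hρx⟩ : ∃ ρ > 0, ρ ≤ 1 ∧ cη * ρ ≤ r ∧ (ρ ≤ nor x ∨ ν = 0) := by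
    have hr' : 0 < r / cη := by positivity
    have hcr : cη * (r / cη) = r := by field_simp
    rcases hc with hc | hc
    · refine ⟨min (min 1 (r / cη)) (nor x), by positivity,
        (min_le_left _ _).trans (min_le_left _ _), ?_, Or.inl (min_le_right _ _)⟩
      exact (mul_le_mul_of_nonneg_left ((min_le_left _ _).trans (min_le_right _ _)) hcη.le).trans
        hcr.le
    · refine ⟨min 1 (r / cη), by positivity, min_le_left _ _, ?_, Or.inr (h.null hc)⟩
      exact (mul_le_mul_of_nonneg_left (min_le_right _ _) hcη.le).trans hcr.le
  have hη : ∀ z, ‖z‖ < ρ → ‖η x z‖ < r := fun z hz =>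
    (h.eta.growth x hx z).trans_lt ((mul_lt_mul_of_pos_left hz hcη).trans_le hρr)
  have hm := h.eta.measurable x hx
  have hφm : Measurable fun z => φ (x + η x z) - φ x :=
    ((hφ.continuous.measurable).comp (measurable_const.add hm)).sub_const _
  set g : E n → ℝ := fun z => φ (x + η x z) - φ x
  -- Subtracting the first-order Taylor term for |z| < ρ makes the increment absolutely integrable
  -- against `ν`, and it costs nothing since this term has zero integral on every shell b < |z| < ρ.
  -- The principal value thus becomes an absolutely convergent integral; `σ` needs no compensation.
  set l : E n → ℝ := (shell n (Iio ρ)).indicator fun z => inner ℝ (gradient φ x) (η x z)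
  have hlm : Measurable l :=
    Measurable.indicator (by fun_prop) (measurableSet_shell measurableSet_Iio)
  have i1 : ∀ δ, IntegrableOn (fun z => g z - l z) (shell n (Iio δ)) ν := by
    intro δ
    obtain ⟨K, hK0, hK⟩ := h.bounded_increment hφ.continuous hx δ
    refine Integrable.mono' (g := fun z => (A * cη ^ 2 + K / ρ ^ 2) * min (‖z‖ ^ 2) 1)
      (h.levy.integrableOn.const_mul _) (hφm.sub hlm).aestronglyMeasurable
      ((ae_restrict_iff' (measurableSet_shell measurableSet_Iio)).2
        (Eventually.of_forall fun z hz => ?_))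
    rw [Real.norm_eq_abs, add_mul]
    by_cases hzρ : ‖z‖ < ρ
    · have : l z = inner ℝ (gradient φ x) (η x z) := indicator_of_mem (by exact hzρ) _
      rw [this]
      refine (hT' _ (hη z hzρ)).1.trans ?_
      rw [min_eq_left (by nlinarith [norm_nonneg z]), mul_assoc, ← mul_pow]
      have := h.eta.growth x hx z
      have h2 : A * ‖η x z‖ ^ 2 ≤ A * (cη * ‖z‖) ^ 2 := by gcongr
      have h3 : 0 ≤ K / ρ ^ 2 * ‖z‖ ^ 2 := by positivity
      linarith
    · have : l z = 0 := indicator_of_notMem (by exact hzρ) _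
      rw [this, sub_zero]
      refine (hK z (le_of_lt hz)).trans ?_
      have h1 : ρ ^ 2 ≤ min (‖z‖ ^ 2) 1 := by
        push Not at hzρ
        exact le_min (by gcongr) (by nlinarith)
      have h2 : K ≤ K / ρ ^ 2 * min (‖z‖ ^ 2) 1 := by
        calc K = K / ρ ^ 2 * ρ ^ 2 := by field_simp
          _ ≤ _ := by gcongr
      have : 0 ≤ A * cη ^ 2 * min (‖z‖ ^ 2) 1 := by positivity
      linarith
  have i2 : ∀ δ, IntegrableOn g (shell n (Iio δ)) σ := by
    intro δ
    obtain ⟨K, hK0, hK⟩ := h.bounded_increment hφ.continuous hx δ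
    refine Integrable.mono' (g := fun z => (B * cη + K / ρ) * min 1 ‖z‖)
      (h.first_moment.integrableOn.const_mul _) hφm.aestronglyMeasurable
      ((ae_restrict_iff' (measurableSet_shell measurableSet_Iio)).2
        (Eventually.of_forall fun z hz => ?_))
    rw [Real.norm_eq_abs, add_mul]
    by_cases hzρ : ‖z‖ < ρ
    · refine (hT' _ (hη z hzρ)).2.trans ?_
      rw [min_eq_right (by linarith), mul_assoc]
      have h2 := mul_le_mul_of_nonneg_left (h.eta.growth x hx z) hB0
      have h3 : 0 ≤ K / ρ * ‖z‖ := by positivity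
      linarith
    · refine (hK z (le_of_lt hz)).trans ?_
      have h1 : ρ ≤ min 1 ‖z‖ := le_min hρ1 (not_lt.1 hzρ)
      have h2 : K ≤ K / ρ * min 1 ‖z‖ := by
        calc K = K / ρ * ρ := by field_simp
          _ ≤ _ := by gcongr
      have : 0 ≤ B * cη * min 1 ‖z‖ := by positivity
      linarith
  refine ⟨fun δ => ∫ z in shell n (Ioo 0 δ), (g z - l z) ∂ν + ∫ z in shell n (Ioo 0 δ), g z ∂σ,
    fun δ _ => ?_, ?_⟩
  · refine ((tendsto_setIntegral_shell_Ioo (i1 δ)).add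
      (tendsto_setIntegral_shell_Ioo (i2 δ))).congr' ?_
    filter_upwards [self_mem_nhdsWithin] with b hb
    obtain ⟨K, hK0, hK⟩ := h.bounded_increment hφ.continuous hx δ
    obtain ⟨j1, j2⟩ := h.integrableOn_shell (J := Ioo b δ) hb measurableSet_Ioo
      (fun r hr => hr.1.le) hφm (K := K) fun z hz => hK z hz.2.le
    change _ = ∫ z in shell n (Ioo b δ), g z ∂(ν + σ)
    rw [setIntegral_add_measure j1 j2]
    congr 1
    have j3 : IntegrableOn l (shell n (Ioo b δ)) ν := by
      refine (j1.sub ((i1 δ).mono_set fun z hz => hz.2)).congr (Eventually.of_forall fun z => ?_)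
      simp
    rw [integral_sub j1 j3, sub_eq_self, setIntegral_indicator (measurableSet_shell
      measurableSet_Iio)]
    exact h.setIntegral_inner_eta_eq_zero hx hb (J := Ioo b δ ∩ Iio ρ)
      (measurableSet_Ioo.inter measurableSet_Iio) (fun r hr => ⟨hr.1.1.le, hr.2⟩) hρx _
  · simpa using (tendsto_setIntegral_shell_zero one_pos (i1 1)).add
      (tendsto_setIntegral_shell_zero one_pos (i2 1))

/-- Splitting off the jumps between `δ'` and `δ` from the principal value. -/
lemma smallJumps_eq_add (h : JumpSetting c ν σ η cη) {φ : E n → ℝ} (hφ : Continuous φ)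
    {x : E n} (hx : x ∈ closedHalf n) {δ δ' L L' : ℝ} (hδ' : 0 < δ') (hlt : δ' ≤ δ)
    (hL : HasSmallJumps (ν + σ) η δ φ x L) (hL' : HasSmallJumps (ν + σ) η δ' φ x L') :
    L = L' + ∫ z in shell n (Ico δ' δ), (φ (x + η x z) - φ x) ∂(ν + σ) := by
  refine tendsto_nhds_unique hL ((hL'.add_const _).congr' ?_)
  filter_upwards [Ioo_mem_nhdsGT hδ'] with b hb
  obtain ⟨K, hK0, hK⟩ := h.bounded_increment hφ hx δ
  have hφm : Measurable fun z => φ (x + η x z) - φ x :=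
    ((hφ.measurable).comp (measurable_const.add (h.eta.measurable x hx))).sub_const _
  have hi : IntegrableOn (fun z => φ (x + η x z) - φ x) (shell n (Ioo b δ)) (ν + σ) := by
    obtain ⟨j1, j2⟩ := h.integrableOn_shell (J := Ioo b δ) hb.1 measurableSet_Ioo
      (fun r hr => hr.1.le) hφm (K := K) fun z hz => hK z hz.2.le
    exact j1.add_measure j2
  change ∫ z in shell n (Ioo b δ'), _ ∂_ + _ = ∫ z in shell n (Ioo b δ), _ ∂_
  have hu : shell n (Ioo b δ) = shell n (Ioo b δ') ∪ shell n (Ico δ' δ) := by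
    change shell n _ = shell n (Ioo b δ' ∪ Ico δ' δ)
    rw [Ioo_union_Ico_eq_Ioo hb.2 hlt]
  rw [hu] at hi ⊢
  rw [setIntegral_union ?_ (measurableSet_shell measurableSet_Ico)
    (hi.mono_set subset_union_left) (hi.mono_set subset_union_right)]
  exact disjoint_left.2 fun z hz hz' => not_lt.2 hz'.1 hz.2

end JumpSetting

/-! ### Duality between sub- and supersolutions -/

section Duality

variable {c : ℕ} {μ : Measure (E n)} {η : E n → E n → E n} {cη : ℝ} {f u φ : E n → ℝ} {x : E n}
  {δ L : ℝ}

lemma HasSmallJumps.neg (h : HasSmallJumps μ η δ φ x L) :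
    HasSmallJumps μ η δ (fun y => -φ y) x (-L) := by
  unfold HasSmallJumps at h ⊢
  refine (Tendsto.neg h).congr fun b => ?_
  rw [← integral_neg]
  congr 1; ext z; ring

lemma largeJumps_neg : largeJumps μ η δ (fun y => -u y) x = -largeJumps μ η δ u x := by
  unfold largeJumps
  rw [← integral_neg]
  congr 1; ext z; ring

lemma normalDeriv_neg : normalDeriv (fun y => -φ y) x = -normalDeriv φ x := by
  unfold normalDeriv
  rw [fderiv_fun_neg]; rfl

lemma HypF.neg (hf : HypF f) : HypF fun y => -f y :=
  ⟨hf.continuousOn.neg, hf.bounded.imp fun K hK x hx => by rw [abs_neg]; exact hK x hx⟩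

lemma IsSupersolution.neg (h : IsSupersolution c μ η cη f u) :
    IsSubsolution c μ η cη (fun y => -f y) (fun y => -u y) where
  bounded := h.bounded.imp fun K hK x hx => by rw [abs_neg]; exact hK x hx
  usc := h.lsc.neg
  equation δ φ x hδ hφ hx hmax hc := by
    obtain ⟨L, hL, hle⟩ := h.equation δ (fun y => -φ y) x hδ hφ.neg hx
      (fun y hy => by have := hmax hy; simp only [mem_ofPred_eq] at this ⊢; linarith) hc
    refine ⟨-L, by simpa using hL.neg, ?_⟩
    rw [largeJumps_neg]; unfold F at hle ⊢; linarith
  boundary δ φ x hδ hφ hx hc hmax := by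
    have := h.boundary δ (fun y => -φ y) x hδ hφ.neg hx hc
      (fun y hy => by have := hmax hy; simp only [mem_ofPred_eq] at this ⊢; linarith)
    rw [normalDeriv_neg] at this; linarith

lemma IsSubsolution.neg (h : IsSubsolution c μ η cη f u) :
    IsSupersolution c μ η cη (fun y => -f y) (fun y => -u y) where
  bounded := h.bounded.imp fun K hK x hx => by rw [abs_neg]; exact hK x hx
  lsc := h.usc.neg
  equation δ φ x hδ hφ hx hmin hc := by
    obtain ⟨L, hL, hle⟩ := h.equation δ (fun y => -φ y) x hδ hφ.neg hx
      (fun y hy => by have := hmin hy; simp only [mem_ofPred_eq] at this ⊢; linarith) hc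
    refine ⟨-L, by simpa using hL.neg, ?_⟩
    rw [largeJumps_neg]; unfold F at hle ⊢; linarith
  boundary δ φ x hδ hφ hx hc hmin := by
    have := h.boundary δ (fun y => -φ y) x hδ hφ.neg hx hc
      (fun y hy => by have := hmin hy; simp only [mem_ofPred_eq] at this ⊢; linarith)
    rw [normalDeriv_neg] at this; linarith

end Duality

/-! ### The inequality at a global maximum point -/

section

variable {c : ℕ} {ν σ : Measure (E n)} {η : E n → E n → E n} {cη : ℝ} {f u : E n → ℝ}

/-- A global maximum permits every δ. The sign of the normal derivative excludes the boundary
condition, so the equation holds at `x`; the principal value of `φ` tends to 0 with δ and is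
absorbed in ρ. The resulting inequality contains no test function. -/
lemma IsSubsolution.eventually_le (h : JumpSetting c ν σ η cη)
    (hu : IsSubsolution c (ν + σ) η cη f u) {φ : E n → ℝ} (hφ : ContDiff ℝ 2 φ) {x : E n}
    (hx : x ∈ closedHalf n) (hmax : ∀ y ∈ closedHalf n, u y - φ y ≤ u x - φ x)
    (hb : nor x = 0 → c = 1 → normalDeriv φ x < 0) {ρ : ℝ} (hρ : 0 < ρ) :
    ∀ᶠ δ in 𝓝[>] (0 : ℝ), u x ≤ f x + ρ + largeJumps (ν + σ) η δ u x := by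
  have hmax' : ∀ δ, IsMaxOn (fun y => u y - φ y) (Metric.ball x (cη * δ) ∩ closedHalf n) x :=
    fun δ y hy => hmax y hy.2
  have hc : 0 < nor x ∨ c = 0 := by
    rcases (mem_closedHalf.1 hx).lt_or_eq with h0 | h0
    · exact Or.inl h0
    · refine Or.inr (h.c_eq.resolve_right fun hc => ?_)
      have := hu.boundary 1 φ x one_pos hφ h0.symm hc (hmax' 1)
      linarith [hb h0.symm hc]
  obtain ⟨L, hL, hL0⟩ := h.exists_smallJumps hφ hx hc
  filter_upwards [self_mem_nhdsWithin, hL0.eventually (gt_mem_nhds hρ)] with δ hδ hLδ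
  obtain ⟨L', hL', hle⟩ := hu.equation δ φ x hδ hφ hx (hmax' δ) hc
  rw [tendsto_nhds_unique hL' (hL δ hδ)] at hle
  unfold F at hle
  linarith

lemma IsSubsolution.measurable (hu : IsSubsolution c (ν + σ) η cη f u) :
    Measurable ((closedHalf n).domRestrict u) :=
  (upperSemicontinuousOn_iff_restrict.2 hu.usc).measurable

end

/-! ### The cut-off function -/

/-- A bounded function which increases to `1` at infinity and has negative normal derivative on the
boundary. -/
noncomputable def cutoff (β : ℝ) (x : E n) : ℝ := 1 - (1 + β * ‖x - unitN n‖ ^ 2)⁻¹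

/-- The gradient of the cut-off function. -/
noncomputable def cutoffGrad (β : ℝ) (x : E n) : E n :=
  (2 * β / (1 + β * ‖x - unitN n‖ ^ 2) ^ 2) • (x - unitN n)

lemma cutoff_denom_pos {β : ℝ} (hβ : 0 < β) (x : E n) : 1 ≤ 1 + β * ‖x - unitN n‖ ^ 2 := by
  have : 0 ≤ β * ‖x - unitN n‖ ^ 2 := by positivity
  linarith

lemma cutoff_nonneg {β : ℝ} (hβ : 0 < β) (x : E n) : 0 ≤ cutoff β x :=
  sub_nonneg.2 (inv_le_one_of_one_le₀ (cutoff_denom_pos hβ x))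

lemma cutoff_le_one {β : ℝ} (hβ : 0 < β) (x : E n) : cutoff β x ≤ 1 := by
  have : 0 < (1 + β * ‖x - unitN n‖ ^ 2)⁻¹ := by positivity
  unfold cutoff; linarith

lemma contDiff_cutoff {β : ℝ} (hβ : 0 < β) : ContDiff ℝ 2 (cutoff β : E n → ℝ) := by
  unfold cutoff
  refine contDiff_const.sub (ContDiff.inv ?_ fun x => (by positivity))
  exact contDiff_const.add (contDiff_const.mul ((contDiff_id.sub contDiff_const).norm_sq ℝ))

lemma tendsto_cutoff_zero (x : E n) : Tendsto (fun β => cutoff β x) (𝓝[>] 0) (𝓝 0) := by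
  have : ContinuousAt (fun β : ℝ => cutoff β x) 0 := by
    unfold cutoff
    refine continuousAt_const.sub (ContinuousAt.inv₀ (by fun_prop) (by simp))
  have h2 : cutoff 0 x = 0 := by simp [cutoff]
  have := this.tendsto
  rw [h2] at this
  exact this.mono_left nhdsWithin_le_nhds

/-- The function s ↦ 1 − 1/s is concave, so its increment lies below the linear one; the quadratic
remainder is that of s = 1 + β|x − e_N|² alone, damped by s⁻² ≤ 1. -/
lemma cutoff_increment_le {β : ℝ} (hβ : 0 < β) (x k : E n) :
    cutoff β (x + k) - cutoff β x ≤ inner ℝ (cutoffGrad β x) k + β * ‖k‖ ^ 2 := by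
  unfold cutoff cutoffGrad
  rw [add_sub_right_comm]
  set a := x - unitN n
  have h1 : ‖a + k‖ ^ 2 = ‖a‖ ^ 2 + 2 * inner ℝ a k + ‖k‖ ^ 2 := norm_add_sq_real a k
  rw [real_inner_smul_left]
  have hs : 1 ≤ 1 + β * ‖a‖ ^ 2 := cutoff_denom_pos hβ x
  have hs' : 0 < 1 + β * ‖a + k‖ ^ 2 := by positivity
  set s := 1 + β * ‖a‖ ^ 2 with hsd
  set s' := 1 + β * ‖a + k‖ ^ 2 with hsd'
  have hd : s' - s = β * (2 * inner ℝ a k + ‖k‖ ^ 2) := by rw [hsd, hsd', h1]; ring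
  have hs0 : 0 < s := by linarith
  have e1 : 1 - s'⁻¹ - (1 - s⁻¹) = (s' - s) / s ^ 2 - (s' - s) ^ 2 / (s ^ 2 * s') := by
    field_simp; ring
  have e2 : 0 ≤ (s' - s) ^ 2 / (s ^ 2 * s') := by positivity
  have e3 : β * ‖k‖ ^ 2 / s ^ 2 ≤ β * ‖k‖ ^ 2 := by
    apply div_le_self (by positivity)
    nlinarith
  have e4 : (s' - s) / s ^ 2 = 2 * β / s ^ 2 * inner ℝ a k + β * ‖k‖ ^ 2 / s ^ 2 := by
    rw [hd]; ring
  linarith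

/-- After scaling lengths by √β, this is the bound s + t ≤ (1 + s²)(1 + t²). It is used where only a
first-order estimate is integrable, and for the large jumps. -/
lemma cutoff_increment_le_norm {β : ℝ} (hβ : 0 < β) (x k : E n) :
    cutoff β (x + k) - cutoff β x ≤ √β * ‖k‖ := by
  unfold cutoff
  rw [add_sub_right_comm]
  set a := x - unitN n
  have hs : 0 < 1 + β * ‖a‖ ^ 2 := by positivity
  have hs' : 0 < 1 + β * ‖a + k‖ ^ 2 := by positivity
  have e1 : 1 - (1 + β * ‖a + k‖ ^ 2)⁻¹ - (1 - (1 + β * ‖a‖ ^ 2)⁻¹)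
      = β * (‖a + k‖ ^ 2 - ‖a‖ ^ 2) / ((1 + β * ‖a‖ ^ 2) * (1 + β * ‖a + k‖ ^ 2)) := by
    field_simp; ring
  rw [e1, div_le_iff₀ (by positivity)]
  have hsq : √β ^ 2 = β := Real.sq_sqrt hβ.le
  have hn : ‖a + k‖ - ‖a‖ ≤ ‖k‖ := by linarith [norm_add_le a k]
  set s := √β * ‖a‖ with hs_def
  set t := √β * ‖a + k‖ with ht_def
  have hs2 : β * ‖a‖ ^ 2 = s ^ 2 := by rw [hs_def, mul_pow, hsq]
  have ht2 : β * ‖a + k‖ ^ 2 = t ^ 2 := by rw [ht_def, mul_pow, hsq]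
  have hs0 : 0 ≤ s := by positivity
  have ht0 : 0 ≤ t := by positivity
  rw [mul_sub, hs2, ht2]
  have h1 : t - s ≤ √β * ‖k‖ := by
    rw [hs_def, ht_def, ← mul_sub]; gcongr
  have h2 : s + t ≤ (1 + s ^ 2) * (1 + t ^ 2) := by
    nlinarith [sq_nonneg (s - 1), sq_nonneg (t - 1), mul_nonneg (sq_nonneg s) (sq_nonneg t)]
  have h3 : 0 ≤ √β * ‖k‖ := by positivity
  calc t ^ 2 - s ^ 2 = (t - s) * (s + t) := by ring
    _ ≤ (√β * ‖k‖) * (s + t) := by gcongr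
    _ ≤ _ := by gcongr

lemma nor_cutoffGrad (β : ℝ) (x : E n) :
    nor (cutoffGrad β x) = 2 * β / (1 + β * ‖x - unitN n‖ ^ 2) ^ 2 * (nor x - 1) := by
  simp [cutoffGrad]

/-- The normal component is a nonnegative multiple of x_N − 1 ≤ x_N. This is the form required by
`setIntegral_inner_eta_le`. -/
lemma nor_cutoffGrad_le {β : ℝ} (hβ : 0 < β) {x : E n} (hx : x ∈ closedHalf n) :
    nor (cutoffGrad β x) ≤ 2 * β * nor x := by
  rw [nor_cutoffGrad]
  have h1 := cutoff_denom_pos hβ x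
  have hx' : 0 ≤ nor x := hx
  calc _ ≤ 2 * β / (1 + β * ‖x - unitN n‖ ^ 2) ^ 2 * nor x := by gcongr; linarith
    _ ≤ 2 * β * nor x := by
      gcongr
      apply div_le_self (by positivity)
      nlinarith

lemma hasFDerivAt_cutoff {β : ℝ} (hβ : 0 < β) (x : E n) :
    HasFDerivAt (cutoff β) (innerSL ℝ (cutoffGrad β x)) x := by
  have hs : (1 + β * ‖x - unitN n‖ ^ 2) ≠ 0 := by positivity
  have h1 : HasFDerivAt (fun y : E n => 1 + β * ‖y - unitN n‖ ^ 2)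
      (β • (2 • (innerSL ℝ (x - unitN n)).comp (ContinuousLinearMap.id ℝ (E n)))) x :=
    (((hasFDerivAt_id x).sub_const _).norm_sq.const_mul β).const_add 1
  have h2 := ((hasDerivAt_inv hs).comp_hasFDerivAt x h1).const_sub 1
  refine h2.congr_fderiv ?_
  ext k
  simp [cutoffGrad]
  field_simp

/-- The test function in one variable of the doubled penalization. -/
noncomputable def penalty (K β α γ : ℝ) (a x : E n) : ℝ :=
  K * cutoff β x + α * ‖x - a‖ ^ 2 + γ * (nor x - nor a) ^ 2

lemma contDiff_nor : ContDiff ℝ 2 (nor : E n → ℝ) :=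
  (EuclideanSpace.proj (𝕜 := ℝ) (Fin.last n)).contDiff

lemma contDiff_penalty {β : ℝ} (hβ : 0 < β) (K α γ : ℝ) (a : E n) :
    ContDiff ℝ 2 (penalty K β α γ a) := by
  unfold penalty
  exact ((contDiff_const.mul (contDiff_cutoff hβ)).add
    (contDiff_const.mul ((contDiff_id.sub contDiff_const).norm_sq ℝ))).add
    (contDiff_const.mul ((contDiff_nor.sub contDiff_const).pow 2))

lemma normalDeriv_penalty {β : ℝ} (hβ : 0 < β) (K α γ : ℝ) (a x : E n) :
    normalDeriv (penalty K β α γ a) x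
      = K * nor (cutoffGrad β x) + 2 * (α + γ) * (nor x - nor a) := by
  have h1 : HasFDerivAt (fun y : E n => ‖y - a‖ ^ 2)
      (2 • (innerSL ℝ (x - a)).comp (ContinuousLinearMap.id ℝ (E n))) x :=
    ((hasFDerivAt_id x).sub_const _).norm_sq
  have h2 : HasFDerivAt (fun y : E n => nor y - nor a) (EuclideanSpace.proj (𝕜 := ℝ)
      (Fin.last n)) x := (EuclideanSpace.proj (𝕜 := ℝ) (Fin.last n)).hasFDerivAt.sub_const _
  have h3 : HasFDerivAt (penalty K β α γ a) _ x :=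
    (((hasFDerivAt_cutoff hβ x).const_mul K).add (h1.const_mul α)).add ((h2.pow 2).const_mul γ)
  unfold normalDeriv
  rw [h3.fderiv]
  change K * inner ℝ (cutoffGrad β x) (unitN n) + _ + _ = _
  have h4 : ∀ y : E n, inner ℝ y (EuclideanSpace.single (Fin.last n) 1) = nor y :=
    fun y => (nor_eq_inner y).symm
  rw [← nor_eq_inner]
  simp [h4]
  ring

/-- At height 0 the centre e_N gives the cut-off term a strictly negative normal derivative, and the
quadratic terms contribute −2(α + γ)a_N ≤ 0. -/
lemma normalDeriv_penalty_neg {K β α γ : ℝ} (hβ : 0 < β) (hK : 0 < K) (hα : 0 ≤ α) (hγ : 0 ≤ γ)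
    {a x : E n} (ha : a ∈ closedHalf n) (hx : nor x = 0) :
    normalDeriv (penalty K β α γ a) x < 0 := by
  rw [normalDeriv_penalty hβ, nor_cutoffGrad, hx]
  have h1 : 0 < K * (2 * β / (1 + β * ‖x - unitN n‖ ^ 2) ^ 2) := by positivity
  have h2 : 0 ≤ (α + γ) * nor a := mul_nonneg (by positivity) ha
  nlinarith

/-! ### The nonlocal operator on the cut-off function. -/

namespace JumpSetting

variable {c : ℕ} {ν σ : Measure (E n)} {η : E n → E n → E n} {cη : ℝ}

lemma largeJumps_eq (h : JumpSetting c ν σ η cη) {x : E n} (hx : x ∈ closedHalf n) {δ : ℝ}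
    (hδ : 0 < δ) {w : E n → ℝ} (hw : Measurable ((closedHalf n).domRestrict w)) {K : ℝ}
    (hK : ∀ y ∈ closedHalf n, |w y| ≤ K) :
    IntegrableOn (fun z => w (x + η x z) - w x) (shell n (Ici δ)) ν ∧
    IntegrableOn (fun z => w (x + η x z) - w x) (shell n (Ici δ)) σ := by
  refine h.integrableOn_shell hδ measurableSet_Ici subset_rfl
    ((h.measurable_comp_jump hx hw).sub_const _) (K := K + K) fun z _ => ?_
  exact (abs_sub _ _).trans (add_le_add (hK _ (h.eta.stays_inside x hx z)) (hK _ hx))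

lemma setIntegral_shell_split {τ : Measure (E n)} {g : E n → ℝ} {δ R : ℝ} (hδR : δ ≤ R)
    (hg : IntegrableOn g (shell n (Ici δ)) τ) :
    ∫ z in shell n (Ici δ), g z ∂τ
      = ∫ z in shell n (Ico δ R), g z ∂τ + ∫ z in shell n (Ici R), g z ∂τ := by
  have hu : shell n (Ici δ) = shell n (Ico δ R) ∪ shell n (Ici R) := by
    change shell n _ = shell n (Ico δ R ∪ Ici R)
    rw [Ico_union_Ici_eq_Ici hδR]
  rw [hu] at hg ⊢
  exact setIntegral_union (disjoint_left.2 fun z hz hz' => not_lt.2 hz' hz.2)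
    (measurableSet_shell measurableSet_Ici) (hg.mono_set subset_union_left)
    (hg.mono_set subset_union_right)

/-- The nonlocal operator applied to the cut-off function is small from above. -/
lemma exists_cutoff_largeJumps_le (h : JumpSetting c ν σ η cη) :
    ∃ err : ℝ → ℝ, Tendsto err (𝓝[>] 0) (𝓝 0) ∧ ∀ β > 0, ∀ x ∈ closedHalf n, ∀ δ ∈ Ioc (0 : ℝ) 1,
      largeJumps (ν + σ) η δ (cutoff β) x ≤ err β := by
  have hc := h.eta.growth_pos
  obtain ⟨f1, f2⟩ := h.measure_shell_lt_top (J := Ici 1) one_pos subset_rfl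
  have hfin : IsFiniteMeasure ((ν + σ).restrict (shell n (Ici 1))) :=
    ⟨by simp [f1, f2]⟩
  -- The summands bound, in order, the reflection drift under `ν`, the second-order remainder under
  -- `ν`, the small jumps under `σ`, and the jumps with |z| ≥ 1. No moment of large jumps is
  -- assumed, so the last one is capped at 1 and tends to 0 by dominated convergence.
  refine ⟨fun β => 2 * β * (1 + cη) * (∫ z, min (‖z‖ ^ 2) 1 ∂ν) + β * cη ^ 2 * secondMoment ν 1
    + √β * cη * firstMoment σ 1
    + ∫ z in shell n (Ici 1), min 1 (√β * cη * ‖z‖) ∂(ν + σ), ?_, ?_⟩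
  · have t1 : Tendsto (fun β : ℝ => 2 * β * (1 + cη) * (∫ z, min (‖z‖ ^ 2) 1 ∂ν)
        + β * cη ^ 2 * secondMoment ν 1 + √β * cη * firstMoment σ 1) (𝓝[>] 0) (𝓝 0) := by
      have : Continuous (fun β : ℝ => 2 * β * (1 + cη) * (∫ z, min (‖z‖ ^ 2) 1 ∂ν)
        + β * cη ^ 2 * secondMoment ν 1 + √β * cη * firstMoment σ 1) := by fun_prop
      have := this.tendsto 0
      simp only [mul_zero, zero_mul, Real.sqrt_zero, add_zero] at this
      exact this.mono_left nhdsWithin_le_nhds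
    have t2 : Tendsto (fun β : ℝ => ∫ z in shell n (Ici 1), min 1 (√β * cη * ‖z‖) ∂(ν + σ))
        (𝓝[>] 0) (𝓝 (∫ z in shell n (Ici 1), 0 ∂(ν + σ))) := by
      refine tendsto_integral_filter_of_dominated_convergence (fun _ => 1) ?_ ?_
        (integrable_const _) ?_
      · exact Eventually.of_forall fun β => (by fun_prop : Measurable _).aestronglyMeasurable
      · refine Eventually.of_forall fun β => Eventually.of_forall fun z => ?_
        rw [Real.norm_eq_abs, abs_of_nonneg (by positivity)]
        exact min_le_left _ _
      · refine Eventually.of_forall fun z => ?_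
        have : Continuous (fun β : ℝ => min 1 (√β * cη * ‖z‖)) := by fun_prop
        have := this.tendsto 0
        simp only [zero_mul, Real.sqrt_zero] at this
        rw [min_eq_right zero_le_one] at this
        exact this.mono_left nhdsWithin_le_nhds
    simpa using t1.add t2
  · intro β hβ x hx δ hδ
    have hw : Measurable ((closedHalf n).domRestrict (cutoff β)) :=
      (contDiff_cutoff hβ).continuous.measurable.comp measurable_subtype_coe
    have hK : ∀ y : E n, |cutoff β y| ≤ 1 := fun y =>
      abs_le.2 ⟨by linarith [cutoff_nonneg hβ y], cutoff_le_one hβ y⟩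
    have hK2 : ∀ y z : E n, |cutoff β y - cutoff β z| ≤ 1 := fun y z =>
      abs_le.2 ⟨by linarith [cutoff_nonneg hβ y, cutoff_le_one hβ z],
        by linarith [cutoff_nonneg hβ z, cutoff_le_one hβ y]⟩
    obtain ⟨i1, i2⟩ := h.largeJumps_eq hx hδ.1 hw fun y _ => hK y
    have i3 := i1.add_measure i2
    change ∫ z in shell n (Ici δ), _ ∂_ ≤ _
    rw [setIntegral_shell_split hδ.2 i3]
    refine add_le_add ?_ ?_
    · refine (h.setIntegral_increment_le hx hδ.1 le_rfl measurableSet_Ico subset_rfl hw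
        (fun z _ => hK2 _ _) hβ.le (Real.sqrt_nonneg β) (fun z _ => cutoff_increment_le hβ x _)
        (fun z _ => cutoff_increment_le_norm hβ x _)).trans ?_
      gcongr
      exact h.setIntegral_inner_eta_le hx hδ.1 measurableSet_Ico subset_rfl (by positivity)
        (nor_cutoffGrad_le hβ hx)
    · refine setIntegral_mono_on (i3.mono_set fun z hz => le_trans hδ.2 hz) ?_
        (measurableSet_shell measurableSet_Ici) fun z _ => le_min ?_ ?_
      · refine Integrable.of_bound (C := 1) (by fun_prop : Measurable _).aestronglyMeasurable
          (Eventually.of_forall fun z => ?_)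
        rw [Real.norm_eq_abs, abs_of_nonneg (by positivity)]
        exact min_le_left _ _
      · exact (le_abs_self _).trans (hK2 _ _)
      · refine (cutoff_increment_le_norm hβ x _).trans ?_
        rw [mul_assoc]
        exact mul_le_mul_of_nonneg_left (h.eta.growth x hx z) (Real.sqrt_nonneg _)

end JumpSetting

/-! ### The tangential error -/

/-- A bound for the increment of `α |x' - y'|²`, with `p = |x' - y'|` and `d` the size of the
difference of the tangential jumps, capped at `K`. -/
noncomputable def tangIncrement (K α p d : ℝ) : ℝ := min K (α * (2 * p * d + d ^ 2))

/-- As `tangIncrement`, but without the first-order term for the small jumps, of size `r < 1`. -/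
noncomputable def tangIncrementEven (K α p d r : ℝ) : ℝ :=
  if r < 1 then α * d ^ 2 else tangIncrement K α p d

section increments

variable {K α p d r D P : ℝ}

lemma tangIncrement_nonneg (hK : 0 ≤ K) (hα : 0 ≤ α) (hp : 0 ≤ p) (hd : 0 ≤ d) :
    0 ≤ tangIncrement K α p d := le_min hK (by positivity)

lemma tangIncrementEven_nonneg (hK : 0 ≤ K) (hα : 0 ≤ α) (hp : 0 ≤ p) (hd : 0 ≤ d) :
    0 ≤ tangIncrementEven K α p d r := by
  unfold tangIncrementEven
  split_ifs
  · positivity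
  · exact tangIncrement_nonneg hK hα hp hd

lemma tangIncrement_le (hK : 0 ≤ K) (hα : 0 ≤ α) (hp : 0 ≤ p) (hd : 0 ≤ d) (hr : 0 ≤ r)
    (hD : 0 ≤ D) (hpP : p ≤ P) (hdr : d ≤ D * r) :
    tangIncrement K α p d ≤ (K + α * (2 * P * D + D ^ 2)) * min 1 r := by
  have hP : 0 ≤ P := hp.trans hpP
  rcases le_total r 1 with h | h
  · rw [min_eq_right h]
    refine (min_le_right _ _).trans ?_
    have h1 : α * (2 * p * d + d ^ 2) ≤ α * (2 * P * (D * r) + (D * r) ^ 2) := by gcongr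
    have h2 : α * (2 * P * (D * r) + (D * r) ^ 2) ≤ α * (2 * P * D + D ^ 2) * r := by
      have : (D * r) ^ 2 ≤ D ^ 2 * r := by
        rw [mul_pow]; gcongr; nlinarith
      nlinarith
    nlinarith [mul_nonneg hK hr]
  · rw [min_eq_left h, mul_one]
    refine (min_le_left _ _).trans ?_
    have : 0 ≤ α * (2 * P * D + D ^ 2) := by positivity
    linarith

/-- Without its first-order term the increment is controlled by min(|z|², 1), which is what `ν`
integrates; `tangIncrement` itself is controlled only by min(1, |z|), which suits `σ`. -/
lemma tangIncrementEven_le (hK : 0 ≤ K) (hα : 0 ≤ α) (hd : 0 ≤ d) (hr : 0 ≤ r)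
    (hdr : d ≤ D * r) :
    tangIncrementEven K α p d r ≤ (K + α * D ^ 2) * min (r ^ 2) 1 := by
  unfold tangIncrementEven
  split_ifs with h
  · rw [min_eq_left (by nlinarith)]
    have h1 : α * d ^ 2 ≤ α * (D * r) ^ 2 := by gcongr
    have h2 : 0 ≤ K * r ^ 2 := by positivity
    nlinarith
  · rw [min_eq_right (by nlinarith), mul_one]
    have : 0 ≤ α * D ^ 2 := by positivity
    exact (min_le_left _ _).trans (by linarith)

lemma tangIncrement_mono (hα : 0 ≤ α) (hp : 0 ≤ p) (hd : 0 ≤ d) {d' : ℝ} (h : d ≤ d') :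
    tangIncrement K α p d ≤ tangIncrement K α p d' := by
  unfold tangIncrement; gcongr

lemma tangIncrementEven_mono (hα : 0 ≤ α) (hp : 0 ≤ p) (hd : 0 ≤ d) {d' : ℝ} (h : d ≤ d') :
    tangIncrementEven K α p d r ≤ tangIncrementEven K α p d' r := by
  unfold tangIncrementEven
  split_ifs
  · gcongr
  · exact tangIncrement_mono hα hp hd h

end increments

/-- A bound for the nonlocal operator applied to `α |x' - y'|²`. -/
noncomputable def tangErr (ν σ : Measure (E n)) (η : E n → E n → E n) (K α : ℝ) (x y : E n) : ℝ :=
  ∫ z, tangIncrementEven K α ‖tang x - tang y‖ ‖tang (η x z) - tang (η y z)‖ ‖z‖ ∂ν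
    + ∫ z, tangIncrement K α ‖tang x - tang y‖ ‖tang (η x z) - tang (η y z)‖ ∂σ

namespace JumpSetting

variable {c : ℕ} {ν σ : Measure (E n)} {η : E n → E n → E n} {cη : ℝ}

lemma norm_tang_eta_sub_le (h : JumpSetting c ν σ η cη) {x y : E n} (hx : x ∈ closedHalf n)
    (hy : y ∈ closedHalf n) (z : E n) : ‖tang (η x z) - tang (η y z)‖ ≤ (2 * cη) * ‖z‖ := by
  have h1 := (norm_tang_le _).trans (h.eta.growth x hx z)
  have h2 := (norm_tang_le _).trans (h.eta.growth y hy z)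
  linarith [norm_sub_le (tang (η x z)) (tang (η y z))]

lemma measurable_norm_tang_eta_sub (h : JumpSetting c ν σ η cη) {x y : E n}
    (hx : x ∈ closedHalf n) (hy : y ∈ closedHalf n) :
    Measurable fun z => ‖tang (η x z) - tang (η y z)‖ :=
  ((continuous_tang.measurable.comp (h.eta.measurable x hx)).sub
    (continuous_tang.measurable.comp (h.eta.measurable y hy))).norm

lemma measurable_tangIncrement (h : JumpSetting c ν σ η cη) {x y : E n}
    (hx : x ∈ closedHalf n) (hy : y ∈ closedHalf n) (K α p : ℝ) :
    Measurable fun z => tangIncrement K α p ‖tang (η x z) - tang (η y z)‖ := by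
  have := h.measurable_norm_tang_eta_sub hx hy
  unfold tangIncrement
  fun_prop

lemma measurable_tangIncrementEven (h : JumpSetting c ν σ η cη) {x y : E n}
    (hx : x ∈ closedHalf n) (hy : y ∈ closedHalf n) (K α p : ℝ) :
    Measurable fun z => tangIncrementEven K α p ‖tang (η x z) - tang (η y z)‖ ‖z‖ := by
  have := h.measurable_norm_tang_eta_sub hx hy
  unfold tangIncrementEven
  exact Measurable.ite (measurableSet_lt measurable_norm measurable_const) (by fun_prop)
    (h.measurable_tangIncrement hx hy K α p)

lemma integrable_tangIncrement (h : JumpSetting c ν σ η cη) {x y : E n}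
    (hx : x ∈ closedHalf n) (hy : y ∈ closedHalf n) {K α p : ℝ} (hK : 0 ≤ K) (hα : 0 ≤ α)
    (hp : 0 ≤ p) : Integrable (fun z => tangIncrement K α p ‖tang (η x z) - tang (η y z)‖) σ := by
  have hc := h.eta.growth_pos
  refine Integrable.mono' (h.first_moment.const_mul (K + α * (2 * p * (2 * cη) + (2 * cη) ^ 2)))
    (h.measurable_tangIncrement hx hy K α p).aestronglyMeasurable
    (Eventually.of_forall fun z => ?_)
  rw [Real.norm_eq_abs, abs_of_nonneg (tangIncrement_nonneg hK hα hp (norm_nonneg _))]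
  exact tangIncrement_le hK hα hp (norm_nonneg _) (norm_nonneg _) (by positivity) le_rfl
    (h.norm_tang_eta_sub_le hx hy z)

lemma integrable_tangIncrementEven (h : JumpSetting c ν σ η cη) {x y : E n}
    (hx : x ∈ closedHalf n) (hy : y ∈ closedHalf n) {K α p : ℝ} (hK : 0 ≤ K) (hα : 0 ≤ α)
    (hp : 0 ≤ p) :
    Integrable (fun z => tangIncrementEven K α p ‖tang (η x z) - tang (η y z)‖ ‖z‖) ν := by
  refine Integrable.mono' (h.levy.const_mul (K + α * (2 * cη) ^ 2))
    (h.measurable_tangIncrementEven hx hy K α p).aestronglyMeasurable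
    (Eventually.of_forall fun z => ?_)
  rw [Real.norm_eq_abs, abs_of_nonneg (tangIncrementEven_nonneg hK hα hp (norm_nonneg _))]
  exact tangIncrementEven_le hK hα (norm_nonneg _) (norm_nonneg _)
    (h.norm_tang_eta_sub_le hx hy z)

/-- A tangential vector has no normal component, so in `setIntegral_inner_eta` the drift term drops
out even where jumps are reflected. -/
lemma setIntegral_inner_tang (h : JumpSetting c ν σ η cη) {x : E n} (hx : x ∈ closedHalf n)
    {δ R : ℝ} (hδ : 0 < δ) (p : EuclideanSpace ℝ (Fin n)) :
    IntegrableOn (fun z => inner ℝ p (tang (η x z))) (shell n (Ico δ R)) ν ∧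
    ∫ z in shell n (Ico δ R), inner ℝ p (tang (η x z)) ∂ν = 0 := by
  have hc := h.eta.growth_pos
  constructor
  · refine (h.integrableOn_shell hδ measurableSet_Ico (fun r hr => hr.1)
      (g := fun z => inner ℝ p (tang (η x z))) ?_ (K := ‖p‖ * (cη * R)) fun z hz => ?_).1
    · exact measurable_const.inner (continuous_tang.measurable.comp (h.eta.measurable x hx))
    · refine (abs_real_inner_le_norm _ _).trans (mul_le_mul_of_nonneg_left ?_ (norm_nonneg _))
      refine (norm_tang_le _).trans ((h.eta.growth x hx z).trans ?_)
      exact mul_le_mul_of_nonneg_left hz.2.le hc.le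
  · have key : ∀ w : E n, inner ℝ p (tang w) = inner ℝ (ofParts p 0) w := fun w => by
      rw [inner_eq_sum_tang_add_nor, nor_ofParts, zero_mul, add_zero, PiLp.inner_apply]
      simp [ofParts, mul_comm]
    simp_rw [key]
    rw [h.setIntegral_inner_eta hx hδ measurableSet_Ico subset_rfl, nor_ofParts, zero_mul]

/-- The tangential error bounds the integral of every function below the increment of
`α |x' - y'|²`. -/
lemma setIntegral_le_tangErr (h : JumpSetting c ν σ η cη) {x y : E n} (hx : x ∈ closedHalf n)
    (hy : y ∈ closedHalf n) {K α : ℝ} (hK : 0 ≤ K) (hα : 0 ≤ α) {δ : ℝ} (hδ : 0 < δ)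
    {R : E n → ℝ} (hR1 : IntegrableOn R (shell n (Ici δ)) ν)
    (hR2 : IntegrableOn R (shell n (Ici δ)) σ) (hRK : ∀ z, R z ≤ K)
    (hRα : ∀ z, R z ≤ α * (2 * inner ℝ (tang x - tang y) (tang (η x z) - tang (η y z))
      + ‖tang (η x z) - tang (η y z)‖ ^ 2)) :
    ∫ z in shell n (Ici δ), R z ∂(ν + σ) ≤ tangErr ν σ η K α x y := by
  rw [setIntegral_add_measure hR1 hR2]
  set p := tang x - tang y
  set d : E n → EuclideanSpace ℝ (Fin n) := fun z => tang (η x z) - tang (η y z)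
  have hR' : ∀ z, R z ≤ tangIncrement K α ‖p‖ ‖d z‖ := fun z => by
    refine le_min (hRK z) ((hRα z).trans (mul_le_mul_of_nonneg_left ?_ hα))
    have := real_inner_le_norm p (d z)
    linarith
  refine add_le_add ?_ ?_
  · obtain ⟨i1, e1⟩ := h.setIntegral_inner_tang hx (R := 1) hδ p
    obtain ⟨i2, e2⟩ := h.setIntegral_inner_tang hy (R := 1) hδ p
    have e3 : ∫ z in shell n (Ico δ 1), inner ℝ p (d z) ∂ν = 0 := by
      simp_rw [d, inner_sub_right]
      rw [integral_sub i1 i2, e1, e2, sub_zero]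
    have i3 : IntegrableOn (fun z => inner ℝ p (d z)) (shell n (Ico δ 1)) ν := by
      simp_rw [d, inner_sub_right]
      exact i1.sub i2
    -- The first-order part of the jumps with |z| < 1. Its `ν`-integral is zero, so subtracting it
    -- leaves the integral of `R` unchanged while lowering the pointwise bound to α|d|².
    set l : E n → ℝ := (shell n (Ico δ 1)).indicator fun z => 2 * α * inner ℝ p (d z)
    have hm := measurableSet_shell (n := n) (measurableSet_Ico (a := δ) (b := 1))
    have hl : Integrable l ν := IntegrableOn.integrable_indicator (i3.const_mul (2 * α)) hm
    have hl0 : ∫ z in shell n (Ici δ), l z ∂ν = 0 := by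
      rw [setIntegral_indicator hm, inter_eq_right.2 (fun z hz => hz.1), integral_const_mul, e3,
        mul_zero]
    have : ∫ z in shell n (Ici δ), R z ∂ν = ∫ z in shell n (Ici δ), (R z - l z) ∂ν := by
      rw [integral_sub hR1 hl.integrableOn, hl0, sub_zero]
    rw [this]
    refine setIntegral_le_integral_of_le (measurableSet_shell measurableSet_Ici)
      (hR1.sub hl.integrableOn) (h.integrable_tangIncrementEven hx hy hK hα (norm_nonneg p))
      (fun z hz => ?_)
      fun z => tangIncrementEven_nonneg hK hα (norm_nonneg _) (norm_nonneg _)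
    unfold tangIncrementEven
    split_ifs with hz1
    · have : l z = 2 * α * inner ℝ p (d z) := indicator_of_mem (by exact ⟨hz, hz1⟩) _
      rw [this]
      have := hRα z
      change R z - _ ≤ α * ‖d z‖ ^ 2
      linarith
    · have : l z = 0 := indicator_of_notMem (fun hz2 => hz1 hz2.2) _
      rw [this, sub_zero]
      exact hR' z
  · exact setIntegral_le_integral_of_le (measurableSet_shell measurableSet_Ici) hR2
      (h.integrable_tangIncrement hx hy hK hα (norm_nonneg p)) (fun z _ => hR' z)
      fun z => tangIncrement_nonneg hK hα (norm_nonneg _) (norm_nonneg _)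

lemma ae_tendsto_eta (h : JumpSetting c ν σ η cη) {x : E n} (hx : x ∈ closedHalf n) :
    (∀ᵐ z ∂ν, Tendsto (fun y => η y z) (𝓝[closedHalf n] x) (𝓝 (η x z))) ∧
    (∀ᵐ z ∂σ, Tendsto (fun y => η y z) (𝓝[closedHalf n] x) (𝓝 (η x z))) :=
  ae_add_measure_iff.1 (h.eta.weak_continuity x hx)

/-- Continuity of the tangential error. -/
lemma tendsto_tangErr (h : JumpSetting c ν σ η cη) {K α : ℝ} (hK : 0 ≤ K) (hα : 0 ≤ α)
    {x y : ℕ → E n} {X Y : E n} (hx : ∀ k, x k ∈ closedHalf n) (hy : ∀ k, y k ∈ closedHalf n)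
    (hX : Tendsto x atTop (𝓝 X)) (hY : Tendsto y atTop (𝓝 Y)) :
    Tendsto (fun k => tangErr ν σ η K α (x k) (y k)) atTop (𝓝 (tangErr ν σ η K α X Y)) := by
  have hc := h.eta.growth_pos
  have hXH : X ∈ closedHalf n := isClosed_closedHalf.mem_of_tendsto hX (Eventually.of_forall hx)
  have hYH : Y ∈ closedHalf n := isClosed_closedHalf.mem_of_tendsto hY (Eventually.of_forall hy)
  have hX' : Tendsto x atTop (𝓝[closedHalf n] X) :=
    tendsto_nhdsWithin_iff.2 ⟨hX, Eventually.of_forall hx⟩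
  have hY' : Tendsto y atTop (𝓝[closedHalf n] Y) :=
    tendsto_nhdsWithin_iff.2 ⟨hY, Eventually.of_forall hy⟩
  have hp : Tendsto (fun k => ‖tang (x k) - tang (y k)‖) atTop (𝓝 ‖tang X - tang Y‖) :=
    (((continuous_tang.tendsto X).comp hX).sub ((continuous_tang.tendsto Y).comp hY)).norm
  have hd : ∀ z, Tendsto (fun y => η y z) (𝓝[closedHalf n] X) (𝓝 (η X z)) →
      Tendsto (fun y => η y z) (𝓝[closedHalf n] Y) (𝓝 (η Y z)) →
      Tendsto (fun k => ‖tang (η (x k) z) - tang (η (y k) z)‖) atTop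
        (𝓝 ‖tang (η X z) - tang (η Y z)‖) := fun z h1 h2 =>
    (((continuous_tang.tendsto _).comp (h1.comp hX')).sub
      ((continuous_tang.tendsto _).comp (h2.comp hY'))).norm
  obtain ⟨P, hP⟩ := hp.bddAbove_range
  have hP' : ∀ k, ‖tang (x k) - tang (y k)‖ ≤ P := fun k => hP ⟨k, rfl⟩
  have hinc : ∀ z, Tendsto (fun y => η y z) (𝓝[closedHalf n] X) (𝓝 (η X z)) →
      Tendsto (fun y => η y z) (𝓝[closedHalf n] Y) (𝓝 (η Y z)) →
      Tendsto (fun k => tangIncrement K α ‖tang (x k) - tang (y k)‖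
        ‖tang (η (x k) z) - tang (η (y k) z)‖) atTop
        (𝓝 (tangIncrement K α ‖tang X - tang Y‖ ‖tang (η X z) - tang (η Y z)‖)) :=
    fun z h1 h2 => tendsto_const_nhds.min
      ((((hp.const_mul 2).mul (hd z h1 h2)).add ((hd z h1 h2).pow 2)).const_mul α)
  refine Tendsto.add ?_ ?_
  · refine tendsto_integral_of_dominated_convergence
      (fun z => (K + α * (2 * cη) ^ 2) * min (‖z‖ ^ 2) 1) (fun k =>
      (h.measurable_tangIncrementEven (hx k) (hy k) K α _).aestronglyMeasurable)
      (h.levy.const_mul _) (fun k => Eventually.of_forall fun z => ?_) ?_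
    · rw [Real.norm_eq_abs,
        abs_of_nonneg (tangIncrementEven_nonneg hK hα (norm_nonneg _) (norm_nonneg _))]
      exact tangIncrementEven_le hK hα (norm_nonneg _) (norm_nonneg _)
        (h.norm_tang_eta_sub_le (hx k) (hy k) z)
    · filter_upwards [(h.ae_tendsto_eta hXH).1, (h.ae_tendsto_eta hYH).1] with z h1 h2
      unfold tangIncrementEven
      split_ifs
      · exact ((hd z h1 h2).pow 2).const_mul α
      · exact hinc z h1 h2
  · refine tendsto_integral_of_dominated_convergence
      (fun z => (K + α * (2 * P * (2 * cη) + (2 * cη) ^ 2)) * min 1 ‖z‖) (fun k =>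
      (h.measurable_tangIncrement (hx k) (hy k) K α _).aestronglyMeasurable)
      (h.first_moment.const_mul _) (fun k => Eventually.of_forall fun z => ?_) ?_
    · rw [Real.norm_eq_abs,
        abs_of_nonneg (tangIncrement_nonneg hK hα (norm_nonneg _) (norm_nonneg _))]
      exact tangIncrement_le hK hα (norm_nonneg _) (norm_nonneg _) (norm_nonneg _)
        (by positivity) (hP' k) (h.norm_tang_eta_sub_le (hx k) (hy k) z)
    · filter_upwards [(h.ae_tendsto_eta hXH).2, (h.ae_tendsto_eta hYH).2] with z h1 h2
      exact hinc z h1 h2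

/-- The hypothesis covers positive heights only. Both points are approached vertically from above at
the same height, and the continuity of `η` for a.e. jump carries the bound to the limit, including
height 0. -/
lemma exists_tang_lipschitz (h : JumpSetting c ν σ η cη) :
    ∃ C ≥ 0, ∀ x ∈ closedHalf n, ∀ y ∈ closedHalf n, nor x = nor y →
      (∀ᵐ z ∂(ν + σ), ‖tang (η x z) - tang (η y z)‖ ≤ ‖tang x - tang y‖ * (C * ‖z‖)) := by
  obtain ⟨C, hC⟩ := h.eta.tangential_lipschitz
  refine ⟨max C 0, le_max_right _ _, fun x hx y hy hxy => ?_⟩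
  have hlim : ∀ w ∈ closedHalf n,
      Tendsto (ofParts (tang w)) (𝓝[>] (nor w)) (𝓝[closedHalf n] w) := by
    intro w hw
    refine tendsto_nhdsWithin_iff.2 ⟨?_, ?_⟩
    · have := (continuous_ofParts (tang w)).tendsto (nor w)
      rw [ofParts_tang_nor] at this
      exact this.mono_left nhdsWithin_le_nhds
    · filter_upwards [self_mem_nhdsWithin] with s hs
      rw [mem_closedHalf, nor_ofParts]
      exact le_trans hw (le_of_lt hs)
  filter_upwards [h.eta.weak_continuity x hx, h.eta.weak_continuity y hy] with z h1 h2
  have t1 := (continuous_tang.tendsto _).comp (h1.comp (hlim x hx))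
  have t2 := (continuous_tang.tendsto _).comp (h2.comp (hlim y hy))
  rw [← hxy] at t2
  refine le_of_tendsto (t1.sub t2).norm ?_
  filter_upwards [self_mem_nhdsWithin] with s hs
  refine (hC (tang x) (tang y) s z (lt_of_le_of_lt hx hs)).trans ?_
  have : C * ‖z‖ ≤ max C 0 * ‖z‖ := by gcongr; exact le_max_left _ _
  nlinarith [norm_nonneg (tang x - tang y)]

/-- On points with equal normal coordinates the tangential error vanishes with `α |x' - y'|²`. -/
lemma exists_tangErr_le (h : JumpSetting c ν σ η cη) {K : ℝ} (hK : 0 ≤ K) :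
    ∃ ω : ℝ → ℝ, Tendsto ω (𝓝 0) (𝓝 0) ∧ ∀ α ≥ 0, ∀ x ∈ closedHalf n, ∀ y ∈ closedHalf n,
      nor x = nor y → tangErr ν σ η K α x y ≤ ω (α * ‖tang x - tang y‖ ^ 2) := by
  obtain ⟨C, hC0, hC⟩ := h.exists_tang_lipschitz
  have hm2 : ∀ t : ℝ, Measurable fun z : E n => tangIncrement K t 1 (C * ‖z‖) := fun t => by
    unfold tangIncrement; fun_prop
  have hm1 : ∀ t : ℝ, Measurable fun z : E n => tangIncrementEven K t 1 (C * ‖z‖) ‖z‖ := fun t =>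
    Measurable.ite (measurableSet_lt measurable_norm measurable_const) (by fun_prop) (hm2 t)
  have b1 : ∀ t ≥ 0, ∀ z : E n, ‖tangIncrementEven K t 1 (C * ‖z‖) ‖z‖‖
      ≤ (K + t * C ^ 2) * min (‖z‖ ^ 2) 1 := fun t ht z => by
    rw [Real.norm_eq_abs,
      abs_of_nonneg (tangIncrementEven_nonneg hK ht zero_le_one (by positivity))]
    exact tangIncrementEven_le hK ht (by positivity) (norm_nonneg _) le_rfl
  have b2 : ∀ t ≥ 0, ∀ z : E n, ‖tangIncrement K t 1 (C * ‖z‖)‖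
      ≤ (K + t * (2 * 1 * C + C ^ 2)) * min 1 ‖z‖ := fun t ht z => by
    rw [Real.norm_eq_abs,
      abs_of_nonneg (tangIncrement_nonneg hK ht zero_le_one (by positivity))]
    exact tangIncrement_le hK ht zero_le_one (by positivity) (norm_nonneg _) hC0 le_rfl le_rfl
  have i1 : ∀ t ≥ 0, Integrable (fun z : E n => tangIncrementEven K t 1 (C * ‖z‖) ‖z‖) ν :=
    fun t ht => Integrable.mono' (h.levy.const_mul _) (hm1 t).aestronglyMeasurable
      (Eventually.of_forall (b1 t ht))
  have i2 : ∀ t ≥ 0, Integrable (fun z : E n => tangIncrement K t 1 (C * ‖z‖)) σ :=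
    fun t ht => Integrable.mono' (h.first_moment.const_mul _) (hm2 t).aestronglyMeasurable
      (Eventually.of_forall (b2 t ht))
  -- The absolute value of t keeps the integrand nonnegative, so that the limit exists on a full
  -- neighbourhood of 0.
  refine ⟨fun t => ∫ z, tangIncrementEven K |t| 1 (C * ‖z‖) ‖z‖ ∂ν
    + ∫ z, tangIncrement K |t| 1 (C * ‖z‖) ∂σ, ?_, ?_⟩
  · have hev : ∀ᶠ t : ℝ in 𝓝 0, |t| ≤ 1 := by
      filter_upwards [Metric.closedBall_mem_nhds (0 : ℝ) one_pos] with t ht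
      simpa using ht
    have hlim : ∀ d : ℝ, Tendsto (fun t : ℝ => tangIncrement K |t| 1 d) (𝓝 0) (𝓝 0) := fun d => by
      have : Continuous fun t : ℝ => tangIncrement K |t| 1 d := by unfold tangIncrement; fun_prop
      have := this.tendsto 0
      simpa [tangIncrement, hK] using this
    have t1 : Tendsto (fun t => ∫ z, tangIncrementEven K |t| 1 (C * ‖z‖) ‖z‖ ∂ν) (𝓝 0)
        (𝓝 (∫ _, 0 ∂ν)) := by
      refine tendsto_integral_filter_of_dominated_convergence
        (fun z => (K + 1 * C ^ 2) * min (‖z‖ ^ 2) 1)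
        (Eventually.of_forall fun t => (hm1 _).aestronglyMeasurable) ?_ (h.levy.const_mul _)
        (Eventually.of_forall fun z => ?_)
      · filter_upwards [hev] with t ht
        refine Eventually.of_forall fun z => (b1 |t| (abs_nonneg t) z).trans ?_
        gcongr
      · unfold tangIncrementEven
        split_ifs
        · have : Continuous fun t : ℝ => |t| * (C * ‖z‖) ^ 2 := by fun_prop
          simpa using this.tendsto 0
        · exact hlim _
    have t2 : Tendsto (fun t => ∫ z, tangIncrement K |t| 1 (C * ‖z‖) ∂σ) (𝓝 0)
        (𝓝 (∫ _, 0 ∂σ)) := by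
      refine tendsto_integral_filter_of_dominated_convergence
        (fun z => (K + 1 * (2 * 1 * C + C ^ 2)) * min 1 ‖z‖)
        (Eventually.of_forall fun t => (hm2 _).aestronglyMeasurable) ?_
        (h.first_moment.const_mul _) (Eventually.of_forall fun z => hlim _)
      filter_upwards [hev] with t ht
      refine Eventually.of_forall fun z => (b2 |t| (abs_nonneg t) z).trans ?_
      gcongr
    simpa using t1.add t2
  · intro α hα x hx y hy hxy
    have ht : 0 ≤ α * ‖tang x - tang y‖ ^ 2 := by positivity
    -- By homogeneity, a tangential difference proportional to |x' − y'| makes α and |x' − y'| enter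
    -- only through α|x' − y'|².
    have hsc : ∀ d, tangIncrement K α ‖tang x - tang y‖ (‖tang x - tang y‖ * d)
        = tangIncrement K (α * ‖tang x - tang y‖ ^ 2) 1 d := fun d => by
      unfold tangIncrement; congr 1; ring
    have hsc' : ∀ d r, tangIncrementEven K α ‖tang x - tang y‖ (‖tang x - tang y‖ * d) r
        = tangIncrementEven K (α * ‖tang x - tang y‖ ^ 2) 1 d r := fun d r => by
      unfold tangIncrementEven; rw [hsc]; split_ifs
      · ring
      · rfl
    obtain ⟨a1, a2⟩ := ae_add_measure_iff.1 (hC x hx y hy hxy)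
    simp only [abs_of_nonneg ht]
    refine add_le_add ?_ ?_
    · refine integral_mono_ae (h.integrable_tangIncrementEven hx hy hK hα (norm_nonneg _))
        (i1 _ ht) ?_
      filter_upwards [a1] with z hz
      rw [← hsc']
      exact tangIncrementEven_mono hα (norm_nonneg _) (norm_nonneg _) hz
    · refine integral_mono_ae (h.integrable_tangIncrement hx hy hK hα (norm_nonneg _))
        (i2 _ ht) ?_
      filter_upwards [a2] with z hz
      rw [← hsc]
      exact tangIncrement_mono hα (norm_nonneg _) (norm_nonneg _) hz

end JumpSetting

/-! ### Comparison -/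

namespace JumpSetting

variable {c : ℕ} {ν σ : Measure (E n)} {η : E n → E n → E n} {cη : ℝ} {f₁ f₂ u₁ u₂ : E n → ℝ}
  {K₁ K₂ K β : ℝ}

/-- By the contraction of landing heights the normal coordinates add nothing positive to the
increment of the penalization, whatever the size of γ. -/
lemma norm_sub_add_sq_sub_le (h : JumpSetting c ν σ η cη) {x y : E n} (hx : x ∈ closedHalf n)
    (hy : y ∈ closedHalf n) (z : E n) :
    ‖(x + η x z) - (y + η y z)‖ ^ 2 - ‖x - y‖ ^ 2
      ≤ 2 * inner ℝ (tang x - tang y) (tang (η x z) - tang (η y z))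
        + ‖tang (η x z) - tang (η y z)‖ ^ 2 ∧
    (nor (x + η x z) - nor (y + η y z)) ^ 2 ≤ (nor x - nor y) ^ 2 := by
  have h1 : (nor (x + η x z) - nor (y + η y z)) ^ 2 ≤ (nor x - nor y) ^ 2 :=
    sq_le_sq.2 (h.eta.normal_contraction x hx y hy z)
  refine ⟨?_, h1⟩
  rw [norm_sq_eq_tang_add_nor, norm_sq_eq_tang_add_nor (x - y), nor_sub, nor_sub]
  have h2 : tang (x + η x z - (y + η y z))
      = (tang x - tang y) + (tang (η x z) - tang (η y z)) := by
    rw [tang_sub, tang_add, tang_add]; abel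
  rw [h2, norm_add_sq_real, tang_sub]
  linarith

/-- The inequality at a maximum point of the doubled problem. -/
lemma doubling_le (h : JumpSetting c ν σ η cη) (hu₁ : IsSubsolution c (ν + σ) η cη f₁ u₁)
    (hu₂ : IsSubsolution c (ν + σ) η cη f₂ u₂) (hK₁ : ∀ x ∈ closedHalf n, |u₁ x| ≤ K₁)
    (hK₂ : ∀ x ∈ closedHalf n, |u₂ x| ≤ K₂) (hK : K₁ + K₂ < K) (hβ : 0 < β) {err : ℝ}
    (herr : ∀ x ∈ closedHalf n, ∀ δ ∈ Ioc (0 : ℝ) 1,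
      largeJumps (ν + σ) η δ (cutoff β) x ≤ err)
    {α γ : ℝ} (hα : 0 ≤ α) (hγ : 0 ≤ γ) {x y : E n} (hx : x ∈ closedHalf n)
    (hy : y ∈ closedHalf n)
    (hmax : ∀ a ∈ closedHalf n, ∀ b ∈ closedHalf n,
      u₁ a + u₂ b - K * cutoff β a - K * cutoff β b - α * ‖a - b‖ ^ 2 - γ * (nor a - nor b) ^ 2
      ≤ u₁ x + u₂ y - K * cutoff β x - K * cutoff β y - α * ‖x - y‖ ^ 2
        - γ * (nor x - nor y) ^ 2) :
    u₁ x + u₂ y ≤ f₁ x + f₂ y + tangErr ν σ η (4 * K) α x y + 2 * K * err := by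
  have h0K₁ : 0 ≤ K₁ := (abs_nonneg _).trans (hK₁ x hx)
  have h0K₂ : 0 ≤ K₂ := (abs_nonneg _).trans (hK₂ x hx)
  have h0K : 0 < K := by linarith
  refine le_of_forall_pos_le_add fun ρ hρ => ?_
  have e1 := hu₁.eventually_le h (φ := penalty K β α γ y) (contDiff_penalty hβ K α γ y) hx
    (fun a ha => by
      have := hmax a ha y hy
      unfold penalty; linarith)
    (fun h0 _ => normalDeriv_penalty_neg hβ h0K hα hγ hy h0) (half_pos hρ)
  have e2 := hu₂.eventually_le h (φ := penalty K β α γ x) (contDiff_penalty hβ K α γ x) hy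
    (fun b hb => by
      have := hmax x hx b hb
      unfold penalty
      rw [norm_sub_rev y x, norm_sub_rev b x]
      linarith [sq_nonneg (nor b - nor x)])
    (fun h0 _ => normalDeriv_penalty_neg hβ h0K hα hγ hx h0) (half_pos hρ)
  -- A common δ for both points, so that the integrals over |z| ≥ δ can be added.
  obtain ⟨δ, ⟨e1, e2⟩, hδ⟩ := ((e1.and e2).and (Ioc_mem_nhdsGT one_pos)).exists
  have hχm : Measurable ((closedHalf n).domRestrict (cutoff β)) :=
    (contDiff_cutoff hβ).continuous.measurable.comp measurable_subtype_coe
  have hχ : ∀ a b : E n, |cutoff β a - cutoff β b| ≤ 1 := fun a b =>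
    abs_le.2 ⟨by linarith [cutoff_nonneg hβ a, cutoff_le_one hβ b],
      by linarith [cutoff_nonneg hβ b, cutoff_le_one hβ a]⟩
  have hχ1 : ∀ a ∈ closedHalf n, |cutoff β a| ≤ 1 := fun a _ =>
    abs_le.2 ⟨by linarith [cutoff_nonneg hβ a], cutoff_le_one hβ a⟩
  obtain ⟨i1, j1⟩ := h.largeJumps_eq hx hδ.1 hu₁.measurable hK₁
  obtain ⟨i2, j2⟩ := h.largeJumps_eq hy hδ.1 hu₂.measurable hK₂
  obtain ⟨i3, j3⟩ := h.largeJumps_eq hx hδ.1 hχm hχ1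
  obtain ⟨i4, j4⟩ := h.largeJumps_eq hy hδ.1 hχm hχ1
  set R : E n → ℝ := fun z => (u₁ (x + η x z) - u₁ x) + (u₂ (y + η y z) - u₂ y)
    - K * (cutoff β (x + η x z) - cutoff β x) - K * (cutoff β (y + η y z) - cutoff β y) with hR
  have hRi : ∫ z in shell n (Ici δ), R z ∂(ν + σ) = largeJumps (ν + σ) η δ u₁ x
      + largeJumps (ν + σ) η δ u₂ y - K * largeJumps (ν + σ) η δ (cutoff β) x
      - K * largeJumps (ν + σ) η δ (cutoff β) y := by
    rw [hR, integral_sub, integral_sub, integral_add, integral_const_mul, integral_const_mul]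
    · rfl
    · exact i1.add_measure j1
    · exact i2.add_measure j2
    · exact (i1.add_measure j1).add (i2.add_measure j2)
    · exact (i3.add_measure j3).const_mul K
    · exact ((i1.add_measure j1).add (i2.add_measure j2)).sub ((i3.add_measure j3).const_mul K)
    · exact (i4.add_measure j4).const_mul K
  -- The cap: the increments of `u₁`, `u₂` and the two cut-off terms add up to at most 2K₁ + 2K₂ +
  -- 2K ≤ 4K. The quadratic bound on `R` is maximality tested at the two landing points of the same
  -- jump z.
  have hT := h.setIntegral_le_tangErr hx hy (K := 4 * K) (by linarith) hα hδ.1 (R := R)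
    (((i1.add i2).sub (i3.const_mul K)).sub (i4.const_mul K))
    (((j1.add j2).sub (j3.const_mul K)).sub (j4.const_mul K))
    (fun z => by
      have a1 := abs_le.1 (hK₁ _ (h.eta.stays_inside x hx z))
      have a2 := abs_le.1 (hK₂ _ (h.eta.stays_inside y hy z))
      have a3 := abs_le.1 (hK₁ x hx)
      have a4 := abs_le.1 (hK₂ y hy)
      have a5 := (abs_le.1 (hχ (x + η x z) x)).1
      have a6 := (abs_le.1 (hχ (y + η y z) y)).1
      have : R z = (u₁ (x + η x z) - u₁ x) + (u₂ (y + η y z) - u₂ y)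
        - K * (cutoff β (x + η x z) - cutoff β x)
        - K * (cutoff β (y + η y z) - cutoff β y) := rfl
      nlinarith)
    (fun z => by
      have a1 := hmax _ (h.eta.stays_inside x hx z) _ (h.eta.stays_inside y hy z)
      obtain ⟨a2, a3⟩ := h.norm_sub_add_sq_sub_le hx hy z
      have a4 := mul_le_mul_of_nonneg_left a2 hα
      have a5 := mul_le_mul_of_nonneg_left a3 hγ
      have : R z = (u₁ (x + η x z) - u₁ x) + (u₂ (y + η y z) - u₂ y)
        - K * (cutoff β (x + η x z) - cutoff β x)
        - K * (cutoff β (y + η y z) - cutoff β y) := rfl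
      linarith)
  rw [hRi] at hT
  have b1 := mul_le_mul_of_nonneg_left (herr x hx δ hδ) h0K.le
  have b2 := mul_le_mul_of_nonneg_left (herr y hy δ hδ) h0K.le
  linarith

/-- The penalized sum is coercive. -/
lemma norm_le_of_le_cutoff {M : ℝ} (hβ : 0 < β) (hM : 0 < M) {x : E n}
    (hx : M ≤ K - K * cutoff β x) : ‖x‖ ≤ 1 + √(K / (M * β)) := by
  have h1 : M ≤ K * (1 + β * ‖x - unitN n‖ ^ 2)⁻¹ := by unfold cutoff at hx; linarith
  have h2 : 0 < 1 + β * ‖x - unitN n‖ ^ 2 := by positivity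
  rw [← div_eq_mul_inv, le_div_iff₀ h2] at h1
  have h3 : ‖x - unitN n‖ ≤ √(K / (M * β)) := by
    apply Real.le_sqrt_of_sq_le
    rw [le_div_iff₀ (by positivity)]
    nlinarith
  have h4 : ‖unitN n‖ = 1 := by simp [unitN]
  have := norm_add_le (x - unitN n) (unitN n)
  rw [sub_add_cancel] at this
  linarith

lemma upperSemicontinuousOn_sum (hu₁ : UpperSemicontinuousOn u₁ (closedHalf n))
    (hu₂ : UpperSemicontinuousOn u₂ (closedHalf n)) {ψ : E n × E n → ℝ} (hψ : Continuous ψ) :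
    UpperSemicontinuousOn (fun q : E n × E n => u₁ q.1 + u₂ q.2 - ψ q)
      (closedHalf n ×ˢ closedHalf n) := by
  have a1 : UpperSemicontinuousOn (fun q : E n × E n => u₁ q.1) (closedHalf n ×ˢ closedHalf n) :=
    hu₁.comp (g := Prod.fst) continuous_fst.continuousOn fun q hq => hq.1
  have a2 : UpperSemicontinuousOn (fun q : E n × E n => u₂ q.2) (closedHalf n ×ˢ closedHalf n) :=
    hu₂.comp (g := Prod.snd) continuous_snd.continuousOn fun q hq => hq.2
  simp_rw [sub_eq_add_neg]
  exact (a1.add a2).add hψ.neg.continuousOn.upperSemicontinuousOn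

/-- Existence of maximum points of the doubled problem. -/
lemma exists_doubling_max (hu₁ : UpperSemicontinuousOn u₁ (closedHalf n))
    (hu₂ : UpperSemicontinuousOn u₂ (closedHalf n)) (hK₁ : ∀ x ∈ closedHalf n, |u₁ x| ≤ K₁)
    (hK₂ : ∀ x ∈ closedHalf n, |u₂ x| ≤ K₂) (hK : K₁ + K₂ < K) (hβ : 0 < β) {M : ℝ} (hM : 0 < M)
    {x₀ : E n} (hx₀ : x₀ ∈ closedHalf n) (hMx : M ≤ u₁ x₀ + u₂ x₀ - 2 * K * cutoff β x₀)
    {ψ : E n × E n → ℝ} (hψ : Continuous ψ) (hψ0 : ∀ q, 0 ≤ ψ q) (hψd : ψ (x₀, x₀) = 0) :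
    ∃ x ∈ closedHalf n, ∃ y ∈ closedHalf n, ‖x‖ ≤ 1 + √(K / (M * β)) ∧
      ‖y‖ ≤ 1 + √(K / (M * β)) ∧ M ≤ u₁ x + u₂ y - K * cutoff β x - K * cutoff β y - ψ (x, y) ∧
      ∀ a ∈ closedHalf n, ∀ b ∈ closedHalf n,
        u₁ a + u₂ b - K * cutoff β a - K * cutoff β b - ψ (a, b)
          ≤ u₁ x + u₂ y - K * cutoff β x - K * cutoff β y - ψ (x, y) := by
  have h0K₁ : 0 ≤ K₁ := (abs_nonneg _).trans (hK₁ x₀ hx₀)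
  have h0K₂ : 0 ≤ K₂ := (abs_nonneg _).trans (hK₂ x₀ hx₀)
  have h0K : 0 < K := by linarith
  set Ψ : E n × E n → ℝ := fun q => u₁ q.1 + u₂ q.2
    - (K * cutoff β q.1 + K * cutoff β q.2 + ψ q) with hΨ
  have hcχ : Continuous (cutoff β : E n → ℝ) := (contDiff_cutoff hβ).continuous
  have hu : UpperSemicontinuousOn Ψ (closedHalf n ×ˢ closedHalf n) :=
    upperSemicontinuousOn_sum hu₁ hu₂ (by fun_prop)
  have hcoer : ∀ a ∈ closedHalf n, ∀ b ∈ closedHalf n, M ≤ Ψ (a, b) →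
      ‖a‖ ≤ 1 + √(K / (M * β)) ∧ ‖b‖ ≤ 1 + √(K / (M * β)) := by
    intro a ha b hb hab
    have b1 := (le_abs_self _).trans (hK₁ a ha)
    have b2 := (le_abs_self _).trans (hK₂ b hb)
    have b3 := mul_nonneg h0K.le (cutoff_nonneg hβ a)
    have b4 := mul_nonneg h0K.le (cutoff_nonneg hβ b)
    have b5 := hψ0 (a, b)
    simp only [hΨ] at hab
    exact ⟨norm_le_of_le_cutoff hβ hM (by linarith),
      norm_le_of_le_cutoff hβ hM (by linarith)⟩
  have hM0 : M ≤ Ψ (x₀, x₀) := by simp only [hΨ, hψd]; linarith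
  set S : Set (E n) := Metric.closedBall 0 (1 + √(K / (M * β))) ∩ closedHalf n
  have hmem : ∀ a ∈ closedHalf n, ∀ b ∈ closedHalf n, M ≤ Ψ (a, b) → (a, b) ∈ S ×ˢ S :=
    fun a ha b hb hab => ⟨⟨mem_closedBall_zero_iff.2 (hcoer a ha b hb hab).1, ha⟩,
      ⟨mem_closedBall_zero_iff.2 (hcoer a ha b hb hab).2, hb⟩⟩
  have hS : IsCompact S := (isCompact_closedBall _ _).inter_right isClosed_closedHalf
  obtain ⟨q, hq, hqm⟩ := UpperSemicontinuousOn.exists_isMaxOn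
    ⟨(x₀, x₀), hmem x₀ hx₀ x₀ hx₀ hM0⟩ (hS.prod hS)
    (hu.mono (prod_mono inter_subset_right inter_subset_right))
  have hMq : M ≤ Ψ q := hM0.trans (hqm (hmem x₀ hx₀ x₀ hx₀ hM0))
  refine ⟨q.1, hq.1.2, q.2, hq.2.2, mem_closedBall_zero_iff.1 hq.1.1,
    mem_closedBall_zero_iff.1 hq.2.1, ?_, fun a ha b hb => ?_⟩
  · have : Ψ q = u₁ q.1 + u₂ q.2 - (K * cutoff β q.1 + K * cutoff β q.2 + ψ q) := rfl
    change M ≤ _ - ψ q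
    linarith
  · have hle : Ψ (a, b) ≤ Ψ q := by
      by_cases hab : M ≤ Ψ (a, b)
      · exact hqm (hmem a ha b hb hab)
      · linarith
    change _ ≤ _ - ψ q
    simp only [hΨ] at hle
    linarith

/-- The limit of infinite penalization of the normal coordinates. -/
lemma exists_tangential_doubling (h : JumpSetting c ν σ η cη)
    (hu₁ : IsSubsolution c (ν + σ) η cη f₁ u₁)
    (hu₂ : IsSubsolution c (ν + σ) η cη f₂ u₂) (hf₁ : ContinuousOn f₁ (closedHalf n))
    (hf₂ : ContinuousOn f₂ (closedHalf n)) (hK₁ : ∀ x ∈ closedHalf n, |u₁ x| ≤ K₁)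
    (hK₂ : ∀ x ∈ closedHalf n, |u₂ x| ≤ K₂) (hK : K₁ + K₂ < K) (hβ : 0 < β) {err : ℝ}
    (herr : ∀ x ∈ closedHalf n, ∀ δ ∈ Ioc (0 : ℝ) 1,
      largeJumps (ν + σ) η δ (cutoff β) x ≤ err)
    {M : ℝ} (hM : 0 < M) {x₀ : E n} (hx₀ : x₀ ∈ closedHalf n)
    (hMx : M ≤ u₁ x₀ + u₂ x₀ - 2 * K * cutoff β x₀) {α : ℝ} (hα : 0 ≤ α) :
    ∃ x ∈ closedHalf n, ∃ y ∈ closedHalf n, ‖x‖ ≤ 1 + √(K / (M * β)) ∧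
      ‖y‖ ≤ 1 + √(K / (M * β)) ∧ nor x = nor y ∧
      M ≤ u₁ x + u₂ y - K * cutoff β x - K * cutoff β y - α * ‖x - y‖ ^ 2 ∧
      M ≤ f₁ x + f₂ y + tangErr ν σ η (4 * K) α x y + 2 * K * err := by
  have h0K₁ : 0 ≤ K₁ := (abs_nonneg _).trans (hK₁ x₀ hx₀)
  have h0K₂ : 0 ≤ K₂ := (abs_nonneg _).trans (hK₂ x₀ hx₀)
  have h0K : 0 < K := by linarith
  have hcn := continuous_nor (n := n)
  -- Here α is fixed and k plays the role of γ.
  have hex := fun k : ℕ => exists_doubling_max hu₁.usc hu₂.usc hK₁ hK₂ hK hβ hM hx₀ hMx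
    (ψ := fun q => α * ‖q.1 - q.2‖ ^ 2 + k * (nor q.1 - nor q.2) ^ 2) (by fun_prop)
    (fun q => by positivity) (by simp)
  choose x hx y hy hxR hyR hMk hmax using hex
  have hineq := fun k : ℕ => h.doubling_le hu₁ hu₂ hK₁ hK₂ hK hβ herr hα (Nat.cast_nonneg k)
    (hx k) (hy k) fun a ha b hb => by
      have := hmax k a ha b hb
      simp only at this
      linarith
  set S : Set (E n) := Metric.closedBall 0 (1 + √(K / (M * β))) ∩ closedHalf n
  have hS : IsCompact S := (isCompact_closedBall _ _).inter_right isClosed_closedHalf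
  obtain ⟨q, hq, ξ, hξ, hlim⟩ := (hS.prod hS).tendsto_subseq (x := fun k => (x k, y k))
    fun k => ⟨⟨mem_closedBall_zero_iff.2 (hxR k), hx k⟩, ⟨mem_closedBall_zero_iff.2 (hyR k), hy k⟩⟩
  have hlx : Tendsto (fun k => x (ξ k)) atTop (𝓝 q.1) := (continuous_fst.tendsto q).comp hlim
  have hly : Tendsto (fun k => y (ξ k)) atTop (𝓝 q.2) := (continuous_snd.tendsto q).comp hlim
  have bnd : ∀ k, u₁ (x k) + u₂ (y k) ≤ K ∧ 0 ≤ K * cutoff β (x k) ∧ 0 ≤ K * cutoff β (y k) :=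
    fun k => ⟨by linarith [(le_abs_self _).trans (hK₁ _ (hx k)),
      (le_abs_self _).trans (hK₂ _ (hy k))], mul_nonneg h0K.le (cutoff_nonneg hβ _),
      mul_nonneg h0K.le (cutoff_nonneg hβ _)⟩
  have hdist : ∀ k, α * ‖x k - y k‖ ^ 2 ≤ u₁ (x k) + u₂ (y k) - K * cutoff β (x k)
      - K * cutoff β (y k) - M := fun k => by
    have a1 := hMk k
    have a2 : 0 ≤ (k : ℝ) * (nor (x k) - nor (y k)) ^ 2 := by positivity
    simp only at a1
    linarith
  refine ⟨q.1, hq.1.2, q.2, hq.2.2, mem_closedBall_zero_iff.1 hq.1.1,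
    mem_closedBall_zero_iff.1 hq.2.1, ?_, ?_, ?_⟩
  · have h1 : Tendsto (fun k => (nor (x (ξ k)) - nor (y (ξ k))) ^ 2) atTop
        (𝓝 ((nor q.1 - nor q.2) ^ 2)) :=
      (((hcn.tendsto _).comp hlx).sub ((hcn.tendsto _).comp hly)).pow 2
    -- Since M > 0, the value at the maximum gives k(x_N − y_N)² ≤ u₁ + u₂ ≤ K.
    have h2 : Tendsto (fun k => K / ((ξ k : ℕ) : ℝ)) atTop (𝓝 0) :=
      tendsto_const_nhds.div_atTop (tendsto_natCast_atTop_atTop.comp hξ.tendsto_atTop)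
    have h3 : (nor q.1 - nor q.2) ^ 2 ≤ 0 := by
      refine le_of_tendsto_of_tendsto h1 h2 ?_
      filter_upwards [hξ.tendsto_atTop.eventually_ge_atTop 1] with k hk
      have hk' : (0 : ℝ) < ξ k := by exact_mod_cast hk
      rw [le_div_iff₀ hk']
      have a1 := hMk (ξ k)
      have a2 : 0 ≤ α * ‖x (ξ k) - y (ξ k)‖ ^ 2 := by positivity
      simp only at a1
      linarith [bnd (ξ k)]
    have := pow_eq_zero_iff (two_ne_zero) |>.1 (le_antisymm h3 (sq_nonneg _))
    linarith
  -- Dropping the normal penalty keeps the values at the maximum points above M, and upper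
  -- semicontinuity hands this bound to the limit point.
  · by_contra! hlt
    have hcχ : Continuous (cutoff β : E n → ℝ) := (contDiff_cutoff hβ).continuous
    have husc := upperSemicontinuousOn_sum hu₁.usc hu₂.usc (ψ := fun q : E n × E n =>
      K * cutoff β q.1 + K * cutoff β q.2 + α * ‖q.1 - q.2‖ ^ 2) (by fun_prop) q
      ⟨hq.1.2, hq.2.2⟩ M (by simp only; linarith)
    have hw : Tendsto (fun k => (x (ξ k), y (ξ k))) atTop
        (𝓝[closedHalf n ×ˢ closedHalf n] q) :=
      tendsto_nhdsWithin_iff.2 ⟨hlim, Eventually.of_forall fun k => ⟨hx _, hy _⟩⟩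
    obtain ⟨k, hk⟩ := (hw.eventually husc).exists
    simp only at hk
    linarith [hdist (ξ k)]
  · have hw1 : Tendsto (fun k => x (ξ k)) atTop (𝓝[closedHalf n] q.1) :=
      tendsto_nhdsWithin_iff.2 ⟨hlx, Eventually.of_forall fun k => hx _⟩
    have hw2 : Tendsto (fun k => y (ξ k)) atTop (𝓝[closedHalf n] q.2) :=
      tendsto_nhdsWithin_iff.2 ⟨hly, Eventually.of_forall fun k => hy _⟩
    have hT := h.tendsto_tangErr (K := 4 * K) (by linarith) hα (fun k => hx (ξ k))
      (fun k => hy (ξ k)) hlx hly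
    -- Upper semicontinuity does not let u₁ + u₂ pass to the limit on the left. Its constant lower
    -- bound M does, against a right-hand side that is continuous.
    refine ge_of_tendsto (((((hf₁ _ hq.1.2).tendsto.comp hw1).add
      ((hf₂ _ hq.2.2).tendsto.comp hw2)).add hT).add_const (2 * K * err))
      (Eventually.of_forall fun k => ?_)
    have a1 : 0 ≤ α * ‖x (ξ k) - y (ξ k)‖ ^ 2 := by positivity
    have := hineq (ξ k)
    have := bnd (ξ k)
    have := hdist (ξ k)
    simp only [Function.comp]
    linarith

/-- Comparison, in symmetric form. -/
theorem add_nonpos (h : JumpSetting c ν σ η cη)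
    (hu₁ : IsSubsolution c (ν + σ) η cη f₁ u₁) (hu₂ : IsSubsolution c (ν + σ) η cη f₂ u₂)
    (hf₁ : ContinuousOn f₁ (closedHalf n)) (hf₂ : ContinuousOn f₂ (closedHalf n))
    (hf : ∀ x ∈ closedHalf n, f₁ x + f₂ x ≤ 0) {x : E n} (hx : x ∈ closedHalf n) :
    u₁ x + u₂ x ≤ 0 := by
  by_contra! hpos
  obtain ⟨K₁, hK₁⟩ := hu₁.bounded
  obtain ⟨K₂, hK₂⟩ := hu₂.bounded
  have h0K₁ : 0 ≤ K₁ := (abs_nonneg _).trans (hK₁ x hx)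
  have h0K₂ : 0 ≤ K₂ := (abs_nonneg _).trans (hK₂ x hx)
  obtain ⟨K, hK⟩ : ∃ K, K₁ + K₂ < K := exists_gt _
  have h0K : 0 < K := by linarith
  obtain ⟨err, herr0, herr⟩ := h.exists_cutoff_largeJumps_le
  -- β is chosen so that the cut-off at `x` and the error it causes together stay below the supposed
  -- positive value of u₁ + u₂.
  obtain ⟨β, hβs, hβ⟩ : ∃ β, 2 * K * cutoff β x + 2 * K * |err β| < u₁ x + u₂ x ∧ 0 < β := by
    have := ((tendsto_cutoff_zero x).const_mul (2 * K)).add (herr0.abs.const_mul (2 * K))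
    simp only [mul_zero, add_zero, abs_zero] at this
    exact ((this.eventually (gt_mem_nhds hpos)).and self_mem_nhdsWithin).exists
  have hcχ : Continuous (cutoff β : E n → ℝ) := (contDiff_cutoff hβ).continuous
  set θ : E n → ℝ := fun z => u₁ z + u₂ z - 2 * K * cutoff β z with hθ
  have hθx : 2 * K * |err β| < θ x := by simp only [hθ]; linarith
  have hθ0 : 0 < θ x := lt_of_le_of_lt (by positivity) hθx
  have hθusc : UpperSemicontinuousOn θ (closedHalf n) := by
    have := upperSemicontinuousOn_sum hu₁.usc hu₂.usc
      (ψ := fun q : E n × E n => 2 * K * cutoff β q.1) (by fun_prop)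
    exact this.comp (g := fun z => (z, z)) (by fun_prop) fun z hz => ⟨hz, hz⟩
  obtain ⟨x₀, hx₀, hx₀m⟩ : ∃ x₀ ∈ closedHalf n, ∀ a ∈ closedHalf n, θ a ≤ θ x₀ := by
    set S : Set (E n) := Metric.closedBall 0 (1 + √(K / (θ x * β))) ∩ closedHalf n
    have hS : IsCompact S := (isCompact_closedBall _ _).inter_right isClosed_closedHalf
    have hmem : ∀ a ∈ closedHalf n, θ x ≤ θ a → a ∈ S := fun a ha hxa => by
      refine ⟨mem_closedBall_zero_iff.2 (norm_le_of_le_cutoff hβ hθ0 ?_), ha⟩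
      have b1 := (le_abs_self _).trans (hK₁ a ha)
      have b2 := (le_abs_self _).trans (hK₂ a ha)
      have b3 := mul_nonneg h0K.le (cutoff_nonneg hβ a)
      have b4 : θ a = u₁ a + u₂ a - 2 * K * cutoff β a := rfl
      linarith
    obtain ⟨x₀, hx₀, hm⟩ := UpperSemicontinuousOn.exists_isMaxOn ⟨x, hmem x hx le_rfl⟩ hS
      (hθusc.mono inter_subset_right)
    refine ⟨x₀, hx₀.2, fun a ha => ?_⟩
    by_cases hxa : θ x ≤ θ a
    · exact hm (hmem a ha hxa)
    · exact (not_le.1 hxa).le.trans (hm (hmem x hx le_rfl))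
  have hM : 0 < θ x₀ := hθ0.trans_le (hx₀m x hx)
  have hex := fun j : ℕ => h.exists_tangential_doubling hu₁ hu₂ hf₁ hf₂ hK₁ hK₂ hK hβ
    (herr β hβ) hM hx₀ le_rfl (Nat.cast_nonneg (α := ℝ) j)
  choose X hX Y hY hXR hYR hnor hval hineq using hex
  set S : Set (E n) := Metric.closedBall 0 (1 + √(K / (θ x₀ * β))) ∩ closedHalf n
  have hS : IsCompact S := (isCompact_closedBall _ _).inter_right isClosed_closedHalf
  obtain ⟨q, hq, ξ, hξ, hlim⟩ := (hS.prod hS).tendsto_subseq (x := fun k => (X k, Y k))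
    fun k => ⟨⟨mem_closedBall_zero_iff.2 (hXR k), hX k⟩, ⟨mem_closedBall_zero_iff.2 (hYR k), hY k⟩⟩
  have hlx : Tendsto (fun k => X (ξ k)) atTop (𝓝 q.1) := (continuous_fst.tendsto q).comp hlim
  have hly : Tendsto (fun k => Y (ξ k)) atTop (𝓝 q.2) := (continuous_snd.tendsto q).comp hlim
  have hξt : Tendsto (fun k => ((ξ k : ℕ) : ℝ)) atTop atTop :=
    tendsto_natCast_atTop_atTop.comp hξ.tendsto_atTop
  have hq12 : q.1 = q.2 := by
    have h1 : Tendsto (fun k => ‖X (ξ k) - Y (ξ k)‖ ^ 2) atTop (𝓝 (‖q.1 - q.2‖ ^ 2)) :=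
      ((hlx.sub hly).norm).pow 2
    have h2 : ‖q.1 - q.2‖ ^ 2 ≤ 0 := by
      refine le_of_tendsto_of_tendsto h1 (tendsto_const_nhds.div_atTop (a := K) hξt) ?_
      filter_upwards [hξt.eventually_gt_atTop 0] with k hk
      rw [le_div_iff₀ hk]
      have := hval (ξ k)
      have b1 := (le_abs_self _).trans (hK₁ _ (hX (ξ k)))
      have b2 := (le_abs_self _).trans (hK₂ _ (hY (ξ k)))
      have b3 := mul_nonneg h0K.le (cutoff_nonneg hβ (X (ξ k)))
      have b4 := mul_nonneg h0K.le (cutoff_nonneg hβ (Y (ξ k)))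
      linarith
    have := (pow_eq_zero_iff two_ne_zero).1 (le_antisymm h2 (sq_nonneg _))
    exact sub_eq_zero.1 (norm_eq_zero.1 this)
  -- The penalty is at most the excess over M = θ(x₀) of the cut-off sum at the doubled points; in
  -- the limit the points merge and the excess is at most θ(q.1) − θ(x₀) ≤ 0.
  have hdist : Tendsto (fun k => (ξ k : ℝ) * ‖X (ξ k) - Y (ξ k)‖ ^ 2) atTop (𝓝 0) := by
    refine tendsto_order.2 ⟨fun a ha => Eventually.of_forall fun k => ha.trans_le (by positivity),
      fun a ha => ?_⟩
    have hw : Tendsto (fun k => (X (ξ k), Y (ξ k))) atTop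
        (𝓝[closedHalf n ×ˢ closedHalf n] q) :=
      tendsto_nhdsWithin_iff.2 ⟨hlim, Eventually.of_forall fun k => ⟨hX _, hY _⟩⟩
    have husc := upperSemicontinuousOn_sum hu₁.usc hu₂.usc (ψ := fun q : E n × E n =>
      K * cutoff β q.1 + K * cutoff β q.2) (by fun_prop) q ⟨hq.1.2, hq.2.2⟩ (θ x₀ + a) (by
        have := hx₀m q.1 hq.1.2
        simp only [hθ] at this ⊢
        rw [← hq12]
        linarith)
    filter_upwards [hw.eventually husc] with k hk
    have := hval (ξ k)
    linarith
  have htang : Tendsto (fun k => (ξ k : ℝ) * ‖tang (X (ξ k)) - tang (Y (ξ k))‖ ^ 2) atTop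
      (𝓝 0) := by
    refine squeeze_zero (fun k => by positivity) (fun k => ?_) hdist
    rw [← tang_sub]
    have := norm_tang_le (X (ξ k) - Y (ξ k))
    gcongr
  obtain ⟨ω, hω0, hω⟩ := h.exists_tangErr_le (K := 4 * K) (by linarith)
  have hw1 : Tendsto (fun k => X (ξ k)) atTop (𝓝[closedHalf n] q.1) :=
    tendsto_nhdsWithin_iff.2 ⟨hlx, Eventually.of_forall fun k => hX _⟩
  have hw2 : Tendsto (fun k => Y (ξ k)) atTop (𝓝[closedHalf n] q.2) :=
    tendsto_nhdsWithin_iff.2 ⟨hly, Eventually.of_forall fun k => hY _⟩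
  -- In the limit θ(x₀) ≤ f₁ + f₂ + 2K err ≤ 2K|err| at the common limit point, against the choice
  -- of β.
  have hfin := ge_of_tendsto (((((hf₁ _ hq.1.2).tendsto.comp hw1).add
      ((hf₂ _ hq.2.2).tendsto.comp hw2)).add (hω0.comp htang)).add_const (2 * K * err β))
      (b := θ x₀) (Eventually.of_forall fun k => by
        have a1 := hω (ξ k) (Nat.cast_nonneg _) _ (hX (ξ k)) _ (hY (ξ k)) (hnor (ξ k))
        have a2 := hineq (ξ k)
        simp only [Function.comp]
        linarith)
  rw [← hq12] at hfin
  have a1 := hf q.1 hq.1.2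
  have a2 := hx₀m x hx
  have a3 : 2 * K * err β ≤ 2 * K * |err β| := by gcongr; exact le_abs_self _
  linarith

end JumpSetting

/-! ### Truncated problems -/

namespace JumpSetting

variable {c : ℕ} {ν σ : Measure (E n)} {η : E n → E n → E n} {cη : ℝ}

lemma isFiniteMeasure_restrict (h : JumpSetting c ν σ η cη) {b : ℝ} (hb : 0 < b) :
    IsFiniteMeasure ((ν + σ).restrict (shell n (Ici b))) := by
  obtain ⟨f1, f2⟩ := h.measure_shell_lt_top (J := Ici b) hb subset_rfl
  exact ⟨by simp [f1, f2]⟩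

/-- The landing point of a jump, as a point of the closed half space. -/
def landing (h : JumpSetting c ν σ η cη) (x : closedHalf n) (z : E n) : closedHalf n :=
  ⟨x + η x z, h.eta.stays_inside x x.2 z⟩

lemma measurable_landing (h : JumpSetting c ν σ η cη) (x : closedHalf n) :
    Measurable (h.landing x) :=
  (measurable_const.add (h.eta.measurable x x.2)).subtype_mk

lemma tendsto_landing (h : JumpSetting c ν σ η cη) (x : closedHalf n) {τ : Measure (E n)}
    (hτ : τ ≪ ν + σ) :
    ∀ᵐ z ∂τ, Tendsto (fun y => h.landing y z) (𝓝 x) (𝓝 (h.landing x z)) := by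
  filter_upwards [hτ.ae_le (h.eta.weak_continuity x x.2)] with z hz
  have hv : Tendsto (fun y : closedHalf n => (y : E n)) (𝓝 x) (𝓝[closedHalf n] x) :=
    tendsto_nhdsWithin_iff.2 ⟨continuous_subtype_val.tendsto x, Eventually.of_forall fun y => y.2⟩
  refine tendsto_subtype_rng.2 ?_
  exact (hv.mono_right nhdsWithin_le_nhds).add (hz.comp hv)

open BoundedContinuousFunction in
/-- The problem truncated at jumps of size `b` has a continuous solution. -/
lemma exists_truncated_solution (h : JumpSetting c ν σ η cη) {f : E n → ℝ}
    (hf : ContinuousOn f (closedHalf n)) {K : ℝ} (hK : ∀ x ∈ closedHalf n, |f x| ≤ K) {b : ℝ}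
    (hb : 0 < b) : ∃ u : E n → ℝ, ContinuousOn u (closedHalf n) ∧ (∀ x, |u x| ≤ K) ∧
      ∀ x ∈ closedHalf n, u x = f x + largeJumps (ν + σ) η b u x := by
  have h0 : (0 : E n) ∈ closedHalf n := by simp [nor]
  have hK0 : 0 ≤ K := (abs_nonneg _).trans (hK 0 h0)
  have hfin := h.isFiniteMeasure_restrict hb
  set m : Measure (E n) := (ν + σ).restrict (shell n (Ici b))
  set l : ℝ := m.real univ
  have hl : 0 ≤ l := measureReal_nonneg
  have hint : ∀ (U : closedHalf n →ᵇ ℝ) (x : closedHalf n),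
      Integrable (fun z => U (h.landing x z)) m := fun U x =>
    Integrable.of_bound
      (U.continuous.measurable.comp (h.measurable_landing x)).aestronglyMeasurable ‖U‖
      (Eventually.of_forall fun z => U.norm_coe_le_norm _)
  have hbd : ∀ (U : closedHalf n →ᵇ ℝ) (x : closedHalf n),
      |∫ z, U (h.landing x z) ∂m| ≤ ‖U‖ * l := fun U x =>
    norm_integral_le_of_norm_le_const (Eventually.of_forall fun z => U.norm_coe_le_norm _)
  have hcont : ∀ U : closedHalf n →ᵇ ℝ,
      Continuous fun x : closedHalf n => (f x + ∫ z, U (h.landing x z) ∂m) / (1 + l) := by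
    intro U
    refine (Continuous.add (continuousOn_iff_continuous_domRestrict.1 hf) ?_).div_const _
    refine continuous_iff_continuousAt.2 fun x => ?_
    refine tendsto_integral_filter_of_dominated_convergence (fun _ => ‖U‖)
      (Eventually.of_forall fun y => (hint U y).aestronglyMeasurable)
      (Eventually.of_forall fun y => Eventually.of_forall fun z => U.norm_coe_le_norm _)
      (integrable_const _) ?_
    filter_upwards [h.tendsto_landing x (τ := m) Measure.restrict_le_self.absolutelyContinuous]
      with z hz
    exact (U.continuous.tendsto _).comp hz
  -- With l the finite mass of the remaining jumps, the truncated equation reads (1 + l)U = f + ∫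
  -- U(P) dm; this gives the contraction factor l/(1 + l). Continuity of the image function rests on
  -- the a.e. continuity of `η` in the starting point.
  set T : (closedHalf n →ᵇ ℝ) → (closedHalf n →ᵇ ℝ) := fun U =>
    BoundedContinuousFunction.ofNormedAddCommGroup
      (fun x : closedHalf n => (f x + ∫ z, U (h.landing x z) ∂m) / (1 + l)) (hcont U)
      ((K + ‖U‖ * l) / (1 + l)) fun x => by
        rw [Real.norm_eq_abs, abs_div, abs_of_pos (by positivity : 0 < 1 + l)]
        gcongr
        exact (abs_add_le _ _).trans (add_le_add (hK x x.2) (hbd U x)) with hT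
  have hTc : ContractingWith (l / (1 + l)).toNNReal T := by
    refine ⟨?_, LipschitzWith.of_dist_le_mul fun U V => ?_⟩
    · rw [Real.toNNReal_lt_one, div_lt_one (by positivity)]; linarith
    · rw [Real.coe_toNNReal _ (by positivity)]
      have h0' : 0 ≤ l / (1 + l) * dist U V := by positivity
      refine (BoundedContinuousFunction.dist_le h0').2 fun x => ?_
      change dist ((f x + ∫ z, U (h.landing x z) ∂m) / (1 + l))
        ((f x + ∫ z, V (h.landing x z) ∂m) / (1 + l)) ≤ l / (1 + l) * dist U V
      rw [Real.dist_eq, ← sub_div, add_sub_add_left_eq_sub, ← integral_sub (hint U x) (hint V x),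
        abs_div, abs_of_pos (by positivity : 0 < 1 + l), div_mul_eq_mul_div]
      gcongr
      rw [mul_comm]
      refine norm_integral_le_of_norm_le_const (μ := m) (C := dist U V)
        (f := fun z => U (h.landing x z) - V (h.landing x z)) (Eventually.of_forall fun z => ?_)
      rw [← dist_eq_norm]
      exact BoundedContinuousFunction.dist_coe_le_dist _
  set U := hTc.fixedPoint T
  have hU : T U = U := hTc.fixedPoint_isFixedPt
  have hUx : ∀ x, U x * (1 + l) = f x + ∫ z, U (h.landing x z) ∂m := fun x => by
    have : (f x + ∫ z, U (h.landing x z) ∂m) / (1 + l) = U x := DFunLike.congr_fun hU x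
    rw [← this]; field_simp
  have hUK : ‖U‖ ≤ K := by
    have h1 : ‖U‖ ≤ (K + ‖U‖ * l) / (1 + l) := by
      refine (BoundedContinuousFunction.norm_le (by positivity)).2 fun x => ?_
      have hl1 : |U x| * (1 + l) = |f x + ∫ z, U (h.landing x z) ∂m| := by
        rw [← hUx, abs_mul, abs_of_pos (by positivity : 0 < 1 + l)]
      rw [le_div_iff₀ (by positivity), Real.norm_eq_abs, hl1]
      exact (abs_add_le _ _).trans (add_le_add (hK x x.2) (hbd U x))
    rw [le_div_iff₀ (by positivity)] at h1
    linarith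
  classical
  have hext : ∀ x : closedHalf n,
      (fun x : E n => if hx : x ∈ closedHalf n then U ⟨x, hx⟩ else 0) x = U x := fun x => by
    simp only [dif_pos x.2]
  refine ⟨fun x => if hx : x ∈ closedHalf n then U ⟨x, hx⟩ else 0, ?_, fun x => ?_,
    fun x hx => ?_⟩
  · refine continuousOn_iff_continuous_domRestrict.2 (U.continuous.congr fun x => (hext x).symm)
  · by_cases hx : x ∈ closedHalf n
    · simp only [dif_pos hx]
      exact (U.norm_coe_le_norm _).trans hUK
    · simpa only [dif_neg hx, abs_zero] using hK0
  · unfold largeJumps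
    have e1 : ∀ z, (fun x : E n => if hx : x ∈ closedHalf n then U ⟨x, hx⟩ else 0) (x + η x z)
        = U (h.landing ⟨x, hx⟩ z) := fun z => hext (h.landing ⟨x, hx⟩ z)
    simp only at e1
    simp_rw [e1, dif_pos hx]
    change _ = f x + ∫ z, (U (h.landing ⟨x, hx⟩ z) - U ⟨x, hx⟩) ∂m
    rw [integral_sub (hint U _) (integrable_const _), integral_const, smul_eq_mul]
    linarith [hUx ⟨x, hx⟩]

end JumpSetting

/-! ### Half-relaxed limits -/

/-- The upper half-relaxed limit on the closed half space. -/
noncomputable def upperLimit (u : ℕ → E n → ℝ) (x : E n) : ℝ :=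
  limsup (fun q : ℕ × E n => u q.1 q.2) (atTop ×ˢ 𝓝[closedHalf n] x)

section upperLimit

variable {u : ℕ → E n → ℝ} {K : ℝ} {x : E n}

lemma neBot_limit_filter (hx : x ∈ closedHalf n) :
    NeBot ((atTop : Filter ℕ) ×ˢ 𝓝[closedHalf n] x) := by
  have := mem_closure_iff_nhdsWithin_neBot.1 (subset_closure hx)
  infer_instance

lemma isBoundedUnder_le_of_bound (hK : ∀ k x, |u k x| ≤ K) (F : Filter (ℕ × E n)) :
    F.IsBoundedUnder (· ≤ ·) fun q => u q.1 q.2 :=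
  isBoundedUnder_of ⟨K, fun _ => (le_abs_self _).trans (hK _ _)⟩

lemma isBoundedUnder_ge_of_bound (hK : ∀ k x, |u k x| ≤ K) (F : Filter (ℕ × E n)) :
    F.IsBoundedUnder (· ≥ ·) fun q => u q.1 q.2 :=
  isBoundedUnder_of ⟨-K, fun _ => (abs_le.1 (hK _ _)).1⟩

lemma eventually_lt_of_upperLimit_lt (hK : ∀ k x, |u k x| ≤ K) {a : ℝ} (ha : upperLimit u x < a) :
    ∀ᶠ q in atTop ×ˢ 𝓝[closedHalf n] x, u q.1 q.2 < a :=
  eventually_lt_of_limsup_lt ha (isBoundedUnder_le_of_bound hK _)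

lemma upperLimit_le (hK : ∀ k x, |u k x| ≤ K) (hx : x ∈ closedHalf n) {a : ℝ}
    (ha : ∀ᶠ q in atTop ×ˢ 𝓝[closedHalf n] x, u q.1 q.2 ≤ a) : upperLimit u x ≤ a :=
  have := neBot_limit_filter hx
  limsup_le_of_le (isBoundedUnder_ge_of_bound hK _).isCoboundedUnder_le ha

lemma le_upperLimit (hK : ∀ k x, |u k x| ≤ K) (hx : x ∈ closedHalf n) {a : ℝ}
    (ha : ∀ᶠ q in atTop ×ˢ 𝓝[closedHalf n] x, a ≤ u q.1 q.2) : a ≤ upperLimit u x :=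
  have := neBot_limit_filter hx
  le_limsup_of_frequently_le ha.frequently (isBoundedUnder_le_of_bound hK _)

lemma abs_upperLimit_le (hK : ∀ k x, |u k x| ≤ K) (hx : x ∈ closedHalf n) :
    |upperLimit u x| ≤ K :=
  abs_le.2 ⟨le_upperLimit hK hx (Eventually.of_forall fun _ => (abs_le.1 (hK _ _)).1),
    upperLimit_le hK hx (Eventually.of_forall fun _ => (abs_le.1 (hK _ _)).2)⟩

/-- A bound valid for large k near `x` is also valid for large k near every point close to `x`. -/
lemma upperSemicontinuousOn_upperLimit (hK : ∀ k x, |u k x| ≤ K) :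
    UpperSemicontinuousOn (upperLimit u) (closedHalf n) := by
  intro x hx a ha
  obtain ⟨a', ha1, ha2⟩ := exists_between ha
  obtain ⟨pk, hpk, px, hpx, hp⟩ :=
    eventually_prod_iff.1 (eventually_lt_of_upperLimit_lt hK ha1)
  filter_upwards [eventually_eventually_nhdsWithin.2 hpx, self_mem_nhdsWithin] with y hy hyH
  refine (upperLimit_le hK hyH ?_).trans_lt ha2
  exact eventually_prod_iff.2 ⟨pk, hpk, px, hy, fun hk _ hx => (hp hk hx).le⟩

/-- Sequences realizing the upper half-relaxed limit from below. -/
lemma exists_seq_upperLimit (hK : ∀ k x, |u k x| ≤ K) (hx : x ∈ closedHalf n) :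
    ∃ (k : ℕ → ℕ) (y : ℕ → E n), Tendsto k atTop atTop ∧ Tendsto y atTop (𝓝[closedHalf n] x) ∧
      ∀ j : ℕ, upperLimit u x - 1 / (j + 1) < u (k j) (y j) := by
  have := neBot_limit_filter hx
  obtain ⟨V, hV⟩ := (𝓝[closedHalf n] x).exists_antitone_basis
  have hex : ∀ j : ℕ, ∃ q : ℕ × E n, (j ≤ q.1 ∧ q.2 ∈ V j) ∧
      upperLimit u x - 1 / (j + 1) < u q.1 q.2 := by
    intro j
    have hfr : ∃ᶠ q in atTop ×ˢ 𝓝[closedHalf n] x, upperLimit u x - 1 / (j + 1) < u q.1 q.2 :=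
      frequently_lt_of_lt_limsup (isBoundedUnder_ge_of_bound hK _).isCoboundedUnder_le
        (sub_lt_self _ (by positivity))
    have hev : ∀ᶠ q in (atTop : Filter ℕ) ×ˢ 𝓝[closedHalf n] x, j ≤ q.1 ∧ q.2 ∈ V j :=
      (eventually_ge_atTop j).prod_mk (hV.mem j)
    obtain ⟨q, hq, hq'⟩ := (hfr.and_eventually hev).exists
    exact ⟨q, hq', hq⟩
  choose q hq1 hq2 using hex
  exact ⟨fun j => (q j).1, fun j => (q j).2,
    tendsto_atTop_mono (fun j => (hq1 j).1) tendsto_id,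
    hV.tendsto fun j => (hq1 j).2, hq2⟩

/-- Convergence of maximum points. -/
lemma exists_max_seq (hK : ∀ k x, |u k x| ≤ K) (hu : ∀ k, ContinuousOn (u k) (closedHalf n))
    {φ : E n → ℝ} (hφ : Continuous φ) (hx : x ∈ closedHalf n) {r : ℝ} (hr : 0 < r)
    (hmax : ∀ y ∈ Metric.closedBall x r ∩ closedHalf n, y ≠ x →
      upperLimit u y - φ y < upperLimit u x - φ x) :
    ∃ (k : ℕ → ℕ) (y : ℕ → E n), Tendsto k atTop atTop ∧ Tendsto y atTop (𝓝[closedHalf n] x) ∧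
      (∀ j, y j ∈ closedHalf n) ∧ Tendsto (fun j => u (k j) (y j)) atTop (𝓝 (upperLimit u x)) ∧
      ∀ j, ∀ w ∈ Metric.closedBall x r ∩ closedHalf n,
        u (k j) w - φ w ≤ u (k j) (y j) - φ (y j) := by
  obtain ⟨k₀, y₀, hk₀, hy₀, hlow⟩ := exists_seq_upperLimit hK hx
  set S : Set (E n) := Metric.closedBall x r ∩ closedHalf n
  have hS : IsCompact S := (isCompact_closedBall _ _).inter_right isClosed_closedHalf
  have hy₀S : ∀ᶠ j in atTop, y₀ j ∈ S := by
    have := inter_mem_nhdsWithin (closedHalf n) (Metric.closedBall_mem_nhds x hr)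
    rw [inter_comm] at this
    exact hy₀ this
  have hex : ∀ j, ∃ w ∈ S, IsMaxOn (fun w => u (k₀ j) w - φ w) S w := fun j =>
    hS.exists_isMaxOn ⟨x, Metric.mem_closedBall_self hr.le, hx⟩
      (((hu _).mono inter_subset_right).sub hφ.continuousOn)
  choose w hwS hw using hex
  obtain ⟨X, hXS, ξ, hξ, hlim⟩ := hS.tendsto_subseq hwS
  have hξt := hξ.tendsto_atTop
  have hlimH : Tendsto (fun j => w (ξ j)) atTop (𝓝[closedHalf n] X) :=
    tendsto_nhdsWithin_iff.2 ⟨hlim, Eventually.of_forall fun j => (hwS _).2⟩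
  have hpair : Tendsto (fun j => (k₀ (ξ j), w (ξ j))) atTop (atTop ×ˢ 𝓝[closedHalf n] X) :=
    (hk₀.comp hξt).prodMk hlimH
  have hφw : Tendsto (fun j => φ (w (ξ j))) atTop (𝓝 (φ X)) := (hφ.tendsto X).comp hlim
  have hlower : Tendsto (fun j => upperLimit u x - 1 / ((ξ j : ℕ) + 1 : ℝ) - φ (y₀ (ξ j))) atTop
      (𝓝 (upperLimit u x - 0 - φ x)) :=
    ((tendsto_const_nhds.sub (tendsto_one_div_add_atTop_nhds_zero_nat.comp hξt)).sub
      ((hφ.tendsto x).comp ((hy₀.mono_right nhdsWithin_le_nhds).comp hξt)))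
  have hge : ∀ᶠ j in atTop, upperLimit u x - 1 / ((ξ j : ℕ) + 1 : ℝ) - φ (y₀ (ξ j))
      ≤ u (k₀ (ξ j)) (w (ξ j)) - φ (w (ξ j)) := by
    filter_upwards [hξt.eventually hy₀S] with j hj
    have h1 : u (k₀ (ξ j)) (y₀ (ξ j)) - φ (y₀ (ξ j)) ≤ u (k₀ (ξ j)) (w (ξ j)) - φ (w (ξ j)) :=
      hw (ξ j) hj
    linarith [hlow (ξ j)]
  -- The maximal values are asymptotically at least those along the sequence realizing the upper
  -- limit at `x`, so a limit of maximizers different from `x` would contradict strictness.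
  have hXx : X = x := by
    by_contra hne
    obtain ⟨a, ha1, ha2⟩ := exists_between (hmax X hXS hne)
    have hev := hpair.eventually (eventually_lt_of_upperLimit_lt hK (a := a + φ X) (by linarith))
    have h1 : upperLimit u x - 0 - φ x ≤ a + φ X - φ X := by
      refine le_of_tendsto_of_tendsto hlower (tendsto_const_nhds.sub hφw) ?_
      filter_upwards [hge, hev] with j h1 h2
      linarith
    linarith
  subst hXx
  refine ⟨fun j => k₀ (ξ j), fun j => w (ξ j), hk₀.comp hξt, hlimH, fun j => (hwS _).2, ?_,
    fun j v hv => hw (ξ j) hv⟩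
  refine tendsto_order.2 ⟨fun a ha => ?_, fun a ha => hpair.eventually
    (eventually_lt_of_upperLimit_lt hK ha)⟩
  have := (hlower.add hφw).eventually (lt_mem_nhds (a := a) (by linarith))
  filter_upwards [this, hge] with j h1 h2
  linarith

end upperLimit

/-! ### Divergence of the normal drift at the boundary -/

lemma norm_le_sum_abs (z : E n) : ‖z‖ ≤ ∑ i, |z i| := by
  refine le_of_sq_le_sq ?_ (Finset.sum_nonneg fun i _ => abs_nonneg _)
  rw [EuclideanSpace.norm_sq_eq]
  exact Finset.sum_sq_le_sq_sum_of_nonneg fun i _ => abs_nonneg _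

namespace JumpSetting

variable {c : ℕ} {ν σ : Measure (E n)} {η : E n → E n → E n} {cη : ℝ}

/-- If the integral were finite, the sign change would make |z_N| integrable near 0, the
permutations every |z_i|, and hence |z|, contrary to the infinite first moment. The jumps with δ ≤
|z| < 1 have finite mass and are harmless. -/
lemma lintegral_nor_neg_eq_top (h : JumpSetting c ν σ η cη) (hc : c = 1) {δ : ℝ} (hδ : 0 < δ) :
    ∫⁻ z in shell n (Ioo 0 δ), ENNReal.ofReal (-nor z) ∂ν = ⊤ := by
  by_contra hne
  set S := shell n (Ioo 0 δ)
  have hS : MeasurableSet S := measurableSet_shell measurableSet_Ioo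
  have hm : Measurable fun z : E n => ENNReal.ofReal (-nor z) :=
    (continuous_nor.measurable.neg).ennreal_ofReal
  have hpos : ∫⁻ z in S, ENNReal.ofReal (nor z) ∂ν = ∫⁻ z in S, ENNReal.ofReal (-nor z) ∂ν := by
    have := (h.symmetric.sign (Fin.last n)).setLIntegral_comp_preimage hS hm
    rw [← this]
    have hpre : signFlip (Fin.last n) ⁻¹' S = S := by
      ext z
      change ‖signFlip _ z‖ ∈ Ioo 0 δ ↔ ‖z‖ ∈ Ioo 0 δ
      rw [norm_signFlip]
    rw [hpre]; simp
  have habs : ∀ i, ∫⁻ z in S, ENNReal.ofReal |z i| ∂ν ≠ ⊤ := by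
    intro i
    have h1 : ∫⁻ z in S, ENNReal.ofReal |z (Fin.last n)| ∂ν ≠ ⊤ := by
      refine ne_top_of_le_ne_top (ENNReal.add_ne_top.2 ⟨hne, hne⟩) ?_
      nth_rewrite 1 [← hpos]
      rw [← lintegral_add_right _ hm]
      refine lintegral_mono fun z => ?_
      change ENNReal.ofReal |nor z| ≤ _
      rcases le_total 0 (nor z) with hz | hz
      · rw [abs_of_nonneg hz]; exact le_self_add
      · rw [abs_of_nonpos hz]; exact le_add_self
    have hm' : Measurable fun z : E n => ENNReal.ofReal |z (Fin.last n)| := by fun_prop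
    have := (h.symmetric.perm (Equiv.swap i (Fin.last n))).setLIntegral_comp_preimage hS hm'
    have hpre : permute (Equiv.swap i (Fin.last n)) ⁻¹' S = S := by
      ext z
      change ‖permute _ z‖ ∈ Ioo 0 δ ↔ ‖z‖ ∈ Ioo 0 δ
      rw [norm_permute]
    rw [hpre] at this
    rw [← this] at h1
    simpa [permute] using h1
  have hnorm : ∫⁻ z in S, ENNReal.ofReal ‖z‖ ∂ν ≠ ⊤ := by
    refine ne_top_of_le_ne_top (b := ∑ i, ∫⁻ z in S, ENNReal.ofReal |z i| ∂ν)
      (ENNReal.sum_ne_top.2 fun i _ => habs i) ?_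
    rw [← lintegral_finsetSum _ fun i _ => by fun_prop]
    refine lintegral_mono fun z => ?_
    rw [← ENNReal.ofReal_sum_of_nonneg fun i _ => abs_nonneg _]
    exact ENNReal.ofReal_le_ofReal (norm_le_sum_abs z)
  have hsub : {z : E n | ‖z‖ < 1} ⊆ {0} ∪ (S ∪ shell n (Ico δ 1)) := by
    intro z hz
    by_cases h0 : z = 0
    · exact Or.inl h0
    · by_cases h1 : ‖z‖ < δ
      · exact Or.inr (Or.inl ⟨norm_pos_iff.2 h0, h1⟩)
      · exact Or.inr (Or.inr ⟨not_lt.1 h1, hz⟩)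
  have hfar : ∫⁻ z in shell n (Ico δ 1), ENNReal.ofReal ‖z‖ ∂ν ≠ ⊤ := by
    refine ne_top_of_le_ne_top
      (h.measure_shell_lt_top (J := Ico δ 1) hδ fun r hr => hr.1).1.ne ?_
    rw [← setLIntegral_one]
    refine setLIntegral_mono measurable_const fun z hz => ?_
    rw [← ENNReal.ofReal_one]
    exact ENNReal.ofReal_le_ofReal hz.2.le
  have hzero : ∫⁻ z in {(0 : E n)}, ENNReal.ofReal ‖z‖ ∂ν = 0 := by
    rw [setLIntegral_congr_fun (g := fun _ => 0) (measurableSet_singleton 0)]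
    · simp
    · intro z hz; simp [mem_singleton_iff.1 hz]
  have := h.singular hc
  refine absurd this (ne_top_of_le_ne_top (b := 0 + (∫⁻ z in S, ENNReal.ofReal ‖z‖ ∂ν
    + ∫⁻ z in shell n (Ico δ 1), ENNReal.ofReal ‖z‖ ∂ν)) ?_ ?_)
  · rw [zero_add]
    exact ENNReal.add_ne_top.2 ⟨hnorm, hfar⟩
  · refine (lintegral_mono_set hsub).trans ((lintegral_union_le _ _ _).trans ?_)
    rw [hzero]
    gcongr
    exact lintegral_union_le _ _ _

/-- The drift in the normal direction blows up at the boundary. -/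
lemma eventually_lt_normal_drift (h : JumpSetting c ν σ η cη) (hc : c = 1) {δ : ℝ} (hδ : 0 < δ)
    {b : ℕ → ℝ} (hb : ∀ j, 0 < b j) (hb0 : Tendsto b atTop (𝓝 0)) {x : ℕ → E n}
    (hx : ∀ j, x j ∈ closedHalf n) (hx0 : Tendsto (fun j => nor (x j)) atTop (𝓝 0)) (C : ℝ) :
    ∀ᶠ j in atTop, C < ∫ z in shell n (Ico (b j) δ), (nor (η (x j) z) - nor z) ∂ν := by
  have hcη := h.eta.growth_pos
  -- The lower bound η_N − z_N ≥ −x_N − z_N does not involve `η`; its positive part converges to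
  -- that of −z_N, and Fatou's lemma gives divergence.
  set g : ℕ → E n → ENNReal := fun j => (shell n (Ico (b j) δ)).indicator
    fun z => ENNReal.ofReal (-nor (x j) - nor z) with hg
  have hgm : ∀ j, Measurable (g j) := fun j =>
    ((measurable_const.sub continuous_nor.measurable).ennreal_ofReal).indicator
      (measurableSet_shell measurableSet_Ico)
  have hpt : ∀ z ∈ shell n (Ioo 0 δ), ENNReal.ofReal (-nor z) ≤ liminf (fun j => g j z) atTop := by
    intro z hz
    have hlim : Tendsto (fun j => ENNReal.ofReal (-nor (x j) - nor z)) atTop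
        (𝓝 (ENNReal.ofReal (-nor z))) := by
      have := (hx0.neg.sub_const (nor z))
      rw [neg_zero, zero_sub] at this
      exact (ENNReal.continuous_ofReal.tendsto _).comp this
    have hev : (fun j => ENNReal.ofReal (-nor (x j) - nor z)) =ᶠ[atTop] fun j => g j z := by
      filter_upwards [hb0.eventually (gt_mem_nhds hz.1)] with j hj
      simp only [hg]
      rw [indicator_of_mem (show z ∈ shell n (Ico (b j) δ) from ⟨hj.le, hz.2⟩)]
    exact (hlim.congr' hev).liminf_eq.ge
  have htop : liminf (fun j => ∫⁻ z, g j z ∂ν) atTop = ⊤ := by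
    refine top_le_iff.1 (le_trans ?_ (lintegral_liminf_le hgm))
    rw [← h.lintegral_nor_neg_eq_top hc hδ]
    exact (setLIntegral_mono (.liminf hgm) hpt).trans (setLIntegral_le_lintegral _ _)
  have hev := eventually_lt_of_lt_liminf (f := atTop) (u := fun j => ∫⁻ z, g j z ∂ν)
    (b := ENNReal.ofReal C) (by rw [htop]; exact ENNReal.ofReal_lt_top)
  filter_upwards [hev] with j hj
  have hm : Measurable fun z => nor (η (x j) z) - nor z :=
    (h.measurable_eta_apply (hx j) (Fin.last n)).sub continuous_nor.measurable
  have hi := (h.integrableOn_shell (J := Ico (b j) δ) (hb j) measurableSet_Ico (fun r hr => hr.1) hm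
    (K := cη * δ + δ) fun z hz => (abs_sub _ _).trans (add_le_add
      ((h.abs_eta_apply_le (hx j) _ z).trans (mul_le_mul_of_nonneg_left hz.2.le hcη.le))
      ((abs_nor_le z).trans hz.2.le))).1
  have h0 : ∀ z, 0 ≤ nor (η (x j) z) - nor z := fun z => sub_nonneg.2 (h.nor_eta_ge (hx j) z)
  have hle : ∫⁻ z, g j z ∂ν
      ≤ ENNReal.ofReal (∫ z in shell n (Ico (b j) δ), (nor (η (x j) z) - nor z) ∂ν) := by
    rw [ofReal_integral_eq_lintegral_ofReal hi (Eventually.of_forall h0),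
      lintegral_indicator (measurableSet_shell measurableSet_Ico)]
    refine lintegral_mono fun z => ENNReal.ofReal_le_ofReal ?_
    linarith [h.nor_eta_ge_neg (hx j) z]
  exact (ENNReal.ofReal_lt_ofReal_iff'.1 (hj.trans_le hle)).1

/-! ### Stability -/

lemma measurable_domRestrict_of_continuousOn {w : E n → ℝ} (hw : ContinuousOn w (closedHalf n)) :
    Measurable ((closedHalf n).domRestrict w) :=
  (continuousOn_iff_continuous_domRestrict.1 hw).measurable

/-- A reverse Fatou argument on a finite measure: for a.e. jump the landing points converge, so the
positive part of the difference of increments tends to 0 and is dominated. -/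
lemma eventually_largeJumps_le (h : JumpSetting c ν σ η cη) {u : ℕ → E n → ℝ} {K : ℝ}
    (hK : ∀ k x, |u k x| ≤ K) (hu : ∀ k, ContinuousOn (u k) (closedHalf n)) {x : E n}
    (hx : x ∈ closedHalf n) {k : ℕ → ℕ} (hk : Tendsto k atTop atTop) {y : ℕ → E n}
    (hy : Tendsto y atTop (𝓝[closedHalf n] x)) (hyH : ∀ j, y j ∈ closedHalf n)
    (hlim : Tendsto (fun j => u (k j) (y j)) atTop (𝓝 (upperLimit u x))) {δ : ℝ} (hδ : 0 < δ)
    {ρ : ℝ} (hρ : 0 < ρ) :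
    ∀ᶠ j in atTop, largeJumps (ν + σ) η δ (u (k j)) (y j)
      ≤ largeJumps (ν + σ) η δ (upperLimit u) x + ρ := by
  have hfin := h.isFiniteMeasure_restrict hδ
  set m : Measure (E n) := (ν + σ).restrict (shell n (Ici δ))
  have hK0 : 0 ≤ K := (abs_nonneg _).trans (hK 0 x)
  set g : ℕ → E n → ℝ := fun j z => u (k j) (y j + η (y j) z) - u (k j) (y j)
  set G : E n → ℝ := fun z => upperLimit u (x + η x z) - upperLimit u x
  have hgm : ∀ j, Measurable (g j) := fun j =>
    (h.measurable_comp_jump (hyH j) (measurable_domRestrict_of_continuousOn (hu _))).sub_const _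
  have hGm : Measurable G := (h.measurable_comp_jump hx
    (upperSemicontinuousOn_iff_restrict.2 (upperSemicontinuousOn_upperLimit hK)).measurable
    ).sub_const _
  have hgb : ∀ j z, |g j z| ≤ K + K := fun j z =>
    (abs_sub _ _).trans (add_le_add (hK _ _) (hK _ _))
  have hGb : ∀ z, |G z| ≤ K + K := fun z => (abs_sub _ _).trans (add_le_add
    (abs_upperLimit_le hK (h.eta.stays_inside x hx z)) (abs_upperLimit_le hK hx))
  have hgi : ∀ j, Integrable (g j) m := fun j =>
    Integrable.of_bound (hgm j).aestronglyMeasurable _ (Eventually.of_forall (hgb j))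
  have hGi : Integrable G m :=
    Integrable.of_bound hGm.aestronglyMeasurable _ (Eventually.of_forall hGb)
  have hpos : Tendsto (fun j => ∫ z, max (g j z - G z) 0 ∂m) atTop (𝓝 (∫ _, 0 ∂m)) := by
    refine tendsto_integral_of_dominated_convergence (fun _ => K + K + (K + K))
      (fun j => (((hgm j).sub hGm).max measurable_const).aestronglyMeasurable)
      (integrable_const _) (fun j => Eventually.of_forall fun z => ?_) ?_
    · rw [Real.norm_eq_abs, abs_of_nonneg (le_max_right _ _)]
      refine max_le ((le_abs_self _).trans ((abs_sub _ _).trans (add_le_add (hgb j z) (hGb z)))) ?_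
      positivity
    · have hae : ∀ᵐ z ∂m, Tendsto (fun y => η y z) (𝓝[closedHalf n] x) (𝓝 (η x z)) :=
        ae_restrict_of_ae (h.eta.weak_continuity x hx)
      filter_upwards [hae] with z hz
      have hP : Tendsto (fun j => (k j, y j + η (y j) z)) atTop
          (atTop ×ˢ 𝓝[closedHalf n] (x + η x z)) := by
        refine hk.prodMk (tendsto_nhdsWithin_iff.2 ⟨?_, Eventually.of_forall fun j =>
          h.eta.stays_inside _ (hyH j) z⟩)
        exact (hy.mono_right nhdsWithin_le_nhds).add (hz.comp hy)
      refine tendsto_order.2 ⟨fun a ha => Eventually.of_forall fun j =>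
        ha.trans_le (le_max_right _ _), fun a ha => ?_⟩
      filter_upwards [hP.eventually (eventually_lt_of_upperLimit_lt hK
        (lt_add_of_pos_right (upperLimit u (x + η x z)) (half_pos ha))),
        hlim.eventually (lt_mem_nhds (sub_lt_self (upperLimit u x) (half_pos ha)))] with j h1 h2
      refine max_lt ?_ ha
      change u (k j) (y j + η (y j) z) - u (k j) (y j)
        - (upperLimit u (x + η x z) - upperLimit u x) < a
      linarith
  rw [integral_zero] at hpos
  filter_upwards [hpos.eventually (gt_mem_nhds hρ)] with j hj
  change ∫ z, g j z ∂m ≤ ∫ z, G z ∂m + ρ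
  have hs : Integrable (fun z => max (g j z - G z) 0) m :=
    ((hgi j).sub hGi).sup (integrable_zero _ _ _)
  have h1 : ∫ z, g j z ∂m ≤ ∫ z, (G z + max (g j z - G z) 0) ∂m :=
    integral_mono (hgi j) (hGi.add hs) fun z => by
      have := le_max_left (g j z - G z) 0
      simp only
      linarith
  rw [integral_add hGi hs] at h1
  linarith

/-- Splitting the truncated operator at an intermediate size. -/
lemma largeJumps_eq_add (h : JumpSetting c ν σ η cη) {x : E n} (hx : x ∈ closedHalf n) {b δ : ℝ}
    (hb : 0 < b) (hbδ : b ≤ δ) {w : E n → ℝ} (hw : Measurable ((closedHalf n).domRestrict w))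
    {K : ℝ} (hK : ∀ y ∈ closedHalf n, |w y| ≤ K) :
    largeJumps (ν + σ) η b w x
      = ∫ z in shell n (Ico b δ), (w (x + η x z) - w x) ∂(ν + σ) + largeJumps (ν + σ) η δ w x := by
  obtain ⟨i1, i2⟩ := h.largeJumps_eq hx hb hw hK
  exact setIntegral_shell_split hbδ (i1.add_measure i2)

end JumpSetting

namespace JumpSetting

variable {c : ℕ} {ν σ : Measure (E n)} {η : E n → E n → E n} {cη : ℝ}

lemma contDiff_add_norm_sq {φ : E n → ℝ} (hφ : ContDiff ℝ 2 φ) (x : E n) :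
    ContDiff ℝ 2 fun y => φ y + ‖y - x‖ ^ 2 :=
  hφ.add ((contDiff_id.sub contDiff_const).norm_sq ℝ)

lemma normalDeriv_add_norm_sq {φ : E n → ℝ} (hφ : ContDiff ℝ 2 φ) (x : E n) :
    normalDeriv (fun y => φ y + ‖y - x‖ ^ 2) x = normalDeriv φ x := by
  have h1 : HasFDerivAt (fun y : E n => ‖y - x‖ ^ 2)
      (2 • (innerSL ℝ (x - x)).comp (ContinuousLinearMap.id ℝ (E n))) x :=
    ((hasFDerivAt_id x).sub_const _).norm_sq
  have h2 := (hφ.differentiable (by norm_num) x).hasFDerivAt.add h1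
  unfold normalDeriv
  rw [show (fun y => φ y + ‖y - x‖ ^ 2) = φ + fun y : E n => ‖y - x‖ ^ 2 from rfl, h2.fderiv]
  simp

/-- Maximum points of the truncated solutions approaching a maximum point of the upper
half-relaxed limit. -/
lemma exists_test_seq {u : ℕ → E n → ℝ} {K : ℝ} (hK : ∀ k x, |u k x| ≤ K)
    (hu : ∀ k, ContinuousOn (u k) (closedHalf n)) {φ : E n → ℝ} (hφ : ContDiff ℝ 2 φ) {x : E n}
    (hx : x ∈ closedHalf n) {R : ℝ} (hR : 0 < R)
    (hmax : IsMaxOn (fun y => upperLimit u y - φ y) (Metric.ball x R ∩ closedHalf n) x) :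
    ∃ (k : ℕ → ℕ) (y : ℕ → E n), Tendsto k atTop atTop ∧ Tendsto y atTop (𝓝[closedHalf n] x) ∧
      (∀ j, y j ∈ closedHalf n) ∧ Tendsto (fun j => u (k j) (y j)) atTop (𝓝 (upperLimit u x)) ∧
      ∀ j, ∀ w ∈ Metric.closedBall x (R / 2) ∩ closedHalf n,
        u (k j) w - u (k j) (y j) ≤ (φ w + ‖w - x‖ ^ 2) - (φ (y j) + ‖y j - x‖ ^ 2) := by
  obtain ⟨k, y, hk, hy, hyH, hlim, hm⟩ := exists_max_seq hK hu
    (φ := fun y => φ y + ‖y - x‖ ^ 2) (contDiff_add_norm_sq hφ x).continuous hx (half_pos hR)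
    (fun y hy hne => by
      have h1 : upperLimit u y - φ y ≤ upperLimit u x - φ x :=
        hmax ⟨Metric.closedBall_subset_ball (half_lt_self hR) hy.1, hy.2⟩
      have h2 : 0 < ‖y - x‖ := norm_pos_iff.2 (sub_ne_zero.2 hne)
      have h3 : 0 < ‖y - x‖ ^ 2 := by positivity
      simp only [sub_self, norm_zero]
      linarith)
  refine ⟨k, y, hk, hy, hyH, hlim, fun j w hw => ?_⟩
  have := hm j w hw
  linarith

/-- The contribution of the small jumps to the truncated equation at maximum points. -/
lemma exists_small_increment_le (h : JumpSetting c ν σ η cη) {φ : E n → ℝ}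
    (hφ : ContDiff ℝ 2 φ) (x : E n) {R : ℝ} (hR : 0 < R) :
    ∃ r > 0, ∃ ω : ℝ → ℝ, Tendsto ω (𝓝[>] 0) (𝓝 0) ∧
      ∀ δ ∈ Ioo 0 r, ∀ y ∈ Metric.ball x r ∩ closedHalf n, ∀ b > 0, ∀ w : E n → ℝ,
        ContinuousOn w (closedHalf n) → (∃ K, ∀ a, |w a| ≤ K) →
        (∀ a ∈ Metric.closedBall x R ∩ closedHalf n, w a - w y ≤ φ a - φ y) →
        ∫ z in shell n (Ico b δ), (w (y + η y z) - w y) ∂(ν + σ)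
          ≤ ∫ z in shell n (Ico b δ), inner ℝ (gradient φ y) (η y z) ∂ν + ω δ := by
  have hcη := h.eta.growth_pos
  obtain ⟨r, hr, A, hA0, B, hB0, hT⟩ := exists_taylor_bound hφ x
  -- Division by 1 + cη makes both r' and cη r' at most min r (R/2): base points and jumps stay
  -- within Taylor range, and landing points remain within distance R of `x`.
  set r' := min 1 (min r (R / 2) / (1 + cη))
  have hr' : 0 < r' := by positivity
  have hr'c : (1 + cη) * r' ≤ min r (R / 2) := by
    calc (1 + cη) * r' ≤ (1 + cη) * (min r (R / 2) / (1 + cη)) :=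
          mul_le_mul_of_nonneg_left (min_le_right _ _) (by positivity)
      _ = _ := by field_simp
  have hrr : r' ≤ min r (R / 2) := le_trans (by nlinarith) hr'c
  have hcr : cη * r' ≤ min r (R / 2) := le_trans (by nlinarith) hr'c
  refine ⟨r', hr', fun δ => A * cη ^ 2 * secondMoment ν δ + B * cη * firstMoment σ δ, ?_, ?_⟩
  · simpa using (h.tendsto_secondMoment.const_mul (A * cη ^ 2)).add
      (h.tendsto_firstMoment.const_mul (B * cη))
  · rintro δ hδ y ⟨hyx, hy⟩ b hb w hw ⟨K, hK⟩ hmax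
    have hη : ∀ z ∈ shell n (Ico b δ), ‖η y z‖ < min r (R / 2) := fun z hz =>
      (h.eta.growth y hy z).trans_lt ((mul_lt_mul_of_pos_left (hz.2.trans hδ.2) hcη).trans_le hcr)
    have hyr : y ∈ Metric.ball x r :=
      Metric.ball_subset_ball (hrr.trans (min_le_left _ _)) hyx
    have hball : ∀ z ∈ shell n (Ico b δ),
        y + η y z ∈ Metric.closedBall x R ∩ closedHalf n := fun z hz => by
      refine ⟨?_, h.eta.stays_inside y hy z⟩
      rw [Metric.mem_closedBall, dist_eq_norm, add_sub_right_comm]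
      have h1 := (hη z hz).le.trans (min_le_right _ _)
      have h2 : ‖y - x‖ < R / 2 := by
        rw [← dist_eq_norm]; exact lt_of_lt_of_le hyx (hrr.trans (min_le_right _ _))
      linarith [norm_add_le (y - x) (η y z)]
    rw [← add_assoc]
    refine h.setIntegral_increment_le hy hb (hδ.2.le.trans (min_le_left _ _)) measurableSet_Ico
      subset_rfl (measurable_domRestrict_of_continuousOn hw) (K := K + K)
      (fun z _ => (abs_sub _ _).trans (add_le_add (hK _) (hK _))) hA0 hB0 (fun z hz => ?_)
      fun z hz => ?_
    · have h1 := hmax _ (hball z hz)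
      have h2 := (le_abs_self _).trans
        (hT y hyr (η y z) ((hη z hz).trans_le (min_le_left _ _))).1
      linarith
    · have h1 := hmax _ (hball z hz)
      have h2 := (le_abs_self _).trans
        (hT y hyr (η y z) ((hη z hz).trans_le (min_le_left _ _))).2
      linarith

/-- The upper half-relaxed limit of solutions of truncated problems is a subsolution. -/
theorem isSubsolution_upperLimit (h : JumpSetting c ν σ η cη) {f : E n → ℝ}
    (hf : ContinuousOn f (closedHalf n)) {u : ℕ → E n → ℝ} {K : ℝ} (hK : ∀ k x, |u k x| ≤ K)
    (hu : ∀ k, ContinuousOn (u k) (closedHalf n)) {b : ℕ → ℝ} (hb : ∀ k, 0 < b k)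
    (hb0 : Tendsto b atTop (𝓝 0))
    (heq : ∀ k, ∀ x ∈ closedHalf n, u k x = f x + largeJumps (ν + σ) η (b k) (u k) x) :
    IsSubsolution c (ν + σ) η cη f (upperLimit u) := by
  have hcη := h.eta.growth_pos
  have husc := upperSemicontinuousOn_upperLimit hK
  have hUm : Measurable ((closedHalf n).domRestrict (upperLimit u)) :=
    (upperSemicontinuousOn_iff_restrict.2 husc).measurable
  have hUb : ∀ x ∈ closedHalf n, |upperLimit u x| ≤ K := fun x hx => abs_upperLimit_le hK hx
  refine ⟨⟨K, hUb⟩, husc, ?_, ?_⟩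
  · intro δ φ x hδ hφ hx hmax hc
    obtain ⟨L, hL, hL0⟩ := h.exists_smallJumps hφ hx hc
    refine ⟨L δ, hL δ hδ, ?_⟩
    have hR : 0 < cη * δ := by positivity
    obtain ⟨k, y, hk, hy, hyH, hlim, hm⟩ := exists_test_seq hK hu hφ hx hR hmax
    obtain ⟨r, hr, ω, hω, hinc⟩ :=
      h.exists_small_increment_le (contDiff_add_norm_sq hφ x) x (half_pos hR)
    have hy' := hy.mono_right nhdsWithin_le_nhds
    have hfy : Tendsto (fun j => f (y j)) atTop (𝓝 (f x)) := (hf x hx).tendsto.comp hy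
    have key : ∀ ρ > 0, ∀ᶠ δ' in 𝓝[>] (0 : ℝ),
        upperLimit u x ≤ f x + ρ + largeJumps (ν + σ) η δ' (upperLimit u) x := by
      intro ρ hρ
      -- The first-order term under `ν` must vanish at the approximating points: either δ' < x_N, so
      -- that jumps shorter than δ' are eventually unreflected, or `ν = 0`.
      have hev : ∀ᶠ δ' in 𝓝[>] (0 : ℝ), δ' < nor x ∨ ν = 0 := by
        rcases hc with hc | hc
        · filter_upwards [Ioo_mem_nhdsGT hc] with δ' hδ' using Or.inl hδ'.2
        · exact Eventually.of_forall fun _ => Or.inr (h.null hc)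
      filter_upwards [hev, Ioo_mem_nhdsGT hr, hω.eventually (gt_mem_nhds (half_pos hρ))]
        with δ' hδx hδr hωδ
      have hjump := h.eventually_largeJumps_le hK hu hx hk hy hyH hlim hδr.1 (half_pos hρ)
      have hnor : ∀ᶠ j in atTop, δ' ≤ nor (y j) ∨ ν = 0 := by
        rcases hδx with hδx | hδx
        · filter_upwards [((continuous_nor.tendsto x).comp hy').eventually (lt_mem_nhds hδx)]
            with j hj using Or.inl hj.le
        · exact Eventually.of_forall fun _ => Or.inr hδx
      refine le_of_tendsto_of_tendsto hlim ((hfy.add_const ρ).add_const _) ?_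
      filter_upwards [hjump, hnor, hy'.eventually (Metric.ball_mem_nhds x hr),
        (hb0.comp hk).eventually (gt_mem_nhds hδr.1)] with j h1 h2 h3 h4
      have e1 := heq (k j) (y j) (hyH j)
      rw [h.largeJumps_eq_add (hyH j) (hb _) h4.le
        (measurable_domRestrict_of_continuousOn (hu _)) fun a _ => hK _ a] at e1
      have e2 := hinc δ' hδr (y j) ⟨h3, hyH j⟩ (b (k j)) (hb _) (u (k j)) (hu _) ⟨K, hK _⟩ (hm j)
      rw [h.setIntegral_inner_eta_eq_zero (hyH j) (hb _) measurableSet_Ico subset_rfl h2] at e2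
      linarith
    -- Passage from δ' to the given δ: for δ' ≤ |z| < δ landing points stay in the ball where the
    -- maximum is attained, so increments of the limit are below those of `φ`, and these complete
    -- L(δ') to L(δ) with L(δ') → 0.
    have hle : ∀ ρ > 0,
        upperLimit u x ≤ f x + L δ + largeJumps (ν + σ) η δ (upperLimit u) x + 2 * ρ := by
      intro ρ hρ
      obtain ⟨δ', ⟨h1, hδ'⟩, hLδ⟩ := (((key ρ hρ).and (Ioo_mem_nhdsGT hδ)).and
        (hL0.eventually (lt_mem_nhds (neg_lt_zero.2 hρ)))).exists
      rw [h.largeJumps_eq_add hx hδ'.1 hδ'.2.le hUm hUb] at h1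
      have e1 := h.smallJumps_eq_add hφ.continuous hx hδ'.1 hδ'.2.le (hL δ hδ) (hL δ' hδ'.1)
      obtain ⟨K', _, hK'⟩ := h.bounded_increment hφ.continuous hx δ
      obtain ⟨i1, i2⟩ := h.integrableOn_shell (J := Ico δ' δ) hδ'.1 measurableSet_Ico
        (fun r hr => hr.1) ((h.measurable_comp_jump hx
          (measurable_domRestrict_of_continuousOn hφ.continuous.continuousOn)).sub_const (φ x))
        (K := K') fun z hz => hK' z hz.2.le
      obtain ⟨i3, i4⟩ := h.largeJumps_eq hx hδ'.1 hUm hUb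
      have e2 : ∫ z in shell n (Ico δ' δ), (upperLimit u (x + η x z) - upperLimit u x) ∂(ν + σ)
          ≤ ∫ z in shell n (Ico δ' δ), (φ (x + η x z) - φ x) ∂(ν + σ) := by
        refine setIntegral_mono_on ((i3.add_measure i4).mono_set fun z hz => hz.1)
          (i1.add_measure i2) (measurableSet_shell measurableSet_Ico) fun z hz => ?_
        have hmem : x + η x z ∈ Metric.ball x (cη * δ) ∩ closedHalf n := by
          refine ⟨?_, h.eta.stays_inside x hx z⟩
          rw [Metric.mem_ball, dist_eq_norm, add_sub_cancel_left]
          exact (h.eta.growth x hx z).trans_lt (mul_lt_mul_of_pos_left hz.2 hcη)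
        have := hmax hmem
        simp only [mem_ofPred_eq] at this
        linarith
      linarith
    unfold F
    have := le_of_forall_pos_le_add fun ρ hρ => by
      have := hle (ρ / 2) (half_pos hρ)
      rwa [mul_div_cancel₀ _ two_ne_zero] at this
    linarith
  · intro δ φ x hδ hφ hx0 hc hmax
    by_contra! hneg
    have hx : x ∈ closedHalf n := hx0.ge
    have hR : 0 < cη * δ := by positivity
    obtain ⟨k, y, hk, hy, hyH, hlim, hm⟩ := exists_test_seq hK hu hφ hx hR hmax
    have hψ := contDiff_add_norm_sq hφ x
    obtain ⟨r, hr, ω, hω, hinc⟩ := h.exists_small_increment_le hψ x (half_pos hR)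
    have hy' := hy.mono_right nhdsWithin_le_nhds
    have hfy : Tendsto (fun j => f (y j)) atTop (𝓝 (f x)) := (hf x hx).tendsto.comp hy
    set ψ : E n → ℝ := fun y => φ y + ‖y - x‖ ^ 2
    obtain ⟨δ', hδ', hδr⟩ : ∃ δ', 0 < δ' ∧ δ' < r := exists_between hr
    have hcont : Continuous (normalDeriv ψ) :=
      (hψ.continuous_fderiv (by norm_num)).clm_apply continuous_const
    set γ := -normalDeriv φ x with hγ
    have hp : ∀ᶠ j in atTop, normalDeriv ψ (y j) < -(γ / 2) := by
      refine ((hcont.tendsto x).comp hy').eventually (gt_mem_nhds ?_)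
      rw [normalDeriv_add_norm_sq hφ x]
      linarith
    -- The threshold is chosen so that γ/2 times the drift exceeds the sum of all other terms and K;
    -- the truncated equation would then force values below −K.
    have hdrift := h.eventually_lt_normal_drift hc hδ' (b := fun j => b (k j)) (fun j => hb _)
      (hb0.comp hk) hyH (by
        have := (continuous_nor.tendsto x).comp hy'
        rwa [hx0] at this)
      ((f x + 1 + ω δ' + (largeJumps (ν + σ) η δ' (upperLimit u) x + 1) + K) / (γ / 2))
    obtain ⟨j, ⟨h1, h2⟩, h3, h4, h5, h6⟩ := ((hp.and hdrift).and
      ((h.eventually_largeJumps_le hK hu hx hk hy hyH hlim hδ' one_pos).and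
        ((hy'.eventually (Metric.ball_mem_nhds x hr)).and
          (((hb0.comp hk).eventually (gt_mem_nhds hδ')).and
            (hfy.eventually (gt_mem_nhds (lt_add_one (f x)))))))).exists
    have e1 := heq (k j) (y j) (hyH j)
    rw [h.largeJumps_eq_add (hyH j) (hb _) (le_of_lt h5)
      (measurable_domRestrict_of_continuousOn (hu _)) fun a _ => hK _ a] at e1
    have e2 := hinc δ' ⟨hδ', hδr⟩ (y j) ⟨h4, hyH j⟩ (b (k j)) (hb _) (u (k j)) (hu _)
      ⟨K, hK _⟩ (hm j)
    rw [h.setIntegral_inner_eta (hyH j) (hb _) measurableSet_Ico subset_rfl, nor_gradient] at e2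
    rw [div_lt_iff₀ (half_pos hneg)] at h2
    have h7 : 0 ≤ ∫ z in shell n (Ico (b (k j)) δ'), (nor (η (y j) z) - nor z) ∂ν :=
      integral_nonneg fun z => sub_nonneg.2 (h.nor_eta_ge (hyH j) z)
    have h8 := mul_le_mul_of_nonneg_right h1.le h7
    have h9 := (abs_le.1 (hK (k j) (y j))).1
    linarith

end JumpSetting

/-! ### Examples of jump functions -/

lemma Continuous.ofParts {X : Type*} [TopologicalSpace X] {p : X → EuclideanSpace ℝ (Fin n)}
    {s : X → ℝ} (hp : Continuous p) (hs : Continuous s) :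
    Continuous fun a => ofParts (p a) (s a) := by
  unfold NonlocalNeumann.ofParts
  refine (PiLp.continuous_toLp 2 _).comp (continuous_pi fun i => ?_)
  refine Fin.lastCases ?_ (fun j => ?_) i <;> simp <;> fun_prop

lemma nor_signFlip_castSucc (i : Fin n) (z : E n) : nor (signFlip i.castSucc z) = nor z := by
  simp [nor, signFlip, (Fin.castSucc_lt_last i).ne']

/-- Jump functions which only modify the normal component. -/
lemma hypEta_ofParts (μ : Measure (E n)) {g : ℝ → ℝ → ℝ}
    (hg : Continuous fun q : ℝ × ℝ => g q.1 q.2)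
    (h0 : ∀ s t, 0 ≤ s → 0 ≤ s + g s t) (h1 : ∀ s t, 0 ≤ s → 0 < s + t → g s t = t)
    (h2 : ∀ s t, 0 ≤ s → |g s t| ≤ |t|)
    (h3 : ∀ s s' t, |(s + g s t) - (s' + g s' t)| ≤ |s - s'|) :
    HypEta μ (fun x z : E n => ofParts (tang z) (g (nor x) (nor z))) 1 where
  measurable x _ := (Continuous.ofParts continuous_tang
    (hg.comp (continuous_const.prodMk continuous_nor))).measurable
  stays_inside x hx z := by simpa using h0 (nor x) (nor z) hx
  eq_self x hx z hz := by simp only [h1 _ _ hx hz, ofParts_tang_nor]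
  growth_pos := one_pos
  growth x hx z := by
    rw [one_mul]
    refine le_of_sq_le_sq ?_ (norm_nonneg _)
    rw [norm_sq_eq_tang_add_nor, norm_sq_eq_tang_add_nor z, tang_ofParts, nor_ofParts]
    have := sq_le_sq.2 (h2 (nor x) (nor z) hx)
    linarith
  antisymm x _ z i := by
    have key : ∀ (w : E n) (s : ℝ), ofParts (tang w) s i.castSucc = w i.castSucc := fun w s => by
      rw [← tang_apply, tang_ofParts, tang_apply]
    rw [key, key, signFlip_apply_self]
  weak_continuity x _ := Eventually.of_forall fun z => by
    have : Continuous fun y : E n => ofParts (tang z) (g (nor y) (nor z)) :=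
      Continuous.ofParts continuous_const (hg.comp (continuous_nor.prodMk continuous_const))
    exact (this.tendsto x).mono_left nhdsWithin_le_nhds
  tangential_lipschitz := ⟨0, fun p q s z _ => by simp⟩
  normal_contraction x _ y _ z := by simpa using h3 (nor x) (nor y) (nor z)

lemma hypEta_normalProjection (μ : Measure (E n)) : HypEta μ normalProjection 1 := by
  have : (normalProjection : E n → E n → E n)
      = fun x z => ofParts (tang z) (max (nor z) (-nor x)) := by
    funext x z
    unfold normalProjection
    split_ifs with h
    · rw [max_eq_left (by linarith), ofParts_tang_nor]
    · rw [max_eq_right (by linarith)]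
  rw [this]
  refine hypEta_ofParts μ (g := fun s t => max t (-s)) (by fun_prop) (fun s t hs => ?_)
    (fun s t hs hst => max_eq_left (by linarith)) (fun s t hs => ?_) (fun s s' t => ?_)
  · linarith [le_max_right t (-s)]
  · rcases le_total (-s) t with h | h
    · rw [max_eq_left h]
    · rw [max_eq_right h, abs_neg, abs_of_nonneg hs, abs_of_nonpos (by linarith)]
      linarith
  · rw [← max_add_add_left, ← max_add_add_left, add_neg_cancel, add_neg_cancel]
    refine (abs_max_sub_max_le_abs _ _ _).trans ?_
    rw [add_sub_add_right_eq_sub]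

lemma hypEta_mirror (μ : Measure (E n)) : HypEta μ mirror 1 := by
  have : (mirror : E n → E n → E n)
      = fun x z => ofParts (tang z) (|nor x + nor z| - nor x) := by
    funext x z
    unfold mirror
    split_ifs with h
    · rw [abs_of_nonneg h, add_sub_cancel_left, ofParts_tang_nor]
    · rw [abs_of_neg (not_le.1 h)]
      congr 1; ring
  rw [this]
  refine hypEta_ofParts μ (g := fun s t => |s + t| - s) (by fun_prop) (fun s t hs => ?_)
    (fun s t hs hst => ?_) (fun s t hs => ?_) (fun s s' t => ?_)
  · rw [add_sub_cancel]; exact abs_nonneg _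
  · rw [abs_of_pos hst, add_sub_cancel_left]
  · have := abs_abs_sub_abs_le (s + t) s
    rwa [abs_of_nonneg hs, add_sub_cancel_left] at this
  · rw [add_sub_cancel, add_sub_cancel]
    refine (abs_abs_sub_abs_le _ _).trans ?_
    rw [add_sub_add_right_eq_sub]

/-- The factor by which a jump is shortened when it is stopped at the boundary. -/
noncomputable def stopFactor (s t : ℝ) : ℝ := if t < 0 then min 1 (s / |t|) else 1

/-- This form, valid on the closed half space, makes the continuity in the starting height visible.
-/
lemma fleas_eq {x : E n} (hx : x ∈ closedHalf n) (z : E n) :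
    fleas x z = stopFactor (nor x) (nor z) • z := by
  have hx' : 0 ≤ nor x := hx
  unfold fleas stopFactor
  split_ifs with h1 h2 h2
  · rw [abs_of_neg h2, min_eq_left ((one_le_div (by linarith)).2 (by linarith)), one_smul]
  · rw [one_smul]
  · rw [min_eq_right]
    rw [abs_of_neg h2]
    exact (div_le_one (by linarith)).2 (by linarith)
  · exact absurd (by linarith) h1

lemma stopFactor_mem {s : ℝ} (hs : 0 ≤ s) (t : ℝ) : stopFactor s t ∈ Icc (0 : ℝ) 1 := by
  unfold stopFactor
  split_ifs
  · exact ⟨by positivity, min_le_left _ _⟩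
  · simp

lemma continuous_stopFactor (t : ℝ) : Continuous fun s => stopFactor s t := by
  unfold stopFactor
  split_ifs <;> fun_prop

/-- The landing height coincides with that of the normal projection, so its contraction property is
that of the positive part. -/
lemma add_stopFactor_mul (s : ℝ) (t : ℝ) (hs : 0 ≤ s) : s + stopFactor s t * t = max (s + t) 0 := by
  unfold stopFactor
  split_ifs with h
  · rw [abs_of_neg h]
    rcases le_total (-t) s with hst | hst
    · rw [min_eq_left ((one_le_div (by linarith)).2 hst), one_mul, max_eq_left (by linarith)]
    · have : s / -t * t = -s := by
        rw [div_neg, neg_mul, div_mul_cancel₀ _ h.ne]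
      rw [min_eq_right ((div_le_one (by linarith)).2 hst), this, max_eq_right (by linarith),
        add_neg_cancel]
  · rw [one_mul, max_eq_left (by linarith)]

lemma hypEta_fleas (μ : Measure (E n)) : HypEta μ fleas 1 where
  measurable x _ := by
    unfold fleas
    have := continuous_nor (n := n)
    refine Measurable.ite (measurableSet_le measurable_const (by fun_prop)) measurable_id ?_
    exact (measurable_const.div (continuous_nor.measurable.abs)).smul measurable_id
  stays_inside x hx z := by
    rw [fleas_eq hx, mem_closedHalf, nor_add, nor_smul, add_stopFactor_mul _ _ hx]
    exact le_max_right _ _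
  eq_self x _ z hz := by unfold fleas; rw [if_pos hz.le]
  growth_pos := one_pos
  growth x hx z := by
    obtain ⟨h0, h1⟩ := stopFactor_mem (mem_closedHalf.1 hx) (nor z)
    rw [fleas_eq hx, norm_smul, Real.norm_eq_abs, abs_of_nonneg h0]
    exact mul_le_mul_of_nonneg_right h1 (norm_nonneg _)
  antisymm x hx z i := by
    rw [fleas_eq hx, fleas_eq hx, nor_signFlip_castSucc]
    simp
  weak_continuity x hx := Eventually.of_forall fun z => by
    have h1 : Tendsto (fun y : E n => stopFactor (nor y) (nor z) • z) (𝓝[closedHalf n] x)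
        (𝓝 (stopFactor (nor x) (nor z) • z)) :=
      ((((continuous_stopFactor (nor z)).comp continuous_nor).smul
        continuous_const).tendsto x).mono_left nhdsWithin_le_nhds
    rw [fleas_eq hx]
    refine h1.congr' ?_
    filter_upwards [self_mem_nhdsWithin] with y hy using (fleas_eq hy z).symm
  tangential_lipschitz := ⟨0, fun p q s z _ => by simp [fleas]⟩
  normal_contraction x hx y hy z := by
    rw [fleas_eq hx, fleas_eq hy, nor_add, nor_smul, nor_add, nor_smul,
      add_stopFactor_mul _ _ hx, add_stopFactor_mul _ _ hy]
    refine (abs_max_sub_max_le_abs _ _ _).trans ?_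
    rw [add_sub_add_right_eq_sub]

/-! ### Well-posedness -/

section

variable {c : ℕ} {μ : Measure (E n)} {η : E n → E n → E n} {cη : ℝ} {f u v : E n → ℝ}

/-- The upper and lower half-relaxed limits are compared only on the closed half space; jumps never
leave it, so values elsewhere do not matter. -/
lemma IsSupersolution.congr (hη : HypEta μ η cη) (h : IsSupersolution c μ η cη f u)
    (huv : EqOn u v (closedHalf n)) : IsSupersolution c μ η cη f v := by
  have hmin : ∀ {R : ℝ} {φ : E n → ℝ} {x : E n}, x ∈ closedHalf n →
      IsMinOn (fun y => v y - φ y) (Metric.ball x R ∩ closedHalf n) x →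
      IsMinOn (fun y => u y - φ y) (Metric.ball x R ∩ closedHalf n) x := by
    intro R φ x hx hm y hy
    have := hm hy
    simp only [mem_ofPred_eq] at this ⊢
    rwa [huv hx, huv hy.2]
  refine ⟨h.bounded.imp fun K hK x hx => huv hx ▸ hK x hx, ?_,
    fun δ φ x hδ hφ hx hm hc => ?_, fun δ φ x hδ hφ hx hc hm =>
      h.boundary δ φ x hδ hφ hx hc (hmin (mem_closedHalf.2 hx.ge) hm)⟩
  · intro x hx a ha
    filter_upwards [h.lsc x hx a (by change a < u x; rw [huv hx]; exact ha),
      self_mem_nhdsWithin] with y hy hyH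
    rwa [← huv hyH]
  obtain ⟨L, hL, hle⟩ := h.equation δ φ x hδ hφ hx (hmin hx hm) hc
  refine ⟨L, hL, ?_⟩
  have : largeJumps μ η δ v x = largeJumps μ η δ u x := by
    unfold largeJumps
    congr 1; ext z
    rw [huv hx, huv (hη.stays_inside x hx z)]
  rwa [this, ← huv hx]

lemma IsSubsolution.sub_const (h : IsSubsolution c μ η cη f u) (d : ℝ) :
    IsSubsolution c μ η cη (fun x => f x - d) (fun x => u x - d) := by
  have hmax : ∀ {S : Set (E n)} {φ : E n → ℝ} {x : E n},
      IsMaxOn (fun y => u y - d - φ y) S x → IsMaxOn (fun y => u y - φ y) S x := by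
    intro S φ x hm y hy
    have := hm hy
    simp only [mem_ofPred_eq] at this ⊢
    linarith
  obtain ⟨K, hK⟩ := h.bounded
  refine ⟨⟨K + |d|, fun x hx => (abs_sub _ _).trans (add_le_add_left (hK x hx) _)⟩, ?_,
    fun δ φ x hδ hφ hx hm hc => ?_, fun δ φ x hδ hφ hx hc hm =>
      h.boundary δ φ x hδ hφ hx hc (hmax hm)⟩
  · simp_rw [sub_eq_add_neg]
    exact h.usc.add continuous_const.continuousOn.upperSemicontinuousOn
  · obtain ⟨L, hL, hle⟩ := h.equation δ φ x hδ hφ hx (hmax hm) hc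
    refine ⟨L, hL, ?_⟩
    have : largeJumps μ η δ (fun x => u x - d) x = largeJumps μ η δ u x := by
      unfold largeJumps
      simp
    rw [this]
    unfold F at hle ⊢
    linarith

end

/-- The lower half-relaxed limit, which is minus the upper limit of the negatives, lies below the
upper one; the opposite inequality is comparison. -/
lemma upperLimit_add_upperLimit_neg_nonneg {u : ℕ → E n → ℝ} {K : ℝ} (hK : ∀ k x, |u k x| ≤ K)
    {x : E n} (hx : x ∈ closedHalf n) :
    0 ≤ upperLimit u x + upperLimit (fun k y => -u k y) x := by
  by_contra! hlt
  have hK' : ∀ k x, |(fun k y => -u k y) k x| ≤ K := fun k x => by simpa using hK k x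
  obtain ⟨a, ha1, ha2⟩ := exists_between
    (show upperLimit u x < -upperLimit (fun k y => -u k y) x by linarith)
  have := neBot_limit_filter hx
  obtain ⟨q, hq1, hq2⟩ := ((eventually_lt_of_upperLimit_lt hK ha1).and
    (eventually_lt_of_upperLimit_lt hK' (a := -a) (by linarith))).exists
  linarith

namespace JumpSetting

variable {c : ℕ} {ν σ : Measure (E n)} {η : E n → E n → E n} {cη : ℝ} {f g u v : E n → ℝ}

theorem comparison (h : JumpSetting c ν σ η cη) (hf : HypF f) (hg : HypF g)
    (hfg : ∀ x ∈ closedHalf n, f x ≤ g x) (hu : IsSubsolution c (ν + σ) η cη f u)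
    (hv : IsSupersolution c (ν + σ) η cη g v) {x : E n} (hx : x ∈ closedHalf n) : u x ≤ v x := by
  have := h.add_nonpos hu hv.neg hf.continuousOn hg.continuousOn.neg
    (fun x hx => by linarith [hfg x hx]) hx
  linarith

/-- Truncation at 1/(k+1) is stable under negation, so the stability theorem for subsolutions,
applied to the truncated solutions and to their negatives, yields both half-relaxed limits.
Comparison of these two limits replaces any equicontinuity estimate. -/
theorem exists_isSolution (h : JumpSetting c ν σ η cη) (hf : HypF f) :
    ∃ u, IsSolution c (ν + σ) η cη f u := by
  obtain ⟨K, hK⟩ := hf.bounded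
  have hb : ∀ k : ℕ, (0 : ℝ) < 1 / (k + 1) := fun k => by positivity
  have hb0 : Tendsto (fun k : ℕ => (1 : ℝ) / (k + 1)) atTop (𝓝 0) :=
    tendsto_one_div_add_atTop_nhds_zero_nat
  choose w hwc hwK hweq using fun k => h.exists_truncated_solution hf.continuousOn hK (hb k)
  have h1 := h.isSubsolution_upperLimit hf.continuousOn hwK hwc hb hb0 hweq
  have h2 := h.isSubsolution_upperLimit (f := fun x => -f x) (u := fun k x => -w k x)
    hf.continuousOn.neg (fun k x => by simpa using hwK k x) (fun k => (hwc k).neg) hb hb0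
    fun k x hx => by rw [largeJumps_neg, ← neg_add, ← hweq k x hx]
  refine ⟨upperLimit w, h1, ?_⟩
  have h3 := h2.neg
  simp only [neg_neg] at h3
  refine h3.congr h.eta fun x hx => ?_
  have h4 := h.add_nonpos h1 h2 hf.continuousOn hf.continuousOn.neg
    (fun x _ => by simp) hx
  have h5 := upperLimit_add_upperLimit_neg_nonneg hwK hx
  linarith

theorem isSolution_unique (h : JumpSetting c ν σ η cη) (hf : HypF f)
    (hu : IsSolution c (ν + σ) η cη f u) (hv : IsSolution c (ν + σ) η cη f v) :
    EqOn v u (closedHalf n) := fun _ hx =>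
  le_antisymm (h.comparison hf hf (fun _ _ => le_rfl) hv.1 hu.2 hx)
    (h.comparison hf hf (fun _ _ => le_rfl) hu.1 hv.2 hx)

/-- Subtracting d from a subsolution lowers its data by d, since the jump operator annihilates
constants; comparison then applies with data f − d ≤ g. -/
lemma sub_le_of_data (h : JumpSetting c ν σ η cη) (hf : HypF f) (hg : HypF g)
    (hu : IsSolution c (ν + σ) η cη f u) (hv : IsSolution c (ν + σ) η cη g v) {d : ℝ}
    (hfg : ∀ x ∈ closedHalf n, |f x - g x| ≤ d) {x : E n} (hx : x ∈ closedHalf n) :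
    u x - v x ≤ d := by
  have := h.add_nonpos (hu.1.sub_const d) hv.2.neg (hf.continuousOn.sub continuousOn_const)
    hg.continuousOn.neg (fun x hx => by linarith [le_abs_self (f x - g x), hfg x hx]) hx
  linarith

end JumpSetting

end NonlocalNeumann
-- Examples, comparison and well-posedness.
theorem mainTheorem1 (n c : ℕ)
    (μ μstar μsharp : MeasureTheory.Measure (NonlocalNeumann.E n))
    (hμ : NonlocalNeumann.HypMu c μ μstar μsharp) :
    -- the three non-censored reflections satisfy the assumptions on the jump function
    (∃ cη, NonlocalNeumann.HypEta μ NonlocalNeumann.fleas cη) ∧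
    (∃ cη, NonlocalNeumann.HypEta μ NonlocalNeumann.normalProjection cη) ∧
    (∃ cη, NonlocalNeumann.HypEta μ NonlocalNeumann.mirror cη) ∧
    ∀ (η : NonlocalNeumann.E n → NonlocalNeumann.E n → NonlocalNeumann.E n) (cη : ℝ),
      NonlocalNeumann.HypEta μ η cη →
      -- comparison
      (∀ f g u v : NonlocalNeumann.E n → ℝ,
        NonlocalNeumann.HypF f → NonlocalNeumann.HypF g →
        (∀ x ∈ NonlocalNeumann.closedHalf n, f x ≤ g x) →
        NonlocalNeumann.IsSubsolution c μ η cη f u →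
        NonlocalNeumann.IsSupersolution c μ η cη g v →
        ∀ x ∈ NonlocalNeumann.closedHalf n, u x ≤ v x) ∧
      -- existence and uniqueness
      (∀ f : NonlocalNeumann.E n → ℝ, NonlocalNeumann.HypF f →
        ∃ u, NonlocalNeumann.IsSolution c μ η cη f u ∧
          ∀ w, NonlocalNeumann.IsSolution c μ η cη f w →
            Set.EqOn w u (NonlocalNeumann.closedHalf n)) ∧
      -- continuous dependence on the data, in the supremum norm
      (∀ f u : NonlocalNeumann.E n → ℝ,
        NonlocalNeumann.HypF f → NonlocalNeumann.IsSolution c μ η cη f u →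
        ∀ ε > 0, ∃ δ > 0, ∀ g v : NonlocalNeumann.E n → ℝ,
          NonlocalNeumann.HypF g → NonlocalNeumann.IsSolution c μ η cη g v →
          (∀ x ∈ NonlocalNeumann.closedHalf n, |f x - g x| ≤ δ) →
          ∀ x ∈ NonlocalNeumann.closedHalf n, |u x - v x| ≤ ε) := by
  obtain ⟨ν, rfl, hν⟩ := hμ.exists_jumpSetting
  refine ⟨⟨1, NonlocalNeumann.hypEta_fleas _⟩, ⟨1, NonlocalNeumann.hypEta_normalProjection _⟩,
    ⟨1, NonlocalNeumann.hypEta_mirror _⟩, fun η cη hη => ?_⟩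
  have h := hν η cη hη
  -- The solution map is 1-Lipschitz in the supremum norm, so δ = ε serves for continuous
  -- dependence.
  refine ⟨fun f g u v hf hg hfg hu hv x hx => h.comparison hf hg hfg hu hv hx, fun f hf => ?_,
    fun f u hf hu ε hε => ⟨ε, hε, fun g v hg hv hfg x hx => abs_le.2 ⟨?_, ?_⟩⟩⟩
  · obtain ⟨u, hu⟩ := h.exists_isSolution hf
    exact ⟨u, hu, fun w hw => h.isSolution_unique hf hu hw⟩
  · have := h.sub_le_of_data hg hf hv hu (fun y hy => abs_sub_comm (f y) (g y) ▸ hfg y hy) hx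
    linarith
  · exact h.sub_le_of_data hf hg hu hv hfg hx
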